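/- **Model.** An abstract object is $\mathcal O=(Q,q_0,O,R,\Delta)$ with $\Delta:Q\times O\to Q\times R$ deterministic. An operation $o$ is *state-changing* if $\Delta(q,o)$ has state component $\ne q$ for some $q\in Q$, and *read-only* otherwise. Processes $p_1,\dots,p_n$ communicate through atomic CAS base objects (with primitives Read, Write, and $\mathrm{CAS}(X,old,new)$); each step of a process is one primitive on one base object plus local computation, and may return a response. Each process has at most one pending operation. The *memory representation* of a finite execution is the vector of states of all base objects in its last configuration; local variables are not part of it. **R-LLSC objects from CAS.** A releasable LL/SC object with values in $V$ is stored in one CAS object $X$ with state $(v,c)\in V\times\{0,1\}^n$ (value and context), initially $(v_0,0)$. Code for $p_i$: * $\mathrm{LL}$: repeat $cur\gets\mathrm{Read}(X)$ until $\mathrm{CAS}(X,cur,cur\text{ with }c_i:=1)$ succeeds; return $cur.v$. * $\mathrm{SC}(v)$: repeat: $cur\gets\mathrm{Read}(X)$; if $cur.c_i=0$ return false; if $\mathrm{CAS}(X,cur,(v,0))$ succeeds return true. * $\mathrm{RL}$: repeat: $cur\gets\mathrm{Read}(X)$; if $cur.c_i=0$ return true; if $\mathrm{CAS}(X,cur,cur\text{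 with }c_i:=0)$ succeeds return true. * $\mathrm{VL}$: read $X$, return whether $c_i=1$. $\mathrm{Load}$: read $X$, return $v$. $\mathrm{Store}(v)$: $\mathrm{Write}(X,(v,0))$. **Universal implementation** of $\mathcal O$. Shared R-LLSC variables, each implemented as above: $head$, with values in $Q\times(\{\bot\}\cup R\times\{1,\dots,n\})$, initially $\langle q_0,\bot\rangle$; and $announce[1..n]$, with values in the disjoint union $\{\bot\}\sqcup O\sqcup R$, initially $\bot$. Each $p_i$ has a local variable $priority_i$, initially $i$, which it keeps between operations. In "$A \parallel B$" the process interleaves the steps of $A$ and $B$, taking an unspecified but finite number of steps on one side before switching; the block ends when $A$ finishes or when $B$ executes its goto. A read-only $op$ by $p_i$: $\langle q,\_\rangle\gets\mathrm{Load}(head)$; return the response in $\Delta(q,op)$. A state-changing $op$ by $p_i$: 1. $\mathrm{Store}(announce[i],op)$. 2. While $\mathrm{Load}(announce[i])\notin R$: * (a) $\langle q,r\rangle\gets\mathrm{LL}(head)\ \parallel\ $ wait until $\mathrm{Load}(announce[i])\in R$; goto 3. * (b) If $r=\bot$: $help\gets\mathrm{Load}(announce[priority_i])$. If $help\in O$,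 let $(o,j)=(help,priority_i)$. Otherwise, if $\mathrm{Load}(announce[i])\notin O$, restart the loop; else let $(o,j)=(op,i)$. Let $(q',rsp)=\Delta(q,o)$. If $\mathrm{SC}(head,\langle q',\langle rsp,j\rangle\rangle)$ succeeds, advance $priority_i$ by one, cyclically in $\{1,\dots,n\}$. * (c) If $r=\langle rsp,j\rangle$: $a\gets\mathrm{LL}(announce[j])\ \parallel\ $ wait until $\mathrm{Load}(announce[i])\in R$; $\mathrm{RL}(announce[j])$; goto 3. Then, if $\mathrm{VL}(head)$ is true: if $a\in O$ do $\mathrm{SC}(announce[j],rsp)$; then (in either case) $\mathrm{SC}(head,\langle q,\bot\rangle)$. Finally, whatever $\mathrm{VL}$ returned, if $a=\bot$ do $\mathrm{RL}(announce[j])$. 3. $response\gets\mathrm{Load}(announce[i])$. 4. $\langle q,r\rangle\gets\mathrm{LL}(head)\ \parallel\ $ wait until $\mathrm{Load}(head)$ is not of the form $\langle\_,\langle\_,i\rangle\rangle$; goto the $\mathrm{RL}(head)$ in 5. 5. If $r=\langle\_,i\rangle$ do $\mathrm{SC}(head,\langle q,\bot\rangle)$, else $\mathrm{RL}(head)$.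 6. $\mathrm{Store}(announce[i],\bot)$; return $response$. **Theorem.** For every abstract object $\mathcal O$ and every $n$, this implementation of $\mathcal O$ for $n$ processes from atomic CAS objects is * *linearizable*: every execution has a linearization; * *wait-free*: every pending operation returns after finitely many steps of the process that invoked it; * *state-quiescent history independent*: there is a function $h$ that maps every finite execution $\alpha$ to a linearization $h(\alpha)$ of it such that, whenever $\alpha,\alpha'$ are finite executions after which no state-changing operation is pending, and $h(\alpha)$ and $h(\alpha')$ lead $\mathcal O$ from $q_0$ to the same state, the memory representations after $\alpha$ and $\alpha'$ are equal. If $Q$, $O$ and $R$ are finite, the CAS object that stores $head$ has $|Q|\,(n|R|+1)\,2^n$ possible states and the one that stores $announce[j]$ has $(|O|+|R|+1)\,2^n$. -/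

import Mathlib

universe u v w

/-! ## Abstract objects -/

/-- A deterministic abstract object `(Q, q₀, O, R, Δ)`. -/
structure AbstractObject : Type (u + 1) where
  State : Type u
  init : State
  Op : Type u
  Resp : Type u
  Δ : State → Op → State × Resp

namespace AbstractObject

/-- An operation is state-changing if it moves the object from some state to a different one. -/
def StateChanging (𝒪 : AbstractObject.{u}) (o : 𝒪.Op) : Prop :=
  ∃ q : 𝒪.State, (𝒪.Δ q o).1 ≠ q

/-- An operation is read-only if it is not state-changing. -/
def ReadOnly (𝒪 : AbstractObject.{u}) (o : 𝒪.Op) : Prop :=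
  ¬ 𝒪.StateChanging o

end AbstractObject

/-! ## The asynchronous shared-memory model with atomic CAS base objects -/

/-- One atomic primitive on one CAS base object (`read`, `write` or `cas`), followed by a local
computation that turns the response of the primitive into a result of type `β`.
`Val b` is the state space of the base object `b`. -/
inductive Access (Base : Type v) (Val : Base → Type u) (β : Type w) where
  | read (b : Base) (k : Val b → β)
  | write (b : Base) (x : Val b) (k : β)
  | cas (b : Base) (old new : Val b) (k : Bool → β)

namespace Access

variable {Base : Type v} {Val : Base → Type u} {β : Type w}

/-- Post-compose the local computation of an access. -/
def map {γ : Type*} (f : β → γ) : Access Base Val β → Access Base Val γ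
  | read b k => read b fun x => f (k x)
  | write b x k => write b x (f k)
  | cas b old new k => cas b old new fun c => f (k c)

open Classical in
/-- The effect of an access on the shared memory, and its result. -/
noncomputable def exec : Access Base Val β → (∀ b, Val b) → (∀ b, Val b) × β
  | read b k, mem => (mem, k (mem b))
  | write b x k, mem => (Function.update mem b x, k)
  | cas b old new k, mem =>
      if mem b = old then (Function.update mem b new, k true) else (mem, k false)

end Access

/-- The two sides of an interleaved block `left ∥ right` of a program. -/
inductive Side where
  | left
  | right

/-- An implementation of an abstract object for `n` processes from CAS base objects.

A program may contain interleaved blocks `left ∥ right`: in such a block every step is taken on one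
of the two sides. Which side moves next is not determined by the program, so `step` gets the side as
an argument (outside such blocks it is ignored). `mustServe s l` says that a process in local state
`l` is in an interleaved block whose side `s` it may not neglect forever. -/
structure Implementation (𝒪 : AbstractObject.{u}) (n : ℕ) where
  /-- the base objects -/
  Base : Type
  /-- the state space of each base object -/
  Val : Base → Type u
  /-- the initial shared memory -/
  initMem : ∀ b, Val b
  /-- the local states of a process -/
  Local : Type u
  initLocal : Fin n → Local
  /-- the local state when an operation is invoked -/
  start : Fin n → 𝒪.Op → Local → Local
  /-- the next step: one primitive, then a new local state and possibly a response -/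
  step : Fin n → Side → Local → Access Base Val (Local × Option 𝒪.Resp)
  mustServe : Side → Local → Prop

/-- Invocations and responses of higher-level operations. -/
inductive Event (𝒪 : AbstractObject.{u}) (n : ℕ) where
  | inv (p : Fin n) (o : 𝒪.Op)
  | res (p : Fin n) (r : 𝒪.Resp)

/-- The process of an event. -/
def Event.proc {𝒪 : AbstractObject.{u}} {n : ℕ} : Event 𝒪 n → Fin n
  | inv p _ => p
  | res p _ => p

/-- The labels of an execution: an invocation of an operation, or a step of a process, taken on a
given side, that possibly returns a response. -/
inductive ExecAction (𝒪 : AbstractObject.{u}) (n : ℕ) where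
  | invoke (p : Fin n) (o : 𝒪.Op)
  | step (p : Fin n) (s : Side) (r : Option 𝒪.Resp)

/-- The event of the history, if any, at an action of an execution. -/
def ExecAction.event {𝒪 : AbstractObject.{u}} {n : ℕ} : ExecAction 𝒪 n → Option (Event 𝒪 n)
  | invoke p o => some (Event.inv p o)
  | step p _ r => r.map (Event.res p)

/-- A history. The index is the position in the execution; positions without an invocation or a
response hold `none`. -/
abbrev History (𝒪 : AbstractObject.{u}) (n : ℕ) := ℕ → Option (Event 𝒪 n)

/-- In `H`, the operation invoked at position `t` returns the response `r` at position `t'`. -/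
def Returns {𝒪 : AbstractObject.{u}} {n : ℕ} (H : History 𝒪 n) (t t' : ℕ) (r : 𝒪.Resp) : Prop :=
  ∃ p o, H t = some (Event.inv p o) ∧ t < t' ∧ H t' = some (Event.res p r) ∧
    ∀ x, t < x → x < t' → ∀ e, H x = some e → e.proc ≠ p

/-! ## Linearizability -/

/-- An operation of a sequential history: the invocation of `op` by `proc`, immediately followed by
the response `resp`. The position `time` of the invocation in the concurrent history identifies the
operation. -/
structure SeqOp (𝒪 : AbstractObject.{u}) (n : ℕ) where
  time : ℕ
  proc : Fin n
  op : 𝒪.Op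
  resp : 𝒪.Resp

/-- The state reached by a finite sequential history. -/
def seqState (𝒪 : AbstractObject.{u}) {n : ℕ} (L : List (SeqOp 𝒪 n)) : 𝒪.State :=
  L.foldl (fun q e => (𝒪.Δ q e.op).1) 𝒪.init

/-- The finite or infinite sequential history `L` (`L k` is its `k`-th operation, if there is one)
is a linearization of the history `H`. -/
structure IsLinearization (𝒪 : AbstractObject.{u}) {n : ℕ} (H : History 𝒪 n)
    (L : ℕ → Option (SeqOp 𝒪 n)) : Prop where
  /-- `L` is a finite or infinite sequence, without gaps -/
  no_gap : ∀ k, L k = none → L (k + 1) = none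
  /-- every operation of `L` is an operation of `H` -/
  mem_history : ∀ k e, L k = some e → H e.time = some (Event.inv e.proc e.op)
  /-- no operation of `H` occurs twice -/
  nodup : ∀ k k' e e', L k = some e → L k' = some e' → e.time = e'.time → k = k'
  /-- every completed operation of `H` occurs (pending ones may be completed or dropped) -/
  complete : ∀ t t' r, Returns H t t' r → ∃ k e, L k = some e ∧ e.time = t
  /-- completed operations have the response that they have in `H` -/
  same_resp : ∀ k e t' r, L k = some e → Returns H e.time t' r → e.resp = r
  /-- `L` matches the sequential specification -/
  spec : ∃ q : ℕ → 𝒪.State, q 0 = 𝒪.init ∧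
    ∀ k e, L k = some e → 𝒪.Δ (q k) e.op = (q (k + 1), e.resp)
  /-- `L` respects the real-time order of non-overlapping operations -/
  real_time : ∀ k k' e e' t' r, L k = some e → L k' = some e' →
    Returns H e.time t' r → t' < e'.time → k < k'

namespace Implementation

variable {𝒪 : AbstractObject.{u}} {n : ℕ}

/-! ## Configurations and executions -/

/-- A configuration: the shared memory (the memory representation), the local state of every process
and its pending operation, if any. -/
structure Config (I : Implementation 𝒪 n) where
  mem : ∀ b, I.Val b
  loc : Fin n → I.Local
  pending : Fin n → Option 𝒪.Op

/-- The unique initial configuration. -/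
def initConfig (I : Implementation 𝒪 n) : I.Config where
  mem := I.initMem
  loc := I.initLocal
  pending := fun _ => none

/-- The configuration after an invocation of `o` by `p`. -/
def afterInvoke (I : Implementation 𝒪 n) (C : I.Config) (p : Fin n) (o : 𝒪.Op) : I.Config where
  mem := C.mem
  loc := Function.update C.loc p (I.start p o (C.loc p))
  pending := Function.update C.pending p (some o)

/-- New memory, new local state and response of the next step of `p`, taken on side `s`. -/
noncomputable def outcome (I : Implementation 𝒪 n) (C : I.Config) (p : Fin n) (s : Side) :
    (∀ b, I.Val b) × (I.Local × Option 𝒪.Resp) :=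
  (I.step p s (C.loc p)).exec C.mem

/-- The configuration after a step of `p` on side `s`. -/
noncomputable def afterStep (I : Implementation 𝒪 n) (C : I.Config) (p : Fin n) (s : Side) :
    I.Config where
  mem := (I.outcome C p s).1
  loc := Function.update C.loc p (I.outcome C p s).2.1
  pending := match (I.outcome C p s).2.2 with
    | none => C.pending
    | some _ => Function.update C.pending p none

/-- The transition relation: an idle process may receive any invocation, a process with a pending
operation may take its next step. -/
inductive Step (I : Implementation 𝒪 n) : I.Config → ExecAction 𝒪 n → I.Config → Prop where
  | invoke (C : I.Config) (p : Fin n) (o : 𝒪.Op) (h : C.pending p = none) :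
      Step I C (ExecAction.invoke p o) (I.afterInvoke C p o)
  | step (C : I.Config) (p : Fin n) (s : Side) (h : C.pending p ≠ none) :
      Step I C (ExecAction.step p s (I.outcome C p s).2.2) (I.afterStep C p s)

/-- `I.Reach as C`: the actions `as`, performed from the initial configuration, lead to `C`. -/
inductive Reach (I : Implementation 𝒪 n) : List (ExecAction 𝒪 n) → I.Config → Prop where
  | nil : Reach I [] I.initConfig
  | snoc {as : List (ExecAction 𝒪 n)} {C C' : I.Config} {a : ExecAction 𝒪 n} :
      Reach I as C → I.Step C a C' → Reach I (as ++ [a]) C'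

/-- Finite executions. The intermediate configurations are determined by the actions. -/
structure FinExec (I : Implementation 𝒪 n) where
  acts : List (ExecAction 𝒪 n)
  last : I.Config
  reach : I.Reach acts last

/-- Infinite executions. -/
structure InfExec (I : Implementation 𝒪 n) where
  cfg : ℕ → I.Config
  act : ℕ → ExecAction 𝒪 n
  init : cfg 0 = I.initConfig
  step : ∀ t, I.Step (cfg t) (act t) (cfg (t + 1))

/-- The history of a finite execution. -/
def FinExec.history {I : Implementation 𝒪 n} (α : I.FinExec) : History 𝒪 n :=
  fun t => α.acts[t]?.bind ExecAction.event

/-- The history of an infinite execution. -/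
def InfExec.history {I : Implementation 𝒪 n} (ρ : I.InfExec) : History 𝒪 n :=
  fun t => (ρ.act t).event

/-! ## Correctness, progress and history independence -/

/-- Every execution, finite or infinite, has a linearization. -/
def Linearizable (I : Implementation 𝒪 n) : Prop :=
  (∀ α : I.FinExec, ∃ L : List (SeqOp 𝒪 n), IsLinearization 𝒪 α.history fun k => L[k]?) ∧
  (∀ ρ : I.InfExec, ∃ L : ℕ → Option (SeqOp 𝒪 n), IsLinearization 𝒪 ρ.history L)

/-- Process `p` takes infinitely many steps in `ρ`. -/
def InfExec.StepsInfinitely {I : Implementation 𝒪 n} (ρ : I.InfExec) (p : Fin n) : Prop :=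
  {t | ∃ s r, ρ.act t = ExecAction.step p s r}.Infinite

/-- The meaning of `left ∥ right`: a process takes an unspecified but finite number of steps on one
side before it switches to the other one. So a process that takes infinitely many steps and never
leaves an interleaved block keeps taking steps on each side that it must serve. -/
def InfExec.FairInterleaving {I : Implementation 𝒪 n} (ρ : I.InfExec) : Prop :=
  ∀ (p : Fin n) (s : Side) (T : ℕ), ρ.StepsInfinitely p →
    (∀ t, T ≤ t → I.mustServe s ((ρ.cfg t).loc p)) →
      ∃ t r, T ≤ t ∧ ρ.act t = ExecAction.step p s r

/-- Every operation returns after finitely many steps of the process that invoked it. -/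
def WaitFree (I : Implementation 𝒪 n) : Prop :=
  ∀ ρ : I.InfExec, ρ.FairInterleaving → ∀ (t : ℕ) (p : Fin n) (o : 𝒪.Op),
    ρ.history t = some (Event.inv p o) → ρ.StepsInfinitely p →
      ∃ t' r, Returns ρ.history t t' r

/-- History independence with respect to a set `E` of finite executions: for some linearization
function `h`, executions in `E` that end in the same state according to `h` end with the same
memory representation. -/
def HistoryIndependent (I : Implementation 𝒪 n) (E : Set I.FinExec) : Prop :=
  ∃ h : I.FinExec → List (SeqOp 𝒪 n),
    (∀ α, IsLinearization 𝒪 α.history fun k => (h α)[k]?) ∧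
    ∀ α ∈ E, ∀ β ∈ E, seqState 𝒪 (h α) = seqState 𝒪 (h β) → α.last.mem = β.last.mem

/-- A configuration is state-quiescent if no state-changing operation is pending. -/
def Config.StateQuiescent {I : Implementation 𝒪 n} (C : I.Config) : Prop :=
  ∀ p o, C.pending p = some o → ¬ 𝒪.StateChanging o

/-- History independence with respect to all finite executions that end in a state-quiescent
configuration. -/
def StateQuiescentHI (I : Implementation 𝒪 n) : Prop :=
  I.HistoryIndependent {α | α.last.StateQuiescent}

end Implementation

/-! ## Releasable LL/SC objects from CAS

The R-LLSC object `b` with values in `W b` is stored in one CAS base object, whose state is a value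
together with one bit per process for the context. -/

/-- The state of the CAS object that stores an R-LLSC object: a value and the context bits. -/
@[ext]
structure Cell (W : Type u) (n : ℕ) where
  val : W
  context : Fin n → Bool

/-- A cell with empty context. -/
def Cell.fresh {W : Type u} {n : ℕ} (x : W) : Cell W n := ⟨x, fun _ => false⟩

/-- Overwrite the context bit of process `i`. -/
def Cell.setBit {W : Type u} {n : ℕ} (c : Cell W n) (i : Fin n) (x : Bool) : Cell W n :=
  ⟨c.val, Function.update c.context i x⟩

/-- Program counter of the procedures LL, SC and RL: about to read the CAS object, or about to
perform a CAS with expected value `cur`. -/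
inductive Retry (W : Type u) (n : ℕ) : Type u where
  | read
  | cas (cur : Cell W n)

namespace RLLSC

variable {Base : Type v} {W : Base → Type u} {n : ℕ} {β : Type w}

/-- The next step of LL on `b` by process `i`. The result is a new program counter (`inl`) or the
returned value (`inr`). -/
def ll (b : Base) (i : Fin n) :
    Retry (W b) n → Access Base (fun b => Cell (W b) n) (Retry (W b) n ⊕ W b)
  | .read => .read b fun cur => .inl (.cas cur)
  | .cas cur => .cas b cur (cur.setBit i true) fun ok => if ok then .inr cur.val else .inl .read

/-- The next step of SC of `x` to `b` by process `i`. -/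
def sc (b : Base) (i : Fin n) (x : W b) :
    Retry (W b) n → Access Base (fun b => Cell (W b) n) (Retry (W b) n ⊕ Bool)
  | .read => .read b fun cur => if cur.context i then .inl (.cas cur) else .inr false
  | .cas cur => .cas b cur (Cell.fresh x) fun ok => if ok then .inr true else .inl .read

/-- The next step of RL on `b` by process `i`. -/
def rl (b : Base) (i : Fin n) :
    Retry (W b) n → Access Base (fun b => Cell (W b) n) (Retry (W b) n ⊕ Bool)
  | .read => .read b fun cur => if cur.context i then .inl (.cas cur) else .inr true
  | .cas cur => .cas b cur (cur.setBit i false) fun ok => if ok then .inr true else .inl .read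

/-- VL on `b` by process `i`: a single read. -/
def vl (b : Base) (i : Fin n) : Access Base (fun b => Cell (W b) n) Bool :=
  .read b fun cur => cur.context i

/-- Load of `b`: a single read. -/
def load (b : Base) : Access Base (fun b => Cell (W b) n) (W b) :=
  .read b fun cur => cur.val

/-- Store of `x` to `b`: a single write. -/
def store (b : Base) (x : W b) : Access Base (fun b => Cell (W b) n) Bool :=
  .write b (Cell.fresh x) true

end RLLSC

/-! ## The universal implementation -/

namespace Universal

/-- The R-LLSC variables: `head` and the array `announce`. -/
inductive Var (n : ℕ) : Type where
  | head
  | announce (j : Fin n)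

/-- Values of `head`: `⟨q, ⊥⟩` or `⟨q, ⟨r, j⟩⟩`. -/
abbrev HeadVal (𝒪 : AbstractObject.{u}) (n : ℕ) : Type u := 𝒪.State × Option (𝒪.Resp × Fin n)

/-- Values of a cell of `announce`: the disjoint union of `{⊥}`, the operations and the
responses. -/
inductive AnnVal (𝒪 : AbstractObject.{u}) : Type u where
  | bot
  | op (o : 𝒪.Op)
  | rsp (r : 𝒪.Resp)

/-- The value domain of each R-LLSC variable. -/
def Dom (𝒪 : AbstractObject.{u}) (n : ℕ) : Var n → Type u
  | .head => HeadVal 𝒪 n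
  | .announce _ => AnnVal 𝒪

/-- The state space of the CAS object behind each R-LLSC variable. -/
abbrev CellOf (𝒪 : AbstractObject.{u}) (n : ℕ) (b : Var n) : Type u := Cell (Dom 𝒪 n b) n

/-- Program counters; each one stands for the next R-LLSC operation, together with the local
variables that are still needed. `op` is the operation being executed. -/
inductive PC (𝒪 : AbstractObject.{u}) (n : ℕ) : Type u where
  /-- no operation is being executed -/
  | idle
  /-- read-only operations: `Load(head)` -/
  | readOnly (op : 𝒪.Op)
  /-- `Store(announce[i], op)` -/
  | announceOp (op : 𝒪.Op)
  /-- loop test: `Load(announce[i]) ∉ R` -/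
  | loopTest (op : 𝒪.Op)
  /-- `⟨q, r⟩ ← LL(head)  ∥  wait until Load(announce[i]) ∈ R; goto loadResponse` -/
  | llHead (op : 𝒪.Op) (c : Retry (HeadVal 𝒪 n) n)
  /-- `help ← Load(announce[priority])` -/
  | loadHelp (op : 𝒪.Op) (q : 𝒪.State)
  /-- `Load(announce[i]) ∉ O` -/
  | loadOwn (op : 𝒪.Op) (q : 𝒪.State)
  /-- `SC(head, ⟨state, ⟨rsp, j⟩⟩)` -/
  | scApply (op : 𝒪.Op) (state : 𝒪.State) (rsp : 𝒪.Resp) (j : Fin n)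
      (c : Retry (HeadVal 𝒪 n) n)
  /-- `a ← LL(announce[j])  ∥  wait until Load(announce[i]) ∈ R; RL(announce[j]);
  goto loadResponse`. The program counter of the right side is `none` while it waits and
  `some d` when it executes `RL(announce[j])`. -/
  | llAnnounce (op : 𝒪.Op) (q : 𝒪.State) (rsp : 𝒪.Resp) (j : Fin n)
      (c : Retry (AnnVal 𝒪) n) (right : Option (Retry (AnnVal 𝒪) n))
  /-- `VL(head)` -/
  | vlHead (op : 𝒪.Op) (q : 𝒪.State) (rsp : 𝒪.Resp) (j : Fin n) (a : AnnVal 𝒪)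
  /-- `SC(announce[j], rsp)` -/
  | scAnnounce (op : 𝒪.Op) (q : 𝒪.State) (rsp : 𝒪.Resp) (j : Fin n) (a : AnnVal 𝒪)
      (c : Retry (AnnVal 𝒪) n)
  /-- `SC(head, ⟨q, ⊥⟩)` inside the loop -/
  | scHeadBot (op : 𝒪.Op) (q : 𝒪.State) (j : Fin n) (a : AnnVal 𝒪)
      (c : Retry (HeadVal 𝒪 n) n)
  /-- `RL(announce[j])` -/
  | rlAnnounce (op : 𝒪.Op) (j : Fin n) (c : Retry (AnnVal 𝒪) n)
  /-- `response ← Load(announce[i])` -/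
  | loadResponse
  /-- `⟨q, r⟩ ← LL(head)  ∥  wait until Load(head) ≠ ⟨_, ⟨_, i⟩⟩; goto rlHead` -/
  | llHeadEnd (response : 𝒪.Resp) (c : Retry (HeadVal 𝒪 n) n)
  /-- `SC(head, ⟨q, ⊥⟩)` after the loop -/
  | scHeadEnd (response : 𝒪.Resp) (q : 𝒪.State) (c : Retry (HeadVal 𝒪 n) n)
  /-- `RL(head)` -/
  | rlHead (response : 𝒪.Resp) (c : Retry (HeadVal 𝒪 n) n)
  /-- `Store(announce[i], ⊥)`, then return -/
  | clearAnnounce (response : 𝒪.Resp)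

/-- The local state of a process: the variable `priority`, which survives between operations, and
the program counter. -/
structure LocalState (𝒪 : AbstractObject.{u}) (n : ℕ) : Type u where
  priority : Fin n
  pc : PC 𝒪 n

/-- Successor modulo `n`. -/
def succMod {n : ℕ} (p : Fin n) : Fin n :=
  ⟨(p.1 + 1) % n, Nat.mod_lt _ (Nat.lt_of_le_of_lt (Nat.zero_le _) p.2)⟩

variable {𝒪 : AbstractObject.{u}} {n : ℕ}

/-- The end of the branch in which `head` held a response:
`if a = ⊥ then RL(announce[j])`, then back to the loop test. -/
def afterHelp (op : 𝒪.Op) (j : Fin n) : AnnVal 𝒪 → PC 𝒪 n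
  | .bot => .rlAnnounce op j .read
  | .op _ => .loopTest op
  | .rsp _ => .loopTest op

open Classical in
/-- An invocation starts `ApplyReadOnly` or `Apply`, depending on the operation. -/
noncomputable def start (op : 𝒪.Op) (l : LocalState 𝒪 n) : LocalState 𝒪 n :=
  { l with pc := if 𝒪.ReadOnly op then .readOnly op else .announceOp op }

/-- Continue with program counter `pc`, without returning. -/
def goto (l : LocalState 𝒪 n) (pc : PC 𝒪 n) : LocalState 𝒪 n × Option 𝒪.Resp :=
  ({ l with pc := pc }, none)

/-- Return the response `r`. -/
def ret (l : LocalState 𝒪 n) (r : 𝒪.Resp) : LocalState 𝒪 n × Option 𝒪.Resp :=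
  ({ l with pc := .idle }, some r)

/-- The next step of process `i`: the next primitive of the R-LLSC operation being executed, and
all local computation up to the primitive after it. -/
def step (i : Fin n) (s : Side) (l : LocalState 𝒪 n) :
    Access (Var n) (CellOf 𝒪 n) (LocalState 𝒪 n × Option 𝒪.Resp) :=
  match l.pc with
  -- never executed: a process without pending operation takes no steps
  | .idle => (RLLSC.load (W := Dom 𝒪 n) .head).map fun _ => goto l .idle
  | .readOnly op => (RLLSC.load (W := Dom 𝒪 n) .head).map fun (v : HeadVal 𝒪 n) =>
      ret l (𝒪.Δ v.1 op).2
  | .announceOp op => (RLLSC.store (W := Dom 𝒪 n) (.announce i) (AnnVal.op op)).map fun _ =>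
      goto l (.loopTest op)
  | .loopTest op => (RLLSC.load (W := Dom 𝒪 n) (.announce i)).map fun (v : AnnVal 𝒪) =>
      match v with
      | .rsp _ => goto l .loadResponse
      | _ => goto l (.llHead op .read)
  | .llHead op c =>
      match s with
      | .left => (RLLSC.ll (W := Dom 𝒪 n) .head i c).map fun
          (x : Retry (HeadVal 𝒪 n) n ⊕ HeadVal 𝒪 n) =>
          match x with
          | .inl c' => goto l (.llHead op c')
          | .inr (q, none) => goto l (.loadHelp op q)
          | .inr (q, some (rsp, j)) => goto l (.llAnnounce op q rsp j .read none)
      | .right => (RLLSC.load (W := Dom 𝒪 n) (.announce i)).map fun (v : AnnVal 𝒪) =>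
          match v with
          | .rsp _ => goto l .loadResponse
          | _ => goto l (.llHead op c)
  | .loadHelp op q =>
      (RLLSC.load (W := Dom 𝒪 n) (.announce l.priority)).map fun (v : AnnVal 𝒪) =>
        match v with
        | .op help => goto l (.scApply op (𝒪.Δ q help).1 (𝒪.Δ q help).2 l.priority .read)
        | _ => goto l (.loadOwn op q)
  | .loadOwn op q => (RLLSC.load (W := Dom 𝒪 n) (.announce i)).map fun (v : AnnVal 𝒪) =>
      match v with
      | .op _ => goto l (.scApply op (𝒪.Δ q op).1 (𝒪.Δ q op).2 i .read)
      | _ => goto l (.loopTest op)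
  | .scApply op state rsp j c =>
      (RLLSC.sc (W := Dom 𝒪 n) .head i (state, some (rsp, j)) c).map fun
        (x : Retry (HeadVal 𝒪 n) n ⊕ Bool) =>
        match x with
        | .inl c' => goto l (.scApply op state rsp j c')
        | .inr true => goto { l with priority := succMod l.priority } (.loopTest op)
        | .inr false => goto l (.loopTest op)
  | .llAnnounce op q rsp j c right =>
      match s, right with
      | .left, _ => (RLLSC.ll (W := Dom 𝒪 n) (.announce j) i c).map fun
          (x : Retry (AnnVal 𝒪) n ⊕ AnnVal 𝒪) =>
          match x with
          | .inl c' => goto l (.llAnnounce op q rsp j c' right)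
          | .inr a => goto l (.vlHead op q rsp j a)
      | .right, none => (RLLSC.load (W := Dom 𝒪 n) (.announce i)).map fun (v : AnnVal 𝒪) =>
          match v with
          | .rsp _ => goto l (.llAnnounce op q rsp j c (some .read))
          | _ => goto l (.llAnnounce op q rsp j c none)
      | .right, some d => (RLLSC.rl (W := Dom 𝒪 n) (.announce j) i d).map fun
          (x : Retry (AnnVal 𝒪) n ⊕ Bool) =>
          match x with
          | .inl d' => goto l (.llAnnounce op q rsp j c (some d'))
          | .inr _ => goto l .loadResponse
  | .vlHead op q rsp j a => (RLLSC.vl (W := Dom 𝒪 n) .head i).map fun ok =>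
      match ok, a with
      | true, .op _ => goto l (.scAnnounce op q rsp j a .read)
      | true, _ => goto l (.scHeadBot op q j a .read)
      | false, _ => goto l (afterHelp op j a)
  | .scAnnounce op q rsp j a c =>
      (RLLSC.sc (W := Dom 𝒪 n) (.announce j) i (AnnVal.rsp rsp) c).map fun
        (x : Retry (AnnVal 𝒪) n ⊕ Bool) =>
        match x with
        | .inl c' => goto l (.scAnnounce op q rsp j a c')
        | .inr _ => goto l (.scHeadBot op q j a .read)
  | .scHeadBot op q j a c => (RLLSC.sc (W := Dom 𝒪 n) .head i (q, none) c).map fun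
      (x : Retry (HeadVal 𝒪 n) n ⊕ Bool) =>
      match x with
      | .inl c' => goto l (.scHeadBot op q j a c')
      | .inr _ => goto l (afterHelp op j a)
  | .rlAnnounce op j c => (RLLSC.rl (W := Dom 𝒪 n) (.announce j) i c).map fun
      (x : Retry (AnnVal 𝒪) n ⊕ Bool) =>
      match x with
      | .inl c' => goto l (.rlAnnounce op j c')
      | .inr _ => goto l (.loopTest op)
  | .loadResponse => (RLLSC.load (W := Dom 𝒪 n) (.announce i)).map fun (v : AnnVal 𝒪) =>
      match v with
      | .rsp r => goto l (.llHeadEnd r .read)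
      -- the value read here is always a response; the other cases only make the code total
      | _ => goto l .loadResponse
  | .llHeadEnd response c =>
      match s with
      | .left => (RLLSC.ll (W := Dom 𝒪 n) .head i c).map fun
          (x : Retry (HeadVal 𝒪 n) n ⊕ HeadVal 𝒪 n) =>
          match x with
          | .inl c' => goto l (.llHeadEnd response c')
          | .inr (_, none) => goto l (.rlHead response .read)
          | .inr (q, some (_, j)) =>
              if j = i then goto l (.scHeadEnd response q .read)
              else goto l (.rlHead response .read)
      | .right => (RLLSC.load (W := Dom 𝒪 n) .head).map fun (v : HeadVal 𝒪 n) =>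
          match v with
          | (_, none) => goto l (.rlHead response .read)
          | (_, some (_, j)) =>
              if j = i then goto l (.llHeadEnd response c) else goto l (.rlHead response .read)
  | .scHeadEnd response q c => (RLLSC.sc (W := Dom 𝒪 n) .head i (q, none) c).map fun
      (x : Retry (HeadVal 𝒪 n) n ⊕ Bool) =>
      match x with
      | .inl c' => goto l (.scHeadEnd response q c')
      | .inr _ => goto l (.clearAnnounce response)
  | .rlHead response c => (RLLSC.rl (W := Dom 𝒪 n) .head i c).map fun
      (x : Retry (HeadVal 𝒪 n) n ⊕ Bool) =>
      match x with
      | .inl c' => goto l (.rlHead response c')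
      | .inr _ => goto l (.clearAnnounce response)
  | .clearAnnounce response =>
      (RLLSC.store (W := Dom 𝒪 n) (.announce i) AnnVal.bot).map fun _ => ret l response

/-- In an interleaved block both sides have to be served as long as the right side is waiting; once
the wait is over, only the right side (left steps remain possible). -/
def mustServe (s : Side) (l : LocalState 𝒪 n) : Prop :=
  match l.pc with
  | .llHead _ _ => True
  | .llAnnounce _ _ _ _ _ none => True
  | .llAnnounce _ _ _ _ _ (some _) => s = .right
  | .llHeadEnd _ _ => True
  | _ => False

/-- The initial values of the R-LLSC variables: `⟨q₀, ⊥⟩` for `head`, `⊥` for `announce`. -/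
def initVal (𝒪 : AbstractObject.{u}) (n : ℕ) : ∀ b : Var n, Dom 𝒪 n b
  | .head => (𝒪.init, none)
  | .announce _ => AnnVal.bot

end Universal

/-- The universal implementation of `𝒪` for `n` processes from atomic CAS objects. -/
noncomputable def universalImplementation (𝒪 : AbstractObject.{u}) (n : ℕ) :
    Implementation 𝒪 n where
  Base := Universal.Var n
  Val := Universal.CellOf 𝒪 n
  initMem := fun b => Cell.fresh (Universal.initVal 𝒪 n b)
  Local := Universal.LocalState 𝒪 n
  initLocal := fun i => ⟨i, .idle⟩
  start := fun _ op l => Universal.start op l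
  step := Universal.step
  mustServe := Universal.mustServe

/-! A context bit of a process is set only by its own LL and is erased by every SC or Store. While
the bit is set, the value of the cell is therefore the one that was linked. Accordingly `ProcInv`
records what a process knows about a linked cell as an implication whose premise is its context bit.
A CAS inside an SC expects a cell in which the bit is set, so its success discharges the premise,
whatever happened to the cell in between; the ABA problem does not arise.

Together with `HeadInv` this leaves few ways to change a value (`MemStep`). The value of `head`
passes from ⟨q, ⊥⟩ to ⟨q', ⟨rsp, j⟩⟩ only by a correct application of the operation that
`announce[j]` holds at that moment. That entry becomes `rsp` while `head` still holds it. Only then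
is `head` released to ⟨q', ⊥⟩, and the owner empties its entry only when `head` is not held for it.
So an announced operation is applied once and gets the response of that application.

Linearizability: a state-changing operation takes effect at the SC that puts its response into
`head`, possibly executed by a helper, and a read-only one at its load of `head`. `LinInv` maintains
a list of operations in this order whose final state is the state in `head`. The list only grows at
its end, so infinite executions are handled by a limit.

History independence: in a state-quiescent configuration all announcements are empty, hence `head`
holds no response. No process has a bit in `head`, and a bit in an empty announcement exists only
while its process is on the way to an RL (`BotLink`). The memory is thus a function of the state in
`head`, which is the final state of the linearization.

Wait-freedom: suppose that a process i takes infinitely many steps without returning. If the value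
of `head` changed only finitely often, bounded measures would freeze the announced values and then
the whole memory, and in constant memory every retry loop ends (`Stuck.headActive`). So `head`
changes forever. Some process then applies infinitely many operations; its priority runs through all
indices, so no announcement is ignored forever (`HeadActive.not_forever_op`). Hence i gets its
response. From then on its program position can only advance, so i ends up in a single loop. Waits
end by fairness. In an SC or RL, either the bit of i is lost, and the next read ends the loop, or
the bit stays set, and then the cell becomes constant and the CAS succeeds (`Stuck.elim`). -/

namespace Universal

variable {𝒪 : AbstractObject.{u}} {n : ℕ}

/-! ### The program as a transition relation on `head` and `announce` -/

/-- The head of the memory, as a cell. -/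
abbrev HeadCell (𝒪 : AbstractObject.{u}) (n : ℕ) : Type u := Cell (HeadVal 𝒪 n) n

/-- An entry of the announce array, as a cell. -/
abbrev AnnCell (𝒪 : AbstractObject.{u}) (n : ℕ) : Type u := Cell (AnnVal 𝒪) n

/-- All steps of process `p` on side `s`, in terms of the contents of `head` and `announce`:
`Trans p s H A l H' A' l' r` says that the step turns the memory `(H, A)` and the local state `l`
into `(H', A')` and `l'`, and returns `r`. -/
inductive Trans (p : Fin n) : Side → HeadCell 𝒪 n → (Fin n → AnnCell 𝒪 n) → LocalState 𝒪 n →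
    HeadCell 𝒪 n → (Fin n → AnnCell 𝒪 n) → LocalState 𝒪 n → Option 𝒪.Resp → Prop where
  | readOnly {s H A pr op} :
      Trans p s H A ⟨pr, .readOnly op⟩ H A ⟨pr, .idle⟩ (some (𝒪.Δ H.val.1 op).2)
  | announce {s H A pr op} :
      Trans p s H A ⟨pr, .announceOp op⟩ H (Function.update A p (Cell.fresh (.op op)))
        ⟨pr, .loopTest op⟩ none
  | loopExit {s H A pr op r} (h : (A p).val = .rsp r) :
      Trans p s H A ⟨pr, .loopTest op⟩ H A ⟨pr, .loadResponse⟩ none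
  | loopEnter {s H A pr op} (h : ∀ r, (A p).val ≠ .rsp r) :
      Trans p s H A ⟨pr, .loopTest op⟩ H A ⟨pr, .llHead op .read⟩ none
  | llHeadRead {H A pr op} :
      Trans p .left H A ⟨pr, .llHead op .read⟩ H A ⟨pr, .llHead op (.cas H)⟩ none
  | llHeadFail {H A pr op cur} (h : H ≠ cur) :
      Trans p .left H A ⟨pr, .llHead op (.cas cur)⟩ H A ⟨pr, .llHead op .read⟩ none
  | llHeadNone {H A pr op cur q} (h : H = cur) (hq : H.val = (q, none)) :
      Trans p .left H A ⟨pr, .llHead op (.cas cur)⟩ (H.setBit p true) A ⟨pr, .loadHelp op q⟩ none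
  | llHeadSome {H A pr op cur q rsp j} (h : H = cur) (hq : H.val = (q, some (rsp, j))) :
      Trans p .left H A ⟨pr, .llHead op (.cas cur)⟩ (H.setBit p true) A
        ⟨pr, .llAnnounce op q rsp j .read none⟩ none
  | llHeadExit {H A pr op c r} (h : (A p).val = .rsp r) :
      Trans p .right H A ⟨pr, .llHead op c⟩ H A ⟨pr, .loadResponse⟩ none
  | llHeadWait {H A pr op c} (h : ∀ r, (A p).val ≠ .rsp r) :
      Trans p .right H A ⟨pr, .llHead op c⟩ H A ⟨pr, .llHead op c⟩ none
  | loadHelpOp {s H A pr op q o} (h : (A pr).val = .op o) :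
      Trans p s H A ⟨pr, .loadHelp op q⟩ H A
        ⟨pr, .scApply op (𝒪.Δ q o).1 (𝒪.Δ q o).2 pr .read⟩ none
  | loadHelpNot {s H A pr op q} (h : ∀ o, (A pr).val ≠ .op o) :
      Trans p s H A ⟨pr, .loadHelp op q⟩ H A ⟨pr, .loadOwn op q⟩ none
  | loadOwnOp {s H A pr op q o} (h : (A p).val = .op o) :
      Trans p s H A ⟨pr, .loadOwn op q⟩ H A
        ⟨pr, .scApply op (𝒪.Δ q op).1 (𝒪.Δ q op).2 p .read⟩ none
  | loadOwnNot {s H A pr op q} (h : ∀ o, (A p).val ≠ .op o) :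
      Trans p s H A ⟨pr, .loadOwn op q⟩ H A ⟨pr, .loopTest op⟩ none
  | scApplyRead {s H A pr op st rsp j} (h : H.context p = true) :
      Trans p s H A ⟨pr, .scApply op st rsp j .read⟩ H A ⟨pr, .scApply op st rsp j (.cas H)⟩ none
  | scApplyFalse {s H A pr op st rsp j} (h : H.context p = false) :
      Trans p s H A ⟨pr, .scApply op st rsp j .read⟩ H A ⟨pr, .loopTest op⟩ none
  | scApplySucc {s H A pr op st rsp j cur} (h : H = cur) :
      Trans p s H A ⟨pr, .scApply op st rsp j (.cas cur)⟩ (Cell.fresh (st, some (rsp, j))) A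
        ⟨succMod pr, .loopTest op⟩ none
  | scApplyFail {s H A pr op st rsp j cur} (h : H ≠ cur) :
      Trans p s H A ⟨pr, .scApply op st rsp j (.cas cur)⟩ H A ⟨pr, .scApply op st rsp j .read⟩ none
  | llAnnRead {H A pr op q rsp j rt} :
      Trans p .left H A ⟨pr, .llAnnounce op q rsp j .read rt⟩ H A
        ⟨pr, .llAnnounce op q rsp j (.cas (A j)) rt⟩ none
  | llAnnFail {H A pr op q rsp j rt cur} (h : A j ≠ cur) :
      Trans p .left H A ⟨pr, .llAnnounce op q rsp j (.cas cur) rt⟩ H A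
        ⟨pr, .llAnnounce op q rsp j .read rt⟩ none
  | llAnnSucc {H A pr op q rsp j rt cur} (h : A j = cur) :
      Trans p .left H A ⟨pr, .llAnnounce op q rsp j (.cas cur) rt⟩
        H (Function.update A j ((A j).setBit p true)) ⟨pr, .vlHead op q rsp j (A j).val⟩ none
  | llAnnRsp {H A pr op q rsp j c r} (h : (A p).val = .rsp r) :
      Trans p .right H A ⟨pr, .llAnnounce op q rsp j c none⟩ H A
        ⟨pr, .llAnnounce op q rsp j c (some .read)⟩ none
  | llAnnWait {H A pr op q rsp j c} (h : ∀ r, (A p).val ≠ .rsp r) :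
      Trans p .right H A ⟨pr, .llAnnounce op q rsp j c none⟩ H A
        ⟨pr, .llAnnounce op q rsp j c none⟩ none
  | llAnnRlRead {H A pr op q rsp j c} (h : (A j).context p = true) :
      Trans p .right H A ⟨pr, .llAnnounce op q rsp j c (some .read)⟩ H A
        ⟨pr, .llAnnounce op q rsp j c (some (.cas (A j)))⟩ none
  | llAnnRlDone {H A pr op q rsp j c} (h : (A j).context p = false) :
      Trans p .right H A ⟨pr, .llAnnounce op q rsp j c (some .read)⟩ H A ⟨pr, .loadResponse⟩ none
  | llAnnRlSucc {H A pr op q rsp j c cur} (h : A j = cur) :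
      Trans p .right H A ⟨pr, .llAnnounce op q rsp j c (some (.cas cur))⟩
        H (Function.update A j ((A j).setBit p false)) ⟨pr, .loadResponse⟩ none
  | llAnnRlFail {H A pr op q rsp j c cur} (h : A j ≠ cur) :
      Trans p .right H A ⟨pr, .llAnnounce op q rsp j c (some (.cas cur))⟩ H A
        ⟨pr, .llAnnounce op q rsp j c (some .read)⟩ none
  | vlOp {s H A pr op q rsp j o} (h : H.context p = true) :
      Trans p s H A ⟨pr, .vlHead op q rsp j (.op o)⟩ H A
        ⟨pr, .scAnnounce op q rsp j (.op o) .read⟩ none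
  | vlNot {s H A pr op q rsp j a} (h : H.context p = true) (ha : ∀ o, a ≠ .op o) :
      Trans p s H A ⟨pr, .vlHead op q rsp j a⟩ H A ⟨pr, .scHeadBot op q j a .read⟩ none
  | vlFalse {s H A pr op q rsp j a} (h : H.context p = false) :
      Trans p s H A ⟨pr, .vlHead op q rsp j a⟩ H A ⟨pr, afterHelp op j a⟩ none
  | scAnnRead {s H A pr op q rsp j a} (h : (A j).context p = true) :
      Trans p s H A ⟨pr, .scAnnounce op q rsp j a .read⟩ H A
        ⟨pr, .scAnnounce op q rsp j a (.cas (A j))⟩ none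
  | scAnnFalse {s H A pr op q rsp j a} (h : (A j).context p = false) :
      Trans p s H A ⟨pr, .scAnnounce op q rsp j a .read⟩ H A ⟨pr, .scHeadBot op q j a .read⟩ none
  | scAnnSucc {s H A pr op q rsp j a cur} (h : A j = cur) :
      Trans p s H A ⟨pr, .scAnnounce op q rsp j a (.cas cur)⟩
        H (Function.update A j (Cell.fresh (.rsp rsp))) ⟨pr, .scHeadBot op q j a .read⟩ none
  | scAnnFail {s H A pr op q rsp j a cur} (h : A j ≠ cur) :
      Trans p s H A ⟨pr, .scAnnounce op q rsp j a (.cas cur)⟩ H A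
        ⟨pr, .scAnnounce op q rsp j a .read⟩ none
  | scBotRead {s H A pr op q j a} (h : H.context p = true) :
      Trans p s H A ⟨pr, .scHeadBot op q j a .read⟩ H A ⟨pr, .scHeadBot op q j a (.cas H)⟩ none
  | scBotFalse {s H A pr op q j a} (h : H.context p = false) :
      Trans p s H A ⟨pr, .scHeadBot op q j a .read⟩ H A ⟨pr, afterHelp op j a⟩ none
  | scBotSucc {s H A pr op q j a cur} (h : H = cur) :
      Trans p s H A ⟨pr, .scHeadBot op q j a (.cas cur)⟩ (Cell.fresh (q, none)) A
        ⟨pr, afterHelp op j a⟩ none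
  | scBotFail {s H A pr op q j a cur} (h : H ≠ cur) :
      Trans p s H A ⟨pr, .scHeadBot op q j a (.cas cur)⟩ H A ⟨pr, .scHeadBot op q j a .read⟩ none
  | rlAnnRead {s H A pr op j} (h : (A j).context p = true) :
      Trans p s H A ⟨pr, .rlAnnounce op j .read⟩ H A ⟨pr, .rlAnnounce op j (.cas (A j))⟩ none
  | rlAnnDone {s H A pr op j} (h : (A j).context p = false) :
      Trans p s H A ⟨pr, .rlAnnounce op j .read⟩ H A ⟨pr, .loopTest op⟩ none
  | rlAnnSucc {s H A pr op j cur} (h : A j = cur) :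
      Trans p s H A ⟨pr, .rlAnnounce op j (.cas cur)⟩
        H (Function.update A j ((A j).setBit p false)) ⟨pr, .loopTest op⟩ none
  | rlAnnFail {s H A pr op j cur} (h : A j ≠ cur) :
      Trans p s H A ⟨pr, .rlAnnounce op j (.cas cur)⟩ H A ⟨pr, .rlAnnounce op j .read⟩ none
  | loadResponse {s H A pr r} (h : (A p).val = .rsp r) :
      Trans p s H A ⟨pr, .loadResponse⟩ H A ⟨pr, .llHeadEnd r .read⟩ none
  | loadResponseStay {s H A pr} (h : ∀ r, (A p).val ≠ .rsp r) :
      Trans p s H A ⟨pr, .loadResponse⟩ H A ⟨pr, .loadResponse⟩ none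
  | endRead {H A pr r} :
      Trans p .left H A ⟨pr, .llHeadEnd r .read⟩ H A ⟨pr, .llHeadEnd r (.cas H)⟩ none
  | endFail {H A pr r cur} (h : H ≠ cur) :
      Trans p .left H A ⟨pr, .llHeadEnd r (.cas cur)⟩ H A ⟨pr, .llHeadEnd r .read⟩ none
  | endOwn {H A pr r cur q rsp} (h : H = cur) (hq : H.val = (q, some (rsp, p))) :
      Trans p .left H A ⟨pr, .llHeadEnd r (.cas cur)⟩ (H.setBit p true) A
        ⟨pr, .scHeadEnd r q .read⟩ none
  | endOther {H A pr r cur} (h : H = cur) (hq : ∀ q rsp, H.val ≠ (q, some (rsp, p))) :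
      Trans p .left H A ⟨pr, .llHeadEnd r (.cas cur)⟩ (H.setBit p true) A
        ⟨pr, .rlHead r .read⟩ none
  | endWait {H A pr r c q rsp} (hq : H.val = (q, some (rsp, p))) :
      Trans p .right H A ⟨pr, .llHeadEnd r c⟩ H A ⟨pr, .llHeadEnd r c⟩ none
  | endExit {H A pr r c} (hq : ∀ q rsp, H.val ≠ (q, some (rsp, p))) :
      Trans p .right H A ⟨pr, .llHeadEnd r c⟩ H A ⟨pr, .rlHead r .read⟩ none
  | scEndRead {s H A pr r q} (h : H.context p = true) :
      Trans p s H A ⟨pr, .scHeadEnd r q .read⟩ H A ⟨pr, .scHeadEnd r q (.cas H)⟩ none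
  | scEndFalse {s H A pr r q} (h : H.context p = false) :
      Trans p s H A ⟨pr, .scHeadEnd r q .read⟩ H A ⟨pr, .clearAnnounce r⟩ none
  | scEndSucc {s H A pr r q cur} (h : H = cur) :
      Trans p s H A ⟨pr, .scHeadEnd r q (.cas cur)⟩ (Cell.fresh (q, none)) A
        ⟨pr, .clearAnnounce r⟩ none
  | scEndFail {s H A pr r q cur} (h : H ≠ cur) :
      Trans p s H A ⟨pr, .scHeadEnd r q (.cas cur)⟩ H A ⟨pr, .scHeadEnd r q .read⟩ none
  | rlHeadRead {s H A pr r} (h : H.context p = true) :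
      Trans p s H A ⟨pr, .rlHead r .read⟩ H A ⟨pr, .rlHead r (.cas H)⟩ none
  | rlHeadDone {s H A pr r} (h : H.context p = false) :
      Trans p s H A ⟨pr, .rlHead r .read⟩ H A ⟨pr, .clearAnnounce r⟩ none
  | rlHeadSucc {s H A pr r cur} (h : H = cur) :
      Trans p s H A ⟨pr, .rlHead r (.cas cur)⟩ (H.setBit p false) A ⟨pr, .clearAnnounce r⟩ none
  | rlHeadFail {s H A pr r cur} (h : H ≠ cur) :
      Trans p s H A ⟨pr, .rlHead r (.cas cur)⟩ H A ⟨pr, .rlHead r .read⟩ none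
  | clear {s H A pr r} :
      Trans p s H A ⟨pr, .clearAnnounce r⟩ H (Function.update A p (Cell.fresh .bot)) ⟨pr, .idle⟩
        (some r)

/-- The contents of `head`. -/
def headOf (mem : ∀ b, CellOf 𝒪 n b) : HeadCell 𝒪 n := mem .head

/-- The contents of `announce`. -/
def annOf (mem : ∀ b, CellOf 𝒪 n b) (j : Fin n) : AnnCell 𝒪 n := mem (.announce j)

theorem headOf_update_head [DecidableEq (Var n)] (mem : ∀ b, CellOf 𝒪 n b)
    (x : CellOf 𝒪 n .head) : headOf (Function.update mem .head x) = x :=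
  Function.update_self ..

theorem annOf_update_head [DecidableEq (Var n)] (mem : ∀ b, CellOf 𝒪 n b)
    (x : CellOf 𝒪 n .head) : annOf (Function.update mem .head x) = annOf mem :=
  funext fun _ => Function.update_of_ne (by simp) ..

theorem headOf_update_ann [DecidableEq (Var n)] (mem : ∀ b, CellOf 𝒪 n b) (i : Fin n)
    (x : CellOf 𝒪 n (.announce i)) :
    headOf (Function.update mem (.announce i) x) = headOf mem :=
  Function.update_of_ne (by simp) ..

theorem annOf_update_ann [DecidableEq (Var n)] (mem : ∀ b, CellOf 𝒪 n b) (i : Fin n)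
    (x : CellOf 𝒪 n (.announce i)) :
    annOf (Function.update mem (.announce i) x) = Function.update (annOf mem) i x := by
  funext j
  by_cases h : j = i
  · subst h
    exact (Function.update_self ..).trans
      (Function.update_self (β := fun _ => AnnCell 𝒪 n) j x (annOf mem)).symm
  · have h' : (Var.announce j : Var n) ≠ .announce i := fun e => h (by injection e)
    exact (Function.update_of_ne h' ..).trans
      (Function.update_of_ne (β := fun _ => AnnCell 𝒪 n) h x (annOf mem)).symm

/-- Lets a constructor of `Trans` be applied when the new memory and local state match its
conclusion only up to a proved equality, as happens with `Function.update` on the dependent memory.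
-/
theorem trans_congr {p : Fin n} {s : Side} {H H₁ H₂ : HeadCell 𝒪 n} {A A₁ A₂ : Fin n → AnnCell 𝒪 n}
    {l l₁ l₂ : LocalState 𝒪 n} {r₁ r₂ : Option 𝒪.Resp} (h : Trans p s H A l H₁ A₁ l₁ r₁)
    (hH : H₂ = H₁) (hA : A₂ = A₁) (hl : (l₂, r₂) = (l₁, r₁)) : Trans p s H A l H₂ A₂ l₂ r₂ := by
  cases hH; cases hA; cases hl; exact h

open Classical in
theorem trans_of_step (p : Fin n) (s : Side) (l : LocalState 𝒪 n) (mem : ∀ b, CellOf 𝒪 n b)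
    (hl : l.pc ≠ .idle) :
    Trans p s (headOf mem) (annOf mem) l (headOf ((step p s l).exec mem).1)
      (annOf ((step p s l).exec mem).1) ((step p s l).exec mem).2.1
      ((step p s l).exec mem).2.2 := by
  rcases l with ⟨pr, pc⟩
  have reads : ∀ {β : Type u} (b : Var n) (k : CellOf 𝒪 n b → β),
      (Access.read (Val := CellOf 𝒪 n) b k).exec mem = (mem, k (mem b)) := fun _ _ => rfl
  have casPos : ∀ {β : Type u} (b : Var n) (old new : CellOf 𝒪 n b) (k : Bool → β), mem b = old →
      (Access.cas (Val := CellOf 𝒪 n) b old new k).exec mem = (Function.update mem b new, k true) :=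
    fun b old new k h => if_pos h
  have casNeg : ∀ {β : Type u} (b : Var n) (old new : CellOf 𝒪 n b) (k : Bool → β), mem b ≠ old →
      (Access.cas (Val := CellOf 𝒪 n) b old new k).exec mem = (mem, k false) :=
    fun b old new k h => if_neg h
  have hA : ∀ j, annOf mem j = mem (.announce j) := fun _ => rfl
  have hH : headOf mem = mem .head := rfl
  cases pc with
  | idle => exact absurd rfl hl
  | readOnly op => exact .readOnly
  | announceOp op =>
    exact trans_congr .announce (headOf_update_ann ..) (annOf_update_ann ..) rfl
  | loopTest op =>
    simp only [step, RLLSC.load, Access.map, reads]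
    rcases h : (annOf mem p).val with _ | o | r
    · exact trans_congr (.loopEnter (by simp [h])) rfl rfl (by rw [hA] at h; rw [h]; rfl)
    · exact trans_congr (.loopEnter (by simp [h])) rfl rfl (by rw [hA] at h; rw [h]; rfl)
    · exact trans_congr (.loopExit h) rfl rfl (by rw [hA] at h; rw [h]; rfl)
  | llHead op c =>
    cases s with
    | left =>
      rcases c with _ | cur
      · exact .llHeadRead
      · simp only [step, RLLSC.ll, Access.map]
        by_cases h : mem .head = cur
        · rw [casPos _ _ _ _ h]
          subst h
          rcases h : headOf mem with ⟨⟨q, _ | ⟨rsp, j⟩⟩, ctx⟩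
          · rw [← h]
            refine trans_congr (.llHeadNone (q := q) hH (by rw [h])) (headOf_update_head ..)
              (annOf_update_head ..) ?_
            rw [← hH, h]; rfl
          · rw [← h]
            refine trans_congr (.llHeadSome (q := q) (rsp := rsp) (j := j) hH (by rw [h]))
              (headOf_update_head ..) (annOf_update_head ..) ?_
            rw [← hH, h]; rfl
        · rw [casNeg _ _ _ _ h]
          exact .llHeadFail h
    | right =>
      simp only [step, RLLSC.load, Access.map, reads]
      rcases h : (annOf mem p).val with _ | o | r
      · exact trans_congr (.llHeadWait (by simp [h])) rfl rfl (by rw [hA] at h; rw [h]; rfl)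
      · exact trans_congr (.llHeadWait (by simp [h])) rfl rfl (by rw [hA] at h; rw [h]; rfl)
      · exact trans_congr (.llHeadExit h) rfl rfl (by rw [hA] at h; rw [h]; rfl)
  | loadHelp op q =>
    simp only [step, RLLSC.load, Access.map, reads]
    rcases h : (annOf mem pr).val with _ | o | r
    · exact trans_congr (.loadHelpNot (by simp [h])) rfl rfl (by rw [hA] at h; rw [h]; rfl)
    · exact trans_congr (.loadHelpOp h) rfl rfl (by rw [hA] at h; rw [h]; rfl)
    · exact trans_congr (.loadHelpNot (by simp [h])) rfl rfl (by rw [hA] at h; rw [h]; rfl)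
  | loadOwn op q =>
    simp only [step, RLLSC.load, Access.map, reads]
    rcases h : (annOf mem p).val with _ | o | r
    · exact trans_congr (.loadOwnNot (by simp [h])) rfl rfl (by rw [hA] at h; rw [h]; rfl)
    · exact trans_congr (.loadOwnOp h) rfl rfl (by rw [hA] at h; rw [h]; rfl)
    · exact trans_congr (.loadOwnNot (by simp [h])) rfl rfl (by rw [hA] at h; rw [h]; rfl)
  | scApply op st rsp j c =>
    rcases c with _ | cur
    · simp only [step, RLLSC.sc, Access.map, reads]
      rcases h : (headOf mem).context p
      · exact trans_congr (.scApplyFalse h) rfl rfl (by rw [hH] at h; rw [h]; rfl)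
      · exact trans_congr (.scApplyRead h) rfl rfl (by rw [hH] at h; rw [h]; rfl)
    · simp only [step, RLLSC.sc, Access.map]
      by_cases h : mem .head = cur
      · rw [casPos _ _ _ _ h]
        exact trans_congr (.scApplySucc h) (headOf_update_head ..) (annOf_update_head ..) rfl
      · rw [casNeg _ _ _ _ h]
        exact .scApplyFail h
  | llAnnounce op q rsp j c right =>
    cases s with
    | left =>
      rcases c with _ | cur
      · exact .llAnnRead
      · simp only [step, RLLSC.ll, Access.map]
        by_cases h : mem (.announce j) = cur
        · rw [casPos _ _ _ _ h]
          subst h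
          exact trans_congr (.llAnnSucc rfl) (headOf_update_ann ..) (annOf_update_ann ..) rfl
        · rw [casNeg _ _ _ _ h]
          exact .llAnnFail h
    | right =>
      rcases right with _ | _ | cur
      · simp only [step, RLLSC.load, Access.map, reads]
        rcases h : (annOf mem p).val with _ | o | r
        · exact trans_congr (.llAnnWait (by simp [h])) rfl rfl (by rw [hA] at h; rw [h]; rfl)
        · exact trans_congr (.llAnnWait (by simp [h])) rfl rfl (by rw [hA] at h; rw [h]; rfl)
        · exact trans_congr (.llAnnRsp h) rfl rfl (by rw [hA] at h; rw [h]; rfl)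
      · simp only [step, RLLSC.rl, Access.map, reads]
        rcases h : (annOf mem j).context p
        · exact trans_congr (.llAnnRlDone h) rfl rfl (by rw [hA] at h; rw [h]; rfl)
        · exact trans_congr (.llAnnRlRead h) rfl rfl (by rw [hA] at h; rw [h]; rfl)
      · simp only [step, RLLSC.rl, Access.map]
        by_cases h : mem (.announce j) = cur
        · rw [casPos _ _ _ _ h]
          subst h
          exact trans_congr (.llAnnRlSucc rfl) (headOf_update_ann ..) (annOf_update_ann ..) rfl
        · rw [casNeg _ _ _ _ h]
          exact .llAnnRlFail h
  | vlHead op q rsp j a =>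
    simp only [step, RLLSC.vl, Access.map, reads]
    rcases h : (headOf mem).context p
    · exact trans_congr (.vlFalse h) rfl rfl (by rw [hH] at h; rw [h]; rfl)
    · rcases a with _ | o | r
      · exact trans_congr (.vlNot h (by simp)) rfl rfl (by rw [hH] at h; rw [h]; rfl)
      · exact trans_congr (.vlOp h) rfl rfl (by rw [hH] at h; rw [h]; rfl)
      · exact trans_congr (.vlNot h (by simp)) rfl rfl (by rw [hH] at h; rw [h]; rfl)
  | scAnnounce op q rsp j a c =>
    rcases c with _ | cur
    · simp only [step, RLLSC.sc, Access.map, reads]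
      rcases h : (annOf mem j).context p
      · exact trans_congr (.scAnnFalse h) rfl rfl (by rw [hA] at h; rw [h]; rfl)
      · exact trans_congr (.scAnnRead h) rfl rfl (by rw [hA] at h; rw [h]; rfl)
    · simp only [step, RLLSC.sc, Access.map]
      by_cases h : mem (.announce j) = cur
      · rw [casPos _ _ _ _ h]
        exact trans_congr (.scAnnSucc h) (headOf_update_ann ..) (annOf_update_ann ..) rfl
      · rw [casNeg _ _ _ _ h]
        exact .scAnnFail h
  | scHeadBot op q j a c =>
    rcases c with _ | cur
    · simp only [step, RLLSC.sc, Access.map, reads]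
      rcases h : (headOf mem).context p
      · exact trans_congr (.scBotFalse h) rfl rfl (by rw [hH] at h; rw [h]; rfl)
      · exact trans_congr (.scBotRead h) rfl rfl (by rw [hH] at h; rw [h]; rfl)
    · simp only [step, RLLSC.sc, Access.map]
      by_cases h : mem .head = cur
      · rw [casPos _ _ _ _ h]
        exact trans_congr (.scBotSucc h) (headOf_update_head ..) (annOf_update_head ..) rfl
      · rw [casNeg _ _ _ _ h]
        exact .scBotFail h
  | rlAnnounce op j c =>
    rcases c with _ | cur
    · simp only [step, RLLSC.rl, Access.map, reads]
      rcases h : (annOf mem j).context p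
      · exact trans_congr (.rlAnnDone h) rfl rfl (by rw [hA] at h; rw [h]; rfl)
      · exact trans_congr (.rlAnnRead h) rfl rfl (by rw [hA] at h; rw [h]; rfl)
    · simp only [step, RLLSC.rl, Access.map]
      by_cases h : mem (.announce j) = cur
      · rw [casPos _ _ _ _ h]
        subst h
        exact trans_congr (.rlAnnSucc rfl) (headOf_update_ann ..) (annOf_update_ann ..) rfl
      · rw [casNeg _ _ _ _ h]
        exact .rlAnnFail h
  | loadResponse =>
    simp only [step, RLLSC.load, Access.map, reads]
    rcases h : (annOf mem p).val with _ | o | r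
    · exact trans_congr (.loadResponseStay (by simp [h])) rfl rfl (by rw [hA] at h; rw [h]; rfl)
    · exact trans_congr (.loadResponseStay (by simp [h])) rfl rfl (by rw [hA] at h; rw [h]; rfl)
    · exact trans_congr (.loadResponse h) rfl rfl (by rw [hA] at h; rw [h]; rfl)
  | llHeadEnd r c =>
    cases s with
    | left =>
      rcases c with _ | cur
      · exact .endRead
      · simp only [step, RLLSC.ll, Access.map]
        by_cases h : mem .head = cur
        · rw [casPos _ _ _ _ h]
          subst h
          rcases h : headOf mem with ⟨⟨q, _ | ⟨rsp, j⟩⟩, ctx⟩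
          · rw [← h]
            refine trans_congr (.endOther hH (by simp [h])) (headOf_update_head ..)
              (annOf_update_head ..) ?_
            rw [← hH, h]; rfl
          · rw [← h]
            by_cases hj : j = p
            · subst hj
              refine trans_congr (.endOwn (q := q) (rsp := rsp) hH (by rw [h]))
                (headOf_update_head ..) (annOf_update_head ..) ?_
              rw [← hH, h]; exact if_pos rfl
            · refine trans_congr (.endOther hH (by simp [h, hj])) (headOf_update_head ..)
                (annOf_update_head ..) ?_
              rw [← hH, h]; exact if_neg hj
        · rw [casNeg _ _ _ _ h]
          exact .endFail h
    | right =>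
      simp only [step, RLLSC.load, Access.map, reads]
      rcases h : headOf mem with ⟨⟨q, _ | ⟨rsp, j⟩⟩, ctx⟩
      · rw [← h]
        refine trans_congr (.endExit (by simp [h])) rfl rfl ?_
        rw [← hH, h]; rfl
      · rw [← h]
        by_cases hj : j = p
        · subst hj
          refine trans_congr (.endWait (q := q) (rsp := rsp) (by rw [h])) rfl rfl ?_
          rw [← hH, h]; exact if_pos rfl
        · refine trans_congr (.endExit (by simp [h, hj])) rfl rfl ?_
          rw [← hH, h]; exact if_neg hj
  | scHeadEnd r q c =>
    rcases c with _ | cur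
    · simp only [step, RLLSC.sc, Access.map, reads]
      rcases h : (headOf mem).context p
      · exact trans_congr (.scEndFalse h) rfl rfl (by rw [hH] at h; rw [h]; rfl)
      · exact trans_congr (.scEndRead h) rfl rfl (by rw [hH] at h; rw [h]; rfl)
    · simp only [step, RLLSC.sc, Access.map]
      by_cases h : mem .head = cur
      · rw [casPos _ _ _ _ h]
        exact trans_congr (.scEndSucc h) (headOf_update_head ..) (annOf_update_head ..) rfl
      · rw [casNeg _ _ _ _ h]
        exact .scEndFail h
  | rlHead r c =>
    rcases c with _ | cur
    · simp only [step, RLLSC.rl, Access.map, reads]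
      rcases h : (headOf mem).context p
      · exact trans_congr (.rlHeadDone h) rfl rfl (by rw [hH] at h; rw [h]; rfl)
      · exact trans_congr (.rlHeadRead h) rfl rfl (by rw [hH] at h; rw [h]; rfl)
    · simp only [step, RLLSC.rl, Access.map]
      by_cases h : mem .head = cur
      · rw [casPos _ _ _ _ h]
        subst h
        exact trans_congr (.rlHeadSucc rfl) (headOf_update_head ..) (annOf_update_head ..) rfl
      · rw [casNeg _ _ _ _ h]
        exact .rlHeadFail h
  | clearAnnounce r =>
    exact trans_congr .clear (headOf_update_ann ..) (annOf_update_ann ..) rfl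

end Universal

/-! ### The invariant and the possible changes of the memory -/

namespace Universal

variable {𝒪 : AbstractObject.{u}} {n : ℕ}

/-- The announced value is a response. -/
def AnnVal.IsRsp (a : AnnVal 𝒪) : Prop := ∃ r, a = .rsp r

/-- `head` holds a response for process `j`. -/
def HeldFor (H : HeadCell 𝒪 n) (j : Fin n) : Prop := ∃ q r, H.val = (q, some (r, j))

/-- The expected value of a pending CAS was read with the context bit of `p` set. -/
def Linked {W : Type u} (p : Fin n) (c : Retry W n) : Prop :=
  ∀ cur, c = .cas cur → cur.context p = true

/-- Process `p` executes the state-changing operation `op` and has announced it; the announcement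
may have been replaced by the response. -/
def Looping (𝒪 : AbstractObject.{u}) (A : Fin n → AnnCell 𝒪 n) (p : Fin n)
    (pend : Option 𝒪.Op) (op : 𝒪.Op) : Prop :=
  pend = some op ∧ 𝒪.StateChanging op ∧ ((A p).val = .op op ∨ (A p).val.IsRsp)

/-- Process `p` executes a state-changing operation, whose response `r` has been announced. -/
def Finishing (𝒪 : AbstractObject.{u}) (A : Fin n → AnnCell 𝒪 n) (p : Fin n)
    (pend : Option 𝒪.Op) (r : 𝒪.Resp) : Prop :=
  (∃ op, pend = some op ∧ 𝒪.StateChanging op) ∧ (A p).val = .rsp r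

/-- The invariant of process `p`, by program counter. -/
def ProcInv (H : HeadCell 𝒪 n) (A : Fin n → AnnCell 𝒪 n) (p : Fin n) (pend : Option 𝒪.Op) :
    PC 𝒪 n → Prop
  | .idle => pend = none ∧ (A p).val = .bot ∧ H.context p = false
  | .readOnly op =>
      pend = some op ∧ ¬ 𝒪.StateChanging op ∧ (A p).val = .bot ∧ H.context p = false
  | .announceOp op =>
      pend = some op ∧ 𝒪.StateChanging op ∧ (A p).val = .bot ∧ H.context p = false
  | .loopTest op => Looping 𝒪 A p pend op
  | .llHead op _ => Looping 𝒪 A p pend op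
  | .loadHelp op q => Looping 𝒪 A p pend op ∧ (H.context p = true → H.val = (q, none))
  | .loadOwn op q => Looping 𝒪 A p pend op ∧ (H.context p = true → H.val = (q, none))
  | .scApply op st rsp j c => Looping 𝒪 A p pend op ∧ Linked p c ∧
      (H.context p = true → ∃ q o, H.val = (q, none) ∧ (A j).val = .op o ∧ 𝒪.Δ q o = (st, rsp))
  | .llAnnounce op q rsp j _ right => Looping 𝒪 A p pend op ∧
      (H.context p = true → H.val = (q, some (rsp, j))) ∧
      (∀ d, right = some d → (A p).val.IsRsp ∧ Linked p d)
  | .vlHead op q rsp j a => Looping 𝒪 A p pend op ∧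
      (H.context p = true → H.val = (q, some (rsp, j)) ∧ a ≠ .bot ∧
        ((A j).context p = true ∨ (A j).val.IsRsp) ∧ (a.IsRsp → (A j).val.IsRsp)) ∧
      ((A j).context p = true → (A j).val = a)
  | .scAnnounce op q rsp j a c => Looping 𝒪 A p pend op ∧ Linked p c ∧ (∃ o, a = .op o) ∧
      (H.context p = true → H.val = (q, some (rsp, j)) ∧
        ((A j).context p = true ∨ (A j).val.IsRsp)) ∧
      ((A j).context p = true →
        (∃ o, (A j).val = .op o) ∧ ∃ q', H.val = (q', some (rsp, j)))
  | .scHeadBot op q j _ c => Looping 𝒪 A p pend op ∧ Linked p c ∧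
      (H.context p = true → (∃ rsp, H.val = (q, some (rsp, j))) ∧ (A j).val.IsRsp)
  | .rlAnnounce op _ c => Looping 𝒪 A p pend op ∧ Linked p c
  | .loadResponse => ∃ r, Finishing 𝒪 A p pend r
  | .llHeadEnd r _ => Finishing 𝒪 A p pend r
  | .scHeadEnd r q c => Finishing 𝒪 A p pend r ∧ Linked p c ∧
      (H.context p = true → ∃ rsp, H.val = (q, some (rsp, p))) ∧
      (H.context p = false → ¬ HeldFor H p)
  | .rlHead r c => Finishing 𝒪 A p pend r ∧ Linked p c ∧ ¬ HeldFor H p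
  | .clearAnnounce r => Finishing 𝒪 A p pend r ∧ ¬ HeldFor H p ∧ H.context p = false

/-- If `head` holds the response `r` for `j`, then `j` has announced an operation whose response,
if it is already there, is `r`. -/
def HeadInv (H : HeadCell 𝒪 n) (A : Fin n → AnnCell 𝒪 n) : Prop :=
  ∀ q r j, H.val = (q, some (r, j)) → (A j).val ≠ .bot ∧ ∀ r', (A j).val = .rsp r' → r' = r

/-- The program counters at which `p` may be linked to an empty announcement of `j`. -/
def BotLink (j : Fin n) : PC 𝒪 n → Prop
  | .vlHead _ _ _ j' a => j' = j ∧ a = .bot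
  | .scHeadBot _ _ j' a _ => j' = j ∧ a = .bot
  | .rlAnnounce _ j' _ => j' = j
  | _ => False

/-- The kinds of memory changes by a step of process `p`. -/
inductive MemStep (p : Fin n) (H : HeadCell 𝒪 n) (A : Fin n → AnnCell 𝒪 n) :
    HeadCell 𝒪 n → (Fin n → AnnCell 𝒪 n) → Prop where
  | silent : MemStep p H A H A
  | headBit (x : Bool) : MemStep p H A (H.setBit p x) A
  | apply {q o j st rsp} (hH : H.val = (q, none)) (hA : (A j).val = .op o)
      (hΔ : 𝒪.Δ q o = (st, rsp)) : MemStep p H A (Cell.fresh (st, some (rsp, j))) A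
  | headBot {q rsp j} (hH : H.val = (q, some (rsp, j))) (hA : (A j).val.IsRsp) :
      MemStep p H A (Cell.fresh (q, none)) A
  | annBit (j : Fin n) (x : Bool) : MemStep p H A H (Function.update A j ((A j).setBit p x))
  | respond {q o j rsp} (hH : H.val = (q, some (rsp, j))) (hA : (A j).val = .op o) :
      MemStep p H A H (Function.update A j (Cell.fresh (.rsp rsp)))
  | announce {op} (hA : (A p).val = .bot) :
      MemStep p H A H (Function.update A p (Cell.fresh (.op op)))
  | clear (hH : ¬ HeldFor H p) (hA : (A p).val.IsRsp) :
      MemStep p H A H (Function.update A p (Cell.fresh .bot))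

/-- When the CAS of an SC succeeds, the current cell equals an expected cell that is `Linked`. So
the bit of `p` is set now, and the conclusions of the conditional clauses of `ProcInv` supply the
side conditions of the constructors. -/
theorem Trans.memStep {p : Fin n} {s : Side} {H H' : HeadCell 𝒪 n} {A A' : Fin n → AnnCell 𝒪 n}
    {l l' : LocalState 𝒪 n} {r : Option 𝒪.Resp} {pend : Option 𝒪.Op}
    (h : Trans p s H A l H' A' l' r) (hp : ProcInv H A p pend l.pc) : MemStep p H A H' A' := by
  cases h with
  | announce => exact .announce hp.2.2.1
  | llHeadNone | llHeadSome | endOwn | endOther | rlHeadSucc => exact .headBit _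
  | llAnnSucc | llAnnRlSucc | rlAnnSucc => exact .annBit _ _
  | scApplySucc h =>
    subst h
    obtain ⟨q, o, h1, h2, h3⟩ := hp.2.2 (hp.2.1 _ rfl)
    exact .apply h1 h2 h3
  | scAnnSucc h =>
    subst h
    obtain ⟨⟨o, h1⟩, q, h2⟩ := hp.2.2.2.2 (hp.2.1 _ rfl)
    exact .respond h2 h1
  | scBotSucc h =>
    subst h
    obtain ⟨⟨r, h1⟩, h2⟩ := hp.2.2 (hp.2.1 _ rfl)
    exact .headBot h1 h2
  | scEndSucc h =>
    subst h
    obtain ⟨r, h1⟩ := hp.2.2.1 (hp.2.1 _ rfl)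
    exact .headBot h1 ⟨_, hp.1.2⟩
  | clear => exact .clear hp.2.1 ⟨_, hp.1.2⟩
  | _ => exact .silent

/-- A held response is created only by `apply`, which finds an operation announced; `respond` writes
exactly the held response; and the entry emptied by `clear` is not the one held. -/
theorem MemStep.headInv {p : Fin n} {H H' : HeadCell 𝒪 n} {A A' : Fin n → AnnCell 𝒪 n}
    (h : MemStep p H A H' A') (hg : HeadInv H A) : HeadInv H' A' := by
  cases h with
  | silent => exact hg
  | headBit => exact hg
  | apply hH hA hΔ =>
    rintro q r j h
    simp only [Cell.fresh, Prod.mk.injEq, Option.some.injEq] at h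
    obtain ⟨_, _, rfl⟩ := h
    simp [hA]
  | headBot hH hA =>
    rintro q r j h
    simp [Cell.fresh] at h
  | annBit j x =>
    intro q r j' h
    have := hg q r j' h
    by_cases hj : j' = j
    · subst hj; simpa [Cell.setBit] using this
    · simpa [hj] using this
  | respond hH hA =>
    intro q r j' h
    rw [hH] at h
    simp only [Prod.mk.injEq, Option.some.injEq] at h
    obtain ⟨_, rfl, rfl⟩ := h
    simp [Cell.fresh]
  | announce hA =>
    intro q r j' h
    have := hg q r j' h
    by_cases hj : j' = p
    · subst hj; exact absurd hA this.1
    · simpa [hj] using this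
  | clear hH hA =>
    intro q r j' h
    have := hg q r j' h
    by_cases hj : j' = p
    · subst hj; exact absurd ⟨_, _, h⟩ hH
    · simpa [hj] using this

-- Non-interference. A foreign step never sets the bit of `p'`, and a change of the value of a cell
-- erases it there, which makes the implications from this bit vacuous. Facts about the other cell
-- are protected by the guards of `MemStep`: an operation is answered only while `head` is held for
-- it, `head` is released only after the answer, and the answer is cleared only when `head` is not
-- held for its owner.
set_option maxHeartbeats 4000000 in
theorem MemStep.procInv_other {p p' : Fin n} {H H' : HeadCell 𝒪 n} {A A' : Fin n → AnnCell 𝒪 n}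
    {pend : Option 𝒪.Op} {pc : PC 𝒪 n}
    (h : MemStep p H A H' A') (hg : HeadInv H A) (hne : p' ≠ p) (hp : ProcInv H A p' pend pc) :
    ProcInv H' A' p' pend pc := by
  cases h with
  | silent => exact hp
  | headBit x =>
    have hc : (H.setBit p x).context p' = H.context p' := by simp [Cell.setBit, hne]
    have hv : (H.setBit p x).val = H.val := rfl
    have hf : HeldFor (H.setBit p x) p' = HeldFor H p' := rfl
    cases pc <;> simpa only [ProcInv, hc, hv, hf] using hp
  | annBit j x =>
    have hc : ∀ j', (Function.update A j ((A j).setBit p x) j').context p' =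
        (A j').context p' := by
      intro j'
      by_cases hj : j' = j
      · subst hj; simp [Cell.setBit, hne]
      · simp [hj]
    have hv : ∀ j', (Function.update A j ((A j).setBit p x) j').val = (A j').val := by
      intro j'
      by_cases hj : j' = j
      · subst hj; simp [Cell.setBit]
      · simp [hj]
    cases pc <;> simpa only [ProcInv, Looping, Finishing, hc, hv] using hp
  | @apply q o j st rsp hH hA hΔ =>
    have hc : (Cell.fresh (st, some (rsp, j)) : HeadCell 𝒪 n).context p' = false := rfl
    -- The entry of the applied operation still contains an operation, so a process whose response
    -- is announced is not the one applied for.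
    have hf : (A p').val.IsRsp → ¬ HeldFor (Cell.fresh (st, some (rsp, j)) : HeadCell 𝒪 n) p' := by
      rintro ⟨r, hr⟩ ⟨q', r', h⟩
      simp only [Cell.fresh, Prod.mk.injEq, Option.some.injEq] at h
      rw [← h.2.2, hA] at hr
      cases hr
    cases pc <;> simp only [ProcInv, hc, hH] at hp ⊢ <;> grind [Finishing, AnnVal.IsRsp]
  | @headBot q rsp j hH hA =>
    have hc : (Cell.fresh (q, none) : HeadCell 𝒪 n).context p' = false := rfl
    have hf : ¬ HeldFor (Cell.fresh (q, none) : HeadCell 𝒪 n) p' := by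
      rintro ⟨q', r', h⟩
      simp [Cell.fresh] at h
    cases pc <;> simp only [ProcInv, hc, hH] at hp ⊢ <;> grind [AnnVal.IsRsp]
  | @respond q o j rsp hH hA =>
    have hj : (Function.update A j (Cell.fresh (.rsp rsp)) j) = Cell.fresh (.rsp rsp) := by simp
    have hj' : ∀ j', j' ≠ j → (Function.update A j (Cell.fresh (.rsp rsp)) j') = A j' := by
      intro j' h; simp [h]
    generalize Function.update A j (Cell.fresh (.rsp rsp)) = A' at hj hj'
    cases pc <;> simp only [ProcInv, Looping, Finishing, AnnVal.IsRsp] at hp ⊢ <;>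
      grind [Cell.fresh]
  | @announce op hA =>
    have hj : (Function.update A p (Cell.fresh (.op op)) p) = Cell.fresh (.op op) := by simp
    have hj' : ∀ j', j' ≠ p → (Function.update A p (Cell.fresh (.op op)) j') = A j' := by
      intro j' h; simp [h]
    generalize Function.update A p (Cell.fresh (.op op)) = A' at hj hj'
    have hb : ∀ q r, H.val ≠ (q, some (r, p)) := fun q r h => (hg q r p h).1 hA
    clear hg
    cases pc <;> simp only [ProcInv, Looping, Finishing, AnnVal.IsRsp] at hp ⊢ <;>
      grind [Cell.fresh]
  | clear hH hA =>
    have hj : (Function.update A p (Cell.fresh .bot) p) = Cell.fresh .bot := by simp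
    have hj' : ∀ j', j' ≠ p → (Function.update A p (Cell.fresh .bot) j') = A j' := by
      intro j' h; simp [h]
    generalize Function.update A p (Cell.fresh .bot) = A' at hj hj'
    have hb : ∀ q r, H.val ≠ (q, some (r, p)) := fun q r h => hH ⟨q, r, h⟩
    clear hg
    cases pc <;> simp only [ProcInv, Looping, Finishing, AnnVal.IsRsp] at hp hA ⊢ <;>
      grind [Cell.fresh]

theorem procInv_afterHelp {p : Fin n} {H : HeadCell 𝒪 n} {A : Fin n → AnnCell 𝒪 n}
    {pend : Option 𝒪.Op} {op : 𝒪.Op} {j : Fin n} (a : AnnVal 𝒪) (h : Looping 𝒪 A p pend op) :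
    ProcInv H A p pend (afterHelp op j a) := by
  cases a with
  | bot => exact ⟨h, by simp [Linked]⟩
  | op | rsp => exact h

-- Each load or LL establishes the clause needed at the next program counter from what it reads at
-- that instant; a bit found clear makes the implication from it vacuous.
set_option maxHeartbeats 4000000 in
theorem Trans.procInv {p : Fin n} {s : Side} {H H' : HeadCell 𝒪 n} {A A' : Fin n → AnnCell 𝒪 n}
    {l l' : LocalState 𝒪 n} {r : Option 𝒪.Resp} {pend : Option 𝒪.Op}
    (h : Trans p s H A l H' A' l' r) (hg : HeadInv H A) (hp : ProcInv H A p pend l.pc) :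
    ProcInv H' A' p (if r = none then pend else none) l'.pc := by
  cases h with
  | vlFalse | scBotFalse | scBotSucc => exact procInv_afterHelp _ hp.1
  | vlNot h ha =>
    rename_i a
    obtain ⟨h1, h2, h3, h4⟩ := hp.2.1 h
    rcases a with _ | o | r
    -- Here `head` is still linked and held for the process being helped, so its announcement was
    -- not empty when it was linked.
    · exact absurd rfl h2
    · exact absurd rfl (ha o)
    · exact ⟨hp.1, by simp [Linked], fun _ => ⟨⟨_, h1⟩, h4 ⟨r, rfl⟩⟩⟩
  | _ =>
    simp [ProcInv, Looping, Finishing, AnnVal.IsRsp, HeldFor, Linked, Cell.setBit, Cell.fresh]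
      at hp ⊢
    all_goals grind [HeadInv]

theorem setBit_val {W : Type u} (c : Cell W n) (p : Fin n) (x : Bool) :
    (c.setBit p x).val = c.val := rfl

theorem setBit_context_self {W : Type u} (c : Cell W n) (p : Fin n) (x : Bool) :
    (c.setBit p x).context p = x := Function.update_self ..

theorem setBit_context_of_ne {W : Type u} (c : Cell W n) {p p' : Fin n} (h : p' ≠ p) (x : Bool) :
    (c.setBit p x).context p' = c.context p' := Function.update_of_ne h ..

theorem fresh_val {W : Type u} (x : W) : (Cell.fresh x : Cell W n).val = x := rfl

theorem fresh_context {W : Type u} (x : W) (p : Fin n) :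
    (Cell.fresh x : Cell W n).context p = false := rfl

theorem botLink_afterHelp {op : 𝒪.Op} {j j' : Fin n} {a : AnnVal 𝒪} (h : j' = j ∧ a = .bot) :
    BotLink j (afterHelp op j' a) := by
  obtain ⟨rfl, rfl⟩ := h; rfl

/-- Bits left on a nonempty announcement are harmless, since the final Store of its owner erases
them. A link to an empty entry is made only by an LL that returns ⊥, and the program counter
remembers this until the RL. -/
theorem Trans.botLink {p : Fin n} {s : Side} {H H' : HeadCell 𝒪 n} {A A' : Fin n → AnnCell 𝒪 n}
    {l l' : LocalState 𝒪 n} {r : Option 𝒪.Resp} {pend : Option 𝒪.Op}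
    (h : Trans p s H A l H' A' l' r) (hp : ProcInv H A p pend l.pc)
    (hb : ∀ j, (A j).val = .bot → (A j).context p = true → BotLink j l.pc) :
    ∀ j, (A' j).val = .bot → (A' j).context p = true → BotLink j l'.pc := by
  cases h with
  | vlFalse | scBotFalse | scBotSucc => exact fun j h h' => botLink_afterHelp (hb j h h')
  | _ =>
    simp only [ProcInv, BotLink, imp_false] at hp hb ⊢
    grind [Function.update_apply, setBit_val, setBit_context_self, fresh_val, fresh_context]

/-- An entry becomes empty only by a Store, which clears all bits, and a foreign step cannot set the
bit of `p'`. -/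
theorem MemStep.botLink_other {p p' : Fin n} {H H' : HeadCell 𝒪 n} {A A' : Fin n → AnnCell 𝒪 n}
    (h : MemStep p H A H' A') (hne : p' ≠ p) (j : Fin n) (hv : (A' j).val = .bot)
    (hc : (A' j).context p' = true) : (A j).val = .bot ∧ (A j).context p' = true := by
  cases h <;>
    grind [Function.update_apply, setBit_val, setBit_context_of_ne, fresh_val, fresh_context]

/-! ### The invariant of reachable configurations and the quiescent memory -/

/-- Configurations of the universal implementation. -/
abbrev Conf (𝒪 : AbstractObject.{u}) (n : ℕ) := (universalImplementation 𝒪 n).Config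

/-- `head` in a configuration. -/
def hd (C : Conf 𝒪 n) : HeadCell 𝒪 n := headOf C.mem

/-- `announce` in a configuration. -/
def an (C : Conf 𝒪 n) : Fin n → AnnCell 𝒪 n := annOf C.mem

/-- The local state of a process in a configuration. -/
def lo (C : Conf 𝒪 n) (p : Fin n) : LocalState 𝒪 n := C.loc p

/-- The invariant of the universal implementation. -/
structure Inv (C : Conf 𝒪 n) : Prop where
  proc : ∀ p, ProcInv (hd C) (an C) p (C.pending p) (lo C p).pc
  head : HeadInv (hd C) (an C)
  bot : ∀ j p, (an C j).val = .bot → (an C j).context p = true → BotLink j (lo C p).pc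

/-- Transitions between configurations, in terms of `Trans`. -/
inductive ConfStep (C C' : Conf 𝒪 n) : ExecAction 𝒪 n → Prop where
  | invoke (p : Fin n) (o : 𝒪.Op) (hpend : C.pending p = none) (hd_eq : hd C' = hd C)
      (an_eq : an C' = an C) (lo_eq : lo C' p = start o (lo C p))
      (lo_other : ∀ p', p' ≠ p → lo C' p' = lo C p')
      (pending_eq : C'.pending = Function.update C.pending p (some o)) :
      ConfStep C C' (.invoke p o)
  | step (p : Fin n) (s : Side) (r : Option 𝒪.Resp) (hpend : C.pending p ≠ none)
      (trans : Trans p s (hd C) (an C) (lo C p) (hd C') (an C') (lo C' p) r)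
      (lo_other : ∀ p', p' ≠ p → lo C' p' = lo C p')
      (pending_eq : C'.pending p = if r = none then C.pending p else none)
      (pending_other : ∀ p', p' ≠ p → C'.pending p' = C.pending p') :
      ConfStep C C' (.step p s r)

/-- The invariant serves only to exclude `idle` for a process with a pending operation. -/
theorem Inv.confStep {C C' : Conf 𝒪 n} {a : ExecAction 𝒪 n} (hC : Inv C)
    (h : (universalImplementation 𝒪 n).Step C a C') : ConfStep C C' a := by
  cases h with
  | invoke p o h =>
    refine .invoke p o h rfl rfl ?_ ?_ rfl
    · exact Function.update_self ..
    · intro p' hp'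
      exact Function.update_of_ne hp' ..
  | step p s h =>
    have hidle : (lo C p).pc ≠ .idle := by
      intro hi
      have := hC.proc p
      rw [hi] at this
      exact h this.1
    have ht := trans_of_step p s (lo C p) C.mem hidle
    refine .step p s _ h ?_ ?_ ?_ ?_
    · exact trans_congr ht rfl rfl (Prod.ext (Function.update_self ..) rfl)
    · intro p' hp'
      exact Function.update_of_ne hp' ..
    · simp only [Implementation.afterStep]
      rcases ((universalImplementation 𝒪 n).outcome C p s).2.2 with _ | r <;> simp
    · intro p' hp'
      simp only [Implementation.afterStep]
      rcases ((universalImplementation 𝒪 n).outcome C p s).2.2 with _ | r <;> simp [hp']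

theorem inv_init : Inv (universalImplementation 𝒪 n).initConfig where
  proc _ := ⟨rfl, rfl, rfl⟩
  head q r j h := by cases h
  bot j p h h' := by cases h'

theorem ConfStep.inv {C C' : Conf 𝒪 n} {a : ExecAction 𝒪 n} (h : ConfStep C C' a) (hC : Inv C) :
    Inv C' := by
  cases h with
  | invoke p o hpend hd_eq an_eq lo_eq lo_other pending_eq =>
    have hidle : (lo C p).pc = .idle := by
      have := hC.proc p
      rw [hpend] at this
      cases h : (lo C p).pc <;> simp_all [ProcInv, Looping, Finishing]
    have hp := hC.proc p
    rw [hidle] at hp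
    refine ⟨fun p' => ?_, by rw [hd_eq, an_eq]; exact hC.head, fun j p' => ?_⟩
    · rw [hd_eq, an_eq, pending_eq]
      by_cases h : p' = p
      · subst h
        rw [lo_eq, Function.update_self]
        by_cases ho : 𝒪.StateChanging o
        · simp [start, AbstractObject.ReadOnly, ho, ProcInv, hp.2]
        · simp [start, AbstractObject.ReadOnly, ho, ProcInv, hp.2]
      · rw [lo_other p' h, Function.update_of_ne h]
        exact hC.proc p'
    · rw [an_eq]
      intro h1 h2
      have := hC.bot j p' h1 h2
      by_cases h : p' = p
      · subst h
        rw [hidle] at this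
        exact this.elim
      · rwa [lo_other p' h]
  | step p s r hpend trans lo_other pending_eq pending_other =>
    have hm := trans.memStep (hC.proc p)
    refine ⟨fun p' => ?_, hm.headInv hC.head, fun j p' h1 h2 => ?_⟩
    · by_cases h : p' = p
      · subst h
        rw [pending_eq]
        exact trans.procInv hC.head (hC.proc p')
      · rw [pending_other p' h, lo_other p' h]
        exact hm.procInv_other hC.head h (hC.proc p')
    · by_cases h : p' = p
      · subst h
        exact trans.botLink (hC.proc p') (fun j => hC.bot j p') j h1 h2
      · rw [lo_other p' h]
        obtain ⟨h3, h4⟩ := hm.botLink_other h j h1 h2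
        exact hC.bot j p' h3 h4

theorem inv_of_reach {as : List (ExecAction 𝒪 n)} {C : Conf 𝒪 n}
    (h : (universalImplementation 𝒪 n).Reach as C) : Inv C := by
  induction h with
  | nil => exact inv_init
  | snoc _ hs ih => exact (ih.confStep hs).inv ih

/-- The memory of a state-quiescent configuration is determined by the state in `head`. -/
theorem Inv.mem_of_stateQuiescent {C : Conf 𝒪 n} (hC : Inv C) (hq : C.StateQuiescent) :
    hd C = Cell.fresh ((hd C).val.1, none) ∧ an C = fun _ => Cell.fresh .bot := by
  -- By quiescence every process is at `idle` or `readOnly`; any other program counter comes with a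
  -- pending state-changing operation.
  have key : ∀ p, (an C p).val = .bot ∧ (hd C).context p = false ∧
      ∀ j, ¬ BotLink j (lo C p).pc := by
    intro p
    have := hC.proc p
    have hq := hq p
    cases h : (lo C p).pc <;> rw [h] at this <;>
      simp [ProcInv, Looping, Finishing, BotLink] at this ⊢ <;> grind
  refine ⟨Cell.ext (Prod.ext rfl ?_) (funext fun p => (key p).2.1), funext fun j =>
    Cell.ext (key j).1 (funext fun p => ?_)⟩
  · rcases h : (hd C).val with ⟨q, _ | ⟨r, j⟩⟩
    · rfl
    -- A response held in `head` would need a nonempty announcement.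
    · exact absurd (key j).1 (hC.head q r j h).1
  · by_contra h
    exact (key p).2.2 j (hC.bot j p (key j).1 (by simpa [Cell.fresh] using h))

end Universal

/-! ### Linearizations built by appending operations -/

section Linearization

variable {𝒪 : AbstractObject.{u}} {n : ℕ}

/-- The finite sequential history `L` is a linearization of `H`, in list form. -/
structure IsLinList (𝒪 : AbstractObject.{u}) {n : ℕ} (H : History 𝒪 n) (L : List (SeqOp 𝒪 n)) :
    Prop where
  mem : ∀ e ∈ L, H e.time = some (.inv e.proc e.op)
  nodup : ∀ (k k' : ℕ) (e e' : SeqOp 𝒪 n), L[k]? = some e → L[k']? = some e' →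
    e.time = e'.time → k = k'
  complete : ∀ t t' r, Returns H t t' r → ∃ e ∈ L, e.time = t ∧ e.resp = r
  spec : ∀ (k : ℕ) (e : SeqOp 𝒪 n), L[k]? = some e →
    𝒪.Δ (seqState 𝒪 (L.take k)) e.op = (seqState 𝒪 (L.take (k + 1)), e.resp)
  real_time : ∀ (k k' : ℕ) (e e' : SeqOp 𝒪 n) t' r, L[k]? = some e → L[k']? = some e' →
    Returns H e.time t' r → t' < e'.time → k < k'

/-- `complete` yields some entry with the right response; `nodup` identifies it with the given one.
-/
theorem IsLinList.same_resp {H : History 𝒪 n} {L : List (SeqOp 𝒪 n)} (h : IsLinList 𝒪 H L)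
    {k : ℕ} {e : SeqOp 𝒪 n} {t' : ℕ} {r : 𝒪.Resp} (hk : L[k]? = some e)
    (hr : Returns H e.time t' r) : e.resp = r := by
  obtain ⟨e', he', ht, hr⟩ := h.complete _ _ _ hr
  obtain ⟨k', hk'⟩ := List.mem_iff_getElem?.1 he'
  have := h.nodup k' k e' e hk' hk ht
  subst this
  rw [hk] at hk'
  cases hk'
  exact hr

theorem IsLinList.isLinearization {H : History 𝒪 n} {L : List (SeqOp 𝒪 n)} (h : IsLinList 𝒪 H L) :
    IsLinearization 𝒪 H fun k => L[k]? where
  no_gap k hk := by simp only [List.getElem?_eq_none_iff] at hk ⊢; omega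
  mem_history k e hk := h.mem e (List.mem_of_getElem? hk)
  nodup := h.nodup
  complete t t' r hr := by
    obtain ⟨e, he, ht, _⟩ := h.complete t t' r hr
    obtain ⟨k, hk⟩ := List.mem_iff_getElem?.1 he
    exact ⟨k, e, hk, ht⟩
  same_resp k e t' r hk hr := h.same_resp hk hr
  spec := ⟨fun k => seqState 𝒪 (L.take k), rfl, h.spec⟩
  real_time := h.real_time

theorem getElem?_concat_eq_some {α : Type*} {L : List α} {a e : α} {k : ℕ} :
    (L ++ [a])[k]? = some e ↔ L[k]? = some e ∨ (k = L.length ∧ e = a) := by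
  rcases lt_trichotomy k L.length with h | h | h
  · rw [List.getElem?_append_left h]
    constructor
    · exact Or.inl
    · rintro (h' | ⟨h', _⟩)
      · exact h'
      · omega
  · subst h
    simp [eq_comm]
  · have h1 : (L ++ [a])[k]? = none := by
      rw [List.getElem?_eq_none_iff, List.length_append, List.length_singleton]; omega
    have h2 : L[k]? = none := by rw [List.getElem?_eq_none_iff]; omega
    rw [h1, h2]
    constructor
    · intro h'; cases h'
    · rintro (h' | ⟨h', _⟩)
      · cases h'
      · omega

theorem seqState_concat (L : List (SeqOp 𝒪 n)) (e : SeqOp 𝒪 n) :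
    seqState 𝒪 (L ++ [e]) = (𝒪.Δ (seqState 𝒪 L) e.op).1 := by
  simp [seqState]

/-- Appending a pending operation to a linearization. -/
theorem IsLinList.append {H : History 𝒪 n} {L : List (SeqOp 𝒪 n)} (h : IsLinList 𝒪 H L)
    (e : SeqOp 𝒪 n) (hmem : H e.time = some (.inv e.proc e.op)) (hnew : ∀ e' ∈ L, e'.time ≠ e.time)
    (hresp : (𝒪.Δ (seqState 𝒪 L) e.op).2 = e.resp) (hpend : ∀ t' r, ¬ Returns H e.time t' r) :
    IsLinList 𝒪 H (L ++ [e]) where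
  mem e' he' := by
    rcases List.mem_append.1 he' with he' | he'
    · exact h.mem e' he'
    · rw [List.mem_singleton.1 he']; exact hmem
  nodup k k' e₁ e₂ h₁ h₂ ht := by
    rw [getElem?_concat_eq_some] at h₁ h₂
    rcases h₁ with h₁ | ⟨rfl, rfl⟩ <;> rcases h₂ with h₂ | ⟨rfl, rfl⟩
    · exact h.nodup _ _ _ _ h₁ h₂ ht
    · exact absurd ht (hnew _ (List.mem_of_getElem? h₁))
    · exact absurd ht.symm (hnew _ (List.mem_of_getElem? h₂))
    · rfl
  complete t t' r hr := by
    obtain ⟨e', he', h'⟩ := h.complete t t' r hr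
    exact ⟨e', List.mem_append_left _ he', h'⟩
  spec k e' hk := by
    rw [getElem?_concat_eq_some] at hk
    rcases hk with hk | ⟨rfl, rfl⟩
    · have hlt : k < L.length := (List.getElem?_eq_some_iff.1 hk).1
      rw [List.take_append_of_le_length hlt.le, List.take_append_of_le_length hlt]
      exact h.spec k e' hk
    · rw [List.take_append_of_le_length le_rfl, List.take_length, List.take_of_length_le (by simp),
        seqState_concat, ← hresp]
  real_time k k' e₁ e₂ t' r h₁ h₂ hr ht := by
    rw [getElem?_concat_eq_some] at h₁ h₂
    rcases h₁ with h₁ | ⟨rfl, rfl⟩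
    · rcases h₂ with h₂ | ⟨rfl, rfl⟩
      · exact h.real_time _ _ _ _ _ _ h₁ h₂ hr ht
      · exact (List.getElem?_eq_some_iff.1 h₁).1
    -- The appended operation has not returned, so it precedes nothing in real time.
    · exact absurd hr (hpend _ _)

theorem Returns.congr {H H' : History 𝒪 n} {t t' : ℕ} {r : 𝒪.Resp} (h : Returns H t t' r)
    (hH : ∀ x, x ≤ t' → H x = H' x) : Returns H' t t' r := by
  obtain ⟨p, o, h1, h2, h3, h4⟩ := h
  refine ⟨p, o, by rw [← hH t h2.le, h1], h2, by rw [← hH t' le_rfl, h3], ?_⟩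
  intro x hx hx' e he
  exact h4 x hx hx' e (by rw [hH x hx'.le, he])

theorem Returns.lt_of_none {H : History 𝒪 n} {t t' T : ℕ} {r : 𝒪.Resp} (h : Returns H t t' r)
    (hT : ∀ x, T ≤ x → H x = none) : t' < T := by
  obtain ⟨p, o, -, -, h3, -⟩ := h
  by_contra hlt
  rw [hT t' (not_lt.1 hlt)] at h3
  cases h3

/-- Extending the history of a linearization by one event. -/
theorem IsLinList.extend {H : History 𝒪 n} {L : List (SeqOp 𝒪 n)} (h : IsLinList 𝒪 H L) {t : ℕ}
    (hT : ∀ x, t ≤ x → H x = none) (ev : Option (Event 𝒪 n))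
    (hev : ∀ t₁ r, Returns (Function.update H t ev) t₁ t r → ∃ e ∈ L, e.time = t₁ ∧ e.resp = r) :
    IsLinList 𝒪 (Function.update H t ev) L := by
  have hlt : ∀ e ∈ L, e.time < t := by
    intro e he
    by_contra hlt
    have := h.mem e he
    rw [hT _ (not_lt.1 hlt)] at this
    cases this
  have hret : ∀ {t₁ t₂ r}, Returns (Function.update H t ev) t₁ t₂ r → t₂ ≠ t →
      Returns H t₁ t₂ r := by
    intro t₁ t₂ r hr ht
    have hT' : ∀ x, t + 1 ≤ x → Function.update H t ev x = none := fun x hx => by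
      rw [Function.update_of_ne (by omega)]; exact hT x (by omega)
    have := hr.lt_of_none hT'
    exact hr.congr fun x hx => Function.update_of_ne (by omega) ..
  refine ⟨fun e he => ?_, h.nodup, fun t₁ t₂ r hr => ?_, h.spec, ?_⟩
  · rw [Function.update_of_ne (hlt e he).ne]; exact h.mem e he
  · by_cases ht : t₂ = t
    · subst ht; exact hev _ _ hr
    · exact h.complete _ _ _ (hret hr ht)
  · intro k k' e e' t' r hk hk' hr ht
    -- A return at the new position precedes no listed operation, because all of these were invoked
    -- before `t`.
    by_cases ht' : t' = t
    · have := hlt e' (List.mem_of_getElem? hk')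
      omega
    · exact h.real_time _ _ _ _ _ _ hk hk' (hret hr ht') ht

/-- The part of a history before time `t`. -/
def History.before (H : History 𝒪 n) (t : ℕ) : History 𝒪 n := fun x => if x < t then H x else none

theorem History.before_succ (H : History 𝒪 n) (t : ℕ) :
    H.before (t + 1) = Function.update (H.before t) t (H t) := by
  funext x
  simp only [before, Function.update_apply]
  split_ifs <;> first | rfl | omega | (subst_vars; rfl)

theorem History.before_of_lt (H : History 𝒪 n) {t x : ℕ} (h : x < t) : H.before t x = H x :=
  if_pos h

/-- The limit of an increasing sequence of lists. -/
theorem exists_limit {α : Type*} (L : ℕ → List α) (hL : ∀ t, L t <+: L (t + 1)) :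
    ∃ M : ℕ → Option α, ∀ (k : ℕ) (e : α), M k = some e ↔ ∃ T, ∀ t, T ≤ t → (L t)[k]? = some e := by
  classical
  have mono : ∀ (t t' k : ℕ) (e : α), t ≤ t' → (L t)[k]? = some e → (L t')[k]? = some e := by
    intro t t' k e htt' h
    induction t', htt' using Nat.le_induction with
    | base => exact h
    | succ m _ ih =>
      obtain ⟨s, hs⟩ := hL m
      rw [← hs, List.getElem?_append_left (List.getElem?_eq_some_iff.1 ih).1]
      exact ih
  -- Every choice gives the same entry, since an entry that is present never changes later.
  refine ⟨fun k => if h : ∃ e t, (L t)[k]? = some e then some h.choose else none, fun k e => ?_⟩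
  beta_reduce
  constructor
  · intro h
    split_ifs at h with hex
    obtain ⟨t, ht⟩ := hex.choose_spec
    cases h
    exact ⟨t, fun t' htt' => mono _ _ _ _ htt' ht⟩
  · rintro ⟨T, hT⟩
    have hex : ∃ e t, (L t)[k]? = some e := ⟨e, T, hT T le_rfl⟩
    rw [dif_pos hex]
    obtain ⟨t, ht⟩ := hex.choose_spec
    have h1 := mono _ (max t T) _ _ (le_max_left _ _) ht
    rw [hT _ (le_max_right _ _)] at h1
    exact h1.symm

/-- A linearization of an infinite history from a growing sequence of linearizations of its
prefixes. -/
theorem exists_isLinearization (H : History 𝒪 n) (L : ℕ → List (SeqOp 𝒪 n))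
    (hL : ∀ t, L t <+: L (t + 1)) (h : ∀ t, IsLinList 𝒪 (H.before t) (L t)) :
    ∃ M, IsLinearization 𝒪 H M := by
  obtain ⟨M, hM⟩ := exists_limit L hL
  have hret : ∀ {t t' r} T, t' < T → Returns H t t' r → Returns (H.before T) t t' r :=
    fun T hT hr => hr.congr fun x hx => (H.before_of_lt (by omega)).symm
  have prefix_le : ∀ t t', t ≤ t' → L t <+: L t' := fun t t' htt' => by
    induction t', htt' using Nat.le_induction with
    | base => exact List.prefix_refl _
    | succ m _ ih => exact ih.trans (hL m)
  have hM' : ∀ (t k : ℕ) (e : SeqOp 𝒪 n), (L t)[k]? = some e → M k = some e := fun t k e hk => by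
    rw [hM]
    refine ⟨t, fun t' htt' => ?_⟩
    obtain ⟨s, hs⟩ := prefix_le t t' htt'
    rw [← hs, List.getElem?_append_left (List.getElem?_eq_some_iff.1 hk).1]
    exact hk
  refine ⟨M, ?_, ?_, ?_, ?_, ?_, ?_, ?_⟩
  · intro k hk
    by_contra hne
    obtain ⟨e, he⟩ := Option.ne_none_iff_exists'.1 hne
    obtain ⟨T, hT⟩ := (hM _ _).1 he
    have hlt := (List.getElem?_eq_some_iff.1 (hT T le_rfl)).1
    have := hM' T k _ (List.getElem?_eq_getElem (by omega : k < (L T).length))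
    rw [hk] at this
    cases this
  · intro k e hk
    obtain ⟨T, hT⟩ := (hM _ _).1 hk
    have := (h T).mem e (List.mem_of_getElem? (hT T le_rfl))
    unfold History.before at this
    split_ifs at this
    exact this
  · intro k k' e e' hk hk' ht
    obtain ⟨T, hT⟩ := (hM _ _).1 hk
    obtain ⟨T', hT'⟩ := (hM _ _).1 hk'
    exact (h (max T T')).nodup _ _ _ _ (hT _ (le_max_left _ _)) (hT' _ (le_max_right _ _)) ht
  · intro t t' r hr
    obtain ⟨e, he, ht, _⟩ := (h (t' + 1)).complete t t' r (hret _ (by omega) hr)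
    obtain ⟨k, hk⟩ := List.mem_iff_getElem?.1 he
    exact ⟨k, e, hM' _ _ _ hk, ht⟩
  · intro k e t' r hk hr
    obtain ⟨T, hT⟩ := (hM _ _).1 hk
    -- The prefix has to contain the position `t'` itself, hence `t' + 1`.
    exact (h (max T (t' + 1))).same_resp (hT _ (le_max_left _ _)) (hret _ (by omega) hr)
  -- Past the end of `M` the state is merely repeated; the specification says nothing there.
  · let q : ℕ → 𝒪.State := Nat.rec 𝒪.init fun k s =>
      match M k with
      | some e => (𝒪.Δ s e.op).1
      | none => s
    have hq : ∀ t k, k ≤ (L t).length → q k = seqState 𝒪 ((L t).take k) := by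
      intro t k
      induction k with
      | zero => intro _; rfl
      | succ k ih =>
        intro hk
        have hk' := List.getElem?_eq_getElem (by omega : k < (L t).length)
        have h1 : q (k + 1) = (𝒪.Δ (q k) ((L t)[k]).op).1 := by
          show (match M k with
            | some e => (𝒪.Δ (q k) e.op).1
            | none => q k) = _
          rw [hM' t k _ hk']
        rw [h1, ih (by omega), (h t).spec k _ hk']
    refine ⟨q, rfl, fun k e hk => ?_⟩
    obtain ⟨T, hT⟩ := (hM _ _).1 hk
    have hk := hT T le_rfl
    have hlt := (List.getElem?_eq_some_iff.1 hk).1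
    rw [hq T k hlt.le, hq T (k + 1) hlt]
    exact (h T).spec k e hk
  · intro k k' e e' t' r hk hk' hr ht
    obtain ⟨T, hT⟩ := (hM _ _).1 hk
    obtain ⟨T', hT'⟩ := (hM _ _).1 hk'
    exact (h (max (max T T') (t' + 1))).real_time _ _ _ _ _ _ (hT _ (by omega)) (hT' _ (by omega))
      (hret _ (by omega) hr) ht

end Linearization

/-! ### Linearization points, linearizability and history independence -/

namespace Universal

variable {𝒪 : AbstractObject.{u}} {n : ℕ}

/-- The response of the pending operation of `j`, if the operation has been applied. -/
def applied (H : HeadCell 𝒪 n) (A : Fin n → AnnCell 𝒪 n) (j : Fin n) : Option 𝒪.Resp :=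
  match (A j).val with
  | .bot => none
  | .rsp r => some r
  | .op _ =>
    match H.val.2 with
    | none => none
    | some (r, j') => if j' = j then some r else none

theorem applied_of_bot {H : HeadCell 𝒪 n} {A : Fin n → AnnCell 𝒪 n} {j : Fin n}
    (h : (A j).val = .bot) : applied H A j = none := by
  simp [applied, h]

theorem applied_of_rsp {H : HeadCell 𝒪 n} {A : Fin n → AnnCell 𝒪 n} {j : Fin n} {r : 𝒪.Resp}
    (h : (A j).val = .rsp r) : applied H A j = some r := by
  simp [applied, h]

theorem applied_of_op_of_held {H : HeadCell 𝒪 n} {A : Fin n → AnnCell 𝒪 n} {j : Fin n} {o : 𝒪.Op}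
    {q : 𝒪.State} {r : 𝒪.Resp} (h : (A j).val = .op o) (hH : H.val = (q, some (r, j))) :
    applied H A j = some r := by
  simp [applied, h, hH]

theorem applied_of_op_of_not_held {H : HeadCell 𝒪 n} {A : Fin n → AnnCell 𝒪 n} {j : Fin n}
    {o : 𝒪.Op} (h : (A j).val = .op o) (hH : ¬ HeldFor H j) : applied H A j = none := by
  rcases hv : H.val with ⟨q, _ | ⟨r, j'⟩⟩
  · simp [applied, h, hv]
  · have : j' ≠ j := fun e => hH ⟨q, r, by rw [hv, e]⟩
    simp [applied, h, hv, this]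

theorem applied_congr {H H' : HeadCell 𝒪 n} {A A' : Fin n → AnnCell 𝒪 n} {j : Fin n}
    (hH : H'.val = H.val) (hA : (A' j).val = (A j).val) : applied H' A' j = applied H A j := by
  simp [applied, hH, hA]

/-- The effect of a step on the abstract state and on the applied operations. -/
inductive Effect (p : Fin n) (pend : Option 𝒪.Op) (H : HeadCell 𝒪 n) (A : Fin n → AnnCell 𝒪 n)
    (H' : HeadCell 𝒪 n) (A' : Fin n → AnnCell 𝒪 n) : Option 𝒪.Resp → Prop where
  | quiet (hs : H'.val.1 = H.val.1) (ha : ∀ j, applied H' A' j = applied H A j) :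
      Effect p pend H A H' A' none
  | apply (j : Fin n) (o : 𝒪.Op) (rsp : 𝒪.Resp) (hA : (A j).val = .op o)
      (hΔ : 𝒪.Δ H.val.1 o = (H'.val.1, rsp)) (hj : applied H A j = none)
      (hj' : applied H' A' j = some rsp) (ha : ∀ j', j' ≠ j → applied H' A' j' = applied H A j') :
      Effect p pend H A H' A' none
  | finish (r : 𝒪.Resp) (hs : H'.val.1 = H.val.1) (hp : applied H A p = some r)
      (hp' : applied H' A' p = none) (ha : ∀ j, j ≠ p → applied H' A' j = applied H A j) :
      Effect p pend H A H' A' (some r)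
  | read (op : 𝒪.Op) (hpend : pend = some op) (hs : H'.val.1 = H.val.1)
      (hΔ : (𝒪.Δ H.val.1 op).1 = H.val.1) (hp : applied H A p = none)
      (ha : ∀ j, applied H' A' j = applied H A j) :
      Effect p pend H A H' A' (some (𝒪.Δ H.val.1 op).2)

/-- `respond` copies the response from `head` to the announcement, and `headBot` drops a copy that
the announcement already has, so `applied` does not see either. Only `apply` is visible, besides
`clear`, which `hp` rules out. -/
theorem MemStep.effect {p : Fin n} {H H' : HeadCell 𝒪 n} {A A' : Fin n → AnnCell 𝒪 n}
    (pend : Option 𝒪.Op) (h : MemStep p H A H' A') (hg : HeadInv H A)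
    (hp : (A' p).val = .bot → (A p).val = .bot) : Effect p pend H A H' A' none := by
  cases h with
  | silent => exact .quiet rfl fun _ => rfl
  | headBit x => exact .quiet rfl fun _ => rfl
  | @apply q o j st rsp hH hA hΔ =>
    refine .apply j o rsp hA (by rw [hH]; exact hΔ) ?_ ?_ ?_
    · exact applied_of_op_of_not_held hA (by rintro ⟨q', r, h⟩; rw [hH] at h; cases h)
    · exact applied_of_op_of_held hA rfl
    · intro j' hj'
      simp [applied, hH, Cell.fresh, hj'.symm]
  | @headBot q rsp j hH hA =>
    refine .quiet (by rw [hH]; rfl) fun j' => ?_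
    by_cases hj : j' = j
    · subst hj
      obtain ⟨r, hr⟩ := hA
      rw [applied_of_rsp hr, applied_of_rsp hr]
    · simp [applied, hH, Cell.fresh, Ne.symm hj]
  | annBit j x =>
    refine .quiet rfl fun j' => applied_congr rfl ?_
    by_cases hj : j' = j
    · subst hj; simp [Cell.setBit]
    · simp [hj]
  | @respond q o j rsp hH hA =>
    refine .quiet rfl fun j' => ?_
    by_cases hj : j' = j
    · subst hj
      rw [applied_of_op_of_held hA hH]
      exact applied_of_rsp (by simp [Cell.fresh])
    · exact applied_congr rfl (by simp [hj])
  | @announce op hA =>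
    refine .quiet rfl fun j' => ?_
    by_cases hj : j' = p
    · subst hj
      rw [applied_of_bot hA]
      refine applied_of_op_of_not_held (o := op) (by simp [Cell.fresh]) ?_
      rintro ⟨q, r, h⟩
      exact (hg q r j' h).1 hA
    · exact applied_congr rfl (by simp [hj])
  | clear hH hA =>
    obtain ⟨r, hr⟩ := hA
    rw [hr] at hp
    simp [Cell.fresh] at hp

/-- Places the linearization points. A read-only operation takes effect in its single step, which is
also its return; a state-changing one returns with `clear`, when it has long been applied. -/
theorem Trans.effect {p : Fin n} {s : Side} {H H' : HeadCell 𝒪 n} {A A' : Fin n → AnnCell 𝒪 n}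
    {l l' : LocalState 𝒪 n} {r : Option 𝒪.Resp} {pend : Option 𝒪.Op}
    (h : Trans p s H A l H' A' l' r) (hg : HeadInv H A) (hp : ProcInv H A p pend l.pc) :
    Effect p pend H A H' A' r := by
  have hm := h.memStep hp
  cases h with
  | readOnly =>
    refine .read _ hp.1 rfl ?_ (applied_of_bot hp.2.2.1) fun _ => rfl
    by_contra hne
    exact hp.2.1 ⟨_, hne⟩
  | clear =>
    refine .finish _ rfl (applied_of_rsp hp.1.2) (applied_of_bot (by simp [Cell.fresh])) ?_
    intro j hj
    exact applied_congr rfl (by simp [hj])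
  | _ =>
    refine hm.effect pend hg ?_
    first
    | exact id
    | (simp only [Function.update_apply]; split_ifs <;> simp_all [Cell.fresh, Cell.setBit])

/-- The operation announced by `j` is the pending one. -/
theorem ProcInv.pending_of_op {p : Fin n} {H : HeadCell 𝒪 n} {A : Fin n → AnnCell 𝒪 n}
    {pend : Option 𝒪.Op} {pc : PC 𝒪 n} {o : 𝒪.Op} (h : ProcInv H A p pend pc)
    (ho : (A p).val = .op o) : pend = some o := by
  cases pc <;> simp [ProcInv, Looping, Finishing, ho, AnnVal.IsRsp] at h <;> simp_all

/-- `L` is the linearization built during the first `t` actions, `H` is their history, and `τ p` is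
the time of the last invocation by `p`. -/
structure LinInv (t : ℕ) (H : History 𝒪 n) (C : Conf 𝒪 n) (L : List (SeqOp 𝒪 n)) (τ : Fin n → ℕ) :
    Prop where
  lin : IsLinList 𝒪 H L
  future : ∀ x, t ≤ x → H x = none
  invoked : ∀ p o, C.pending p = some o → H (τ p) = some (.inv p o) ∧
    ∀ x e, τ p < x → H x = some e → e.proc ≠ p
  state : seqState 𝒪 L = (hd C).val.1
  applied : ∀ p r, applied (hd C) (an C) p = some r → ∃ e ∈ L, e.time = τ p ∧ e.resp = r
  fresh : ∀ p o, C.pending p = some o → Universal.applied (hd C) (an C) p = none →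
    ∀ e ∈ L, e.time ≠ τ p

/-- An idle process has an empty announcement, so nothing is recorded as applied for it and `τ p`
may move to the new invocation. -/
theorem LinInv.invoke {t : ℕ} {H : History 𝒪 n} {C C' : Conf 𝒪 n} {L : List (SeqOp 𝒪 n)}
    {τ : Fin n → ℕ} (h : LinInv t H C L τ) (hC : Inv C) {p : Fin n} {o : 𝒪.Op}
    (hpend : C.pending p = none) (hd_eq : hd C' = hd C)
    (an_eq : an C' = an C) (pending_eq : C'.pending = Function.update C.pending p (some o)) :
    LinInv (t + 1) (Function.update H t (some (.inv p o))) C' L (Function.update τ p t) := by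
  have hap : Universal.applied (hd C) (an C) p = none := by
    have := hC.proc p
    rw [hpend] at this
    refine applied_of_bot ?_
    cases h : (lo C p).pc <;> simp_all [ProcInv, Looping, Finishing]
  have htime : ∀ e ∈ L, e.time ≠ t := fun e he ht => by
    have := h.lin.mem e he
    rw [h.future _ ht.ge] at this
    cases this
  refine ⟨h.lin.extend h.future _ ?_, ?_, ?_, by rw [h.state, hd_eq], ?_, ?_⟩
  · rintro t₁ r ⟨p', o', -, -, h3, -⟩
    simp at h3
  · intro x hx
    rw [Function.update_of_ne (by omega)]
    exact h.future x (by omega)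
  · intro p' o' hp'
    rw [pending_eq] at hp'
    by_cases hpp : p' = p
    · subst hpp
      simp only [Function.update_self, Option.some.injEq] at hp' ⊢
      subst hp'
      refine ⟨rfl, fun x e hx he => ?_⟩
      rw [Function.update_of_ne (by omega), h.future x (by omega)] at he
      cases he
    · rw [Function.update_of_ne hpp] at hp' ⊢
      obtain ⟨h1, h2⟩ := h.invoked p' o' hp'
      have hlt : τ p' ≠ t := fun e => by rw [h.future _ e.ge] at h1; cases h1
      refine ⟨by rw [Function.update_of_ne hlt]; exact h1, fun x e hx he => ?_⟩
      by_cases hxt : x = t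
      · subst hxt
        simp only [Function.update_self, Option.some.injEq] at he
        subst he
        exact fun e => hpp e.symm
      · rw [Function.update_of_ne hxt] at he
        exact h2 x e hx he
  · intro p' r hr
    rw [hd_eq, an_eq] at hr
    have hpp : p' ≠ p := by rintro rfl; rw [hap] at hr; cases hr
    rw [Function.update_of_ne hpp]
    exact h.applied p' r hr
  · intro p' o' hp' hr e he
    by_cases hpp : p' = p
    · subst hpp
      rw [Function.update_self]
      exact htime e he
    · rw [Function.update_of_ne hpp]
      rw [pending_eq, Function.update_of_ne hpp] at hp'
      rw [hd_eq, an_eq] at hr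
      exact h.fresh p' o' hp' hr e he

theorem LinInv.not_returns {t : ℕ} {H : History 𝒪 n} {C : Conf 𝒪 n} {L : List (SeqOp 𝒪 n)}
    {τ : Fin n → ℕ} (h : LinInv t H C L τ) {p : Fin n} {o : 𝒪.Op} (hp : C.pending p = some o)
    (t' : ℕ) (r : 𝒪.Resp) : ¬ Returns H (τ p) t' r := by
  rintro ⟨p', o', h1, h2, h3, -⟩
  obtain ⟨h4, h5⟩ := h.invoked p o hp
  rw [h4] at h1
  cases h1
  exact h5 t' _ h2 h3 rfl

/-- Only the last invocation of `p` can be answered by a response of `p`. -/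
theorem LinInv.returns_eq {t t₁ : ℕ} {H : History 𝒪 n} {C : Conf 𝒪 n} {L : List (SeqOp 𝒪 n)}
    {τ : Fin n → ℕ} (h : LinInv t H C L τ) {p : Fin n} {o : 𝒪.Op} (hp : C.pending p = some o)
    {r r' : 𝒪.Resp} (hr : Returns (Function.update H t (some (.res p r))) t₁ t r') :
    t₁ = τ p ∧ r' = r := by
  obtain ⟨p', o', h1, h2, h3, h4⟩ := hr
  simp only [Function.update_self, Option.some.injEq, Event.res.injEq] at h3
  obtain ⟨rfl, rfl⟩ := h3
  refine ⟨?_, rfl⟩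
  rw [Function.update_of_ne h2.ne] at h1
  obtain ⟨h5, h6⟩ := h.invoked p o hp
  have hlt : τ p < t := by
    by_contra hlt
    rw [h.future _ (not_lt.1 hlt)] at h5
    cases h5
  rcases lt_trichotomy t₁ (τ p) with hlt' | heq | hlt'
  · refine absurd rfl (h4 (τ p) hlt' hlt (.inv p o) ?_)
    rw [Function.update_of_ne hlt.ne]
    exact h5
  · exact heq
  · exact absurd rfl (h6 t₁ _ hlt' h1)

/-- Common part of the steps that return a response. -/
theorem LinInv.respond {t : ℕ} {H : History 𝒪 n} {C C' : Conf 𝒪 n} {L L' : List (SeqOp 𝒪 n)}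
    {τ : Fin n → ℕ} (h : LinInv t H C L τ) (hL' : IsLinList 𝒪 H L') {p : Fin n} {o : 𝒪.Op}
    (hp : C.pending p = some o) {r : 𝒪.Resp}
    (hin : ∃ e ∈ L', e.time = τ p ∧ e.resp = r)
    (hsub : ∀ e ∈ L, e ∈ L') (hsub' : ∀ e ∈ L', e ∈ L ∨ e.time = τ p)
    (pending_eq : C'.pending p = none)
    (pending_other : ∀ p', p' ≠ p → C'.pending p' = C.pending p')
    (hs : seqState 𝒪 L' = (hd C').val.1)
    (hnone : Universal.applied (hd C') (an C') p = none)
    (ha : ∀ j, j ≠ p → Universal.applied (hd C') (an C') j = Universal.applied (hd C) (an C) j) :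
    LinInv (t + 1) (Function.update H t (some (.res p r))) C' L' τ := by
  refine ⟨hL'.extend h.future _ ?_, ?_, ?_, hs, ?_, ?_⟩
  · intro t₁ r' hr
    obtain ⟨rfl, rfl⟩ := h.returns_eq hp hr
    exact hin
  · intro x hx
    rw [Function.update_of_ne (by omega)]
    exact h.future x (by omega)
  · intro p' o' hp'
    by_cases hpp : p' = p
    · subst hpp
      rw [pending_eq] at hp'
      cases hp'
    · rw [pending_other _ hpp] at hp'
      obtain ⟨h1, h2⟩ := h.invoked p' o' hp'
      have hlt : τ p' ≠ t := fun e => by rw [h.future _ e.ge] at h1; cases h1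
      refine ⟨by rw [Function.update_of_ne hlt]; exact h1, fun x e hx he => ?_⟩
      by_cases hxt : x = t
      · subst hxt
        simp only [Function.update_self, Option.some.injEq] at he
        subst he
        exact fun e => hpp e.symm
      · rw [Function.update_of_ne hxt] at he
        exact h2 x e hx he
  · intro p' r' hr'
    have hpp : p' ≠ p := by rintro rfl; rw [hnone] at hr'; cases hr'
    rw [ha _ hpp] at hr'
    obtain ⟨e, he, h'⟩ := h.applied p' r' hr'
    exact ⟨e, hsub e he, h'⟩
  · intro p' o' hp' hr e he
    have hpp : p' ≠ p := by rintro rfl; rw [pending_eq] at hp'; cases hp'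
    rw [ha _ hpp] at hr
    rw [pending_other _ hpp] at hp'
    rcases hsub' e he with he | he
    · exact h.fresh p' o' hp' hr e he
    · rw [he]
      intro heq
      have h1 := (h.invoked p o hp).1
      have h2 := (h.invoked p' o' hp').1
      rw [← heq, h1] at h2
      cases h2
      exact hpp rfl

/-- The list grows only at the effects `apply` and `read`, and only at its end. The prefix relation
is what allows passing to the limit in infinite executions. -/
theorem LinInv.step {t : ℕ} {H : History 𝒪 n} {C C' : Conf 𝒪 n} {L : List (SeqOp 𝒪 n)}
    {τ : Fin n → ℕ} {a : ExecAction 𝒪 n} (h : LinInv t H C L τ) (hC : Inv C)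
    (hs : ConfStep C C' a) :
    ∃ L' τ', LinInv (t + 1) (Function.update H t a.event) C' L' τ' ∧ L <+: L' := by
  cases hs with
  | invoke p o hpend hd_eq an_eq lo_eq lo_other pending_eq =>
    exact ⟨L, _, h.invoke hC hpend hd_eq an_eq pending_eq, List.prefix_refl _⟩
  | step p s r hpend trans lo_other pending_eq pending_other =>
    obtain ⟨o, ho⟩ := Option.ne_none_iff_exists'.1 hpend
    have hset : ∀ p o, C.pending p = some o → ∀ p' o', C.pending p' = some o' → τ p = τ p' →
        p = p' := by
      intro p o hp p' o' hp' heq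
      have h1 := (h.invoked p o hp).1
      have h2 := (h.invoked p' o' hp').1
      rw [← heq, h1] at h2
      cases h2
      rfl
    have hnone : Function.update H t none = H := by
      rw [← h.future t le_rfl]; exact Function.update_eq_self ..
    cases trans.effect hC.head (hC.proc p) with
    | quiet hst ha =>
      have hpend' : C'.pending = C.pending := funext fun p' => by
        by_cases hpp : p' = p
        · subst hpp; simpa using pending_eq
        · exact pending_other p' hpp
      refine ⟨L, τ, ?_, List.prefix_refl _⟩
      show LinInv (t + 1) (Function.update H t none) C' L τ
      rw [hnone]
      refine ⟨h.lin, fun x hx => h.future x (by omega), ?_, by rw [h.state, hst], ?_, ?_⟩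
      · rw [hpend']; exact h.invoked
      · intro p' r; rw [ha]; exact h.applied p' r
      · intro p' r; rw [ha, hpend']; exact h.fresh p' r
    | apply j o' rsp hA hΔ hj hj' ha =>
      have hpend' : C'.pending = C.pending := funext fun p' => by
        by_cases hpp : p' = p
        · subst hpp; simpa using pending_eq
        · exact pending_other p' hpp
      -- The applied operation may belong to a process `j` other than the one that moves; it is
      -- still pending there, so it is listed under the invocation at `τ j`.
      have hpj := (hC.proc j).pending_of_op hA
      have hl := h.lin.append ⟨τ j, j, o', rsp⟩ (h.invoked j o' hpj).1 (h.fresh j o' hpj hj)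
        (by simp only [h.state, hΔ]) (h.not_returns hpj)
      refine ⟨_, τ, ?_, List.prefix_append L [⟨τ j, j, o', rsp⟩]⟩
      show LinInv (t + 1) (Function.update H t none) C' _ τ
      rw [hnone]
      refine ⟨hl, fun x hx => h.future x (by omega), ?_, ?_, ?_, ?_⟩
      · rw [hpend']; exact h.invoked
      · rw [seqState_concat]
        simp only [h.state, hΔ]
      · intro p' r hr
        by_cases hpp : p' = j
        · subst hpp
          rw [hj'] at hr
          cases hr
          exact ⟨_, List.mem_append_right _ (List.mem_singleton_self _), rfl, rfl⟩
        · rw [ha _ hpp] at hr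
          obtain ⟨e, he, h'⟩ := h.applied p' r hr
          exact ⟨e, List.mem_append_left _ he, h'⟩
      · intro p' r hp' hr e he
        have hpp : p' ≠ j := by rintro rfl; rw [hj'] at hr; cases hr
        rw [ha _ hpp] at hr
        rw [hpend'] at hp'
        rcases List.mem_append.1 he with he | he
        · exact h.fresh p' r hp' hr e he
        · rw [List.mem_singleton.1 he]
          exact fun heq => hpp (hset _ _ hpj _ _ hp' heq).symm
    | finish r hst hp hp' ha =>
      refine ⟨L, τ, ?_, List.prefix_refl _⟩
      exact h.respond h.lin ho (h.applied p r hp) (fun _ => id) (fun _ => Or.inl)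
        (by simpa using pending_eq) pending_other (by rw [h.state, hst]) hp' ha
    | read op hop hst hΔ hp ha =>
      have hl := h.lin.append ⟨τ p, p, op, (𝒪.Δ (hd C).val.1 op).2⟩ (h.invoked p op hop).1
        (h.fresh p op hop hp) (by simp only [h.state]) (h.not_returns hop)
      refine ⟨_, τ, ?_, List.prefix_append L [⟨τ p, p, op, (𝒪.Δ (hd C).val.1 op).2⟩]⟩
      refine h.respond hl ho ⟨_, List.mem_append_right _ (List.mem_singleton_self _), rfl, rfl⟩
        (fun e he => List.mem_append_left _ he) ?_
        (by simpa using pending_eq) pending_other ?_ (by rw [ha, hp]) (fun j _ => ha j)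
      · intro e he
        rcases List.mem_append.1 he with he | he
        · exact Or.inl he
        · rw [List.mem_singleton.1 he]; exact Or.inr rfl
      · rw [seqState_concat]
        simp only [h.state, hΔ, hst]

theorem linInv_init :
    LinInv 0 (fun _ => none) (universalImplementation 𝒪 n).initConfig [] fun _ => 0 where
  lin := ⟨by simp, by simp, fun _ _ _ ⟨_, _, h, _⟩ => (nomatch h), by simp, by simp⟩
  future _ _ := rfl
  invoked p o h := by cases h
  state := rfl
  applied p r h := by cases h
  fresh p o h := by cases h

/-- The history of a list of actions. -/
def historyOf (as : List (ExecAction 𝒪 n)) : History 𝒪 n := fun t => as[t]?.bind ExecAction.event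

theorem historyOf_concat (as : List (ExecAction 𝒪 n)) (a : ExecAction 𝒪 n) :
    historyOf (as ++ [a]) = Function.update (historyOf as) as.length a.event := by
  funext t
  rcases lt_trichotomy t as.length with h | h | h
  · simp [historyOf, h.ne, List.getElem?_append_left h]
  · subst h; simp [historyOf]
  · rw [Function.update_of_ne h.ne']
    simp only [historyOf]
    rw [List.getElem?_eq_none (by simp; omega), List.getElem?_eq_none h.le]

theorem exists_linInv_of_reach {as : List (ExecAction 𝒪 n)} {C : Conf 𝒪 n}
    (h : (universalImplementation 𝒪 n).Reach as C) :
    ∃ L τ, LinInv as.length (historyOf as) C L τ := by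
  induction h with
  | nil => exact ⟨[], _, linInv_init⟩
  | snoc hr hs ih =>
    obtain ⟨L, τ, ih⟩ := ih
    have hinv := inv_of_reach hr
    obtain ⟨L', τ', h', -⟩ := ih.step hinv (hinv.confStep hs)
    refine ⟨L', τ', ?_⟩
    rw [historyOf_concat, List.length_append]
    exact h'

theorem InfExec.inv (ρ : (universalImplementation 𝒪 n).InfExec) (t : ℕ) : Inv (ρ.cfg t) := by
  induction t with
  | zero => rw [ρ.init]; exact inv_init
  | succ t ih => exact (ih.confStep (ρ.step t)).inv ih

theorem InfExec.confStep (ρ : (universalImplementation 𝒪 n).InfExec) (t : ℕ) :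
    ConfStep (ρ.cfg t) (ρ.cfg (t + 1)) (ρ.act t) :=
  (InfExec.inv ρ t).confStep (ρ.step t)

theorem linearizable : (universalImplementation 𝒪 n).Linearizable := by
  refine ⟨fun α => ?_, fun ρ => ?_⟩
  · obtain ⟨L, τ, h⟩ := exists_linInv_of_reach α.reach
    exact ⟨L, h.lin.isLinearization⟩
  -- The subtypes carry the invariant, so that `choose` yields a successor function that can be
  -- iterated.
  · have hstep : ∀ (t : ℕ)
        (x : {x : List (SeqOp 𝒪 n) × (Fin n → ℕ) //
          LinInv t (ρ.history.before t) (ρ.cfg t) x.1 x.2}),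
        ∃ y : {y : List (SeqOp 𝒪 n) × (Fin n → ℕ) //
          LinInv (t + 1) (ρ.history.before (t + 1)) (ρ.cfg (t + 1)) y.1 y.2},
          x.1.1 <+: y.1.1 := by
      rintro t ⟨⟨L, τ⟩, h⟩
      obtain ⟨L', τ', h', hL⟩ := h.step (InfExec.inv ρ t) (InfExec.confStep ρ t)
      refine ⟨⟨(L', τ'), ?_⟩, hL⟩
      rw [History.before_succ]
      exact h'
    choose f hf using hstep
    have h0 : LinInv 0 (ρ.history.before 0) (ρ.cfg 0) [] fun _ => 0 := by
      rw [ρ.init]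
      exact linInv_init
    let g : ∀ t, {x : List (SeqOp 𝒪 n) × (Fin n → ℕ) //
        LinInv t (ρ.history.before t) (ρ.cfg t) x.1 x.2} :=
      fun t => Nat.rec ⟨([], fun _ => 0), h0⟩ f t
    exact exists_isLinearization ρ.history (fun t => (g t).1.1) (fun t => hf t (g t))
      fun t => (g t).2.lin

/-- Any linearization that ends in the state stored in `head` serves, because the quiescent memory
depends on this state alone. -/
theorem stateQuiescentHI : (universalImplementation 𝒪 n).StateQuiescentHI := by
  have hex : ∀ α : (universalImplementation 𝒪 n).FinExec, ∃ L,
      IsLinearization 𝒪 α.history (fun k => L[k]?) ∧ seqState 𝒪 L = (hd α.last).val.1 := by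
    intro α
    obtain ⟨L, τ, h⟩ := exists_linInv_of_reach α.reach
    exact ⟨L, h.lin.isLinearization, h.state⟩
  choose h h1 h2 using hex
  refine ⟨h, h1, fun α hα β hβ heq => ?_⟩
  rw [h2, h2] at heq
  obtain ⟨a1, a2⟩ := (inv_of_reach α.reach).mem_of_stateQuiescent hα
  obtain ⟨b1, b2⟩ := (inv_of_reach β.reach).mem_of_stateQuiescent hβ
  rw [heq, ← b1] at a1
  rw [← b2] at a2
  funext b
  cases b with
  | head => exact a1
  | announce j => exact congrFun a2 j

end Universal

namespace Universal

variable {𝒪 : AbstractObject.{u}} {n : ℕ}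

/-! ### Measures of progress -/

/-- The program counter without the state of the retry loops. -/
def skel : PC 𝒪 n → PC 𝒪 n
  | .llHead op _ => .llHead op .read
  | .scApply op st rsp j _ => .scApply op st rsp j .read
  | .llAnnounce op q rsp j _ right => .llAnnounce op q rsp j .read (right.map fun _ => .read)
  | .scAnnounce op q rsp j a _ => .scAnnounce op q rsp j a .read
  | .scHeadBot op q j a _ => .scHeadBot op q j a .read
  | .rlAnnounce op j _ => .rlAnnounce op j .read
  | .llHeadEnd r _ => .llHeadEnd r .read
  | .scHeadEnd r q _ => .scHeadEnd r q .read
  | .rlHead r _ => .rlHead r .read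
  | pc => pc

/-- The position in the program of a process whose response has been announced; it never
decreases. -/
def position : PC 𝒪 n → ℕ
  | .idle | .readOnly _ | .announceOp _ => 0
  | .llHead _ _ => 1
  | .loadHelp _ _ => 2
  | .loadOwn _ _ => 3
  | .scApply _ _ _ _ _ => 4
  | .llAnnounce _ _ _ _ _ none => 2
  | .llAnnounce _ _ _ _ _ (some _) => 3
  | .vlHead _ _ _ _ _ => 4
  | .scAnnounce _ _ _ _ _ _ => 5
  | .scHeadBot _ _ _ _ _ => 6
  | .rlAnnounce _ _ _ => 7
  | .loopTest _ => 8
  | .loadResponse => 9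
  | .llHeadEnd _ _ => 10
  | .scHeadEnd _ _ _ => 11
  | .rlHead _ _ => 11
  | .clearAnnounce _ => 12

/-- The position in the program of a process whose operation has no response yet, while the values
of all variables are constant. `x` is the context bit of the process in `head`. -/
def openPosition (x : Bool) : PC 𝒪 n → ℕ
  | .llHead _ _ => 9
  | .loadHelp _ _ => if x then 12 else 2
  | .loadOwn _ _ => if x then 13 else 3
  | .scApply _ _ _ _ _ => if x then 14 else 4
  | .llAnnounce _ _ _ _ _ _ => if x then 12 else 2
  | .vlHead _ _ _ _ _ => if x then 14 else 4
  | .scAnnounce _ _ _ _ _ _ => if x then 15 else 5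
  | .scHeadBot _ _ _ _ _ => if x then 16 else 6
  | .rlAnnounce _ _ _ => 7
  | .loopTest _ => 8
  | _ => 0

/-- A measure of progress that never decreases while the values of all variables are constant. -/
def rank (v : AnnVal 𝒪) (x : Bool) (pc : PC 𝒪 n) : ℕ :=
  match v with
  | .bot => 0
  | .op _ => openPosition x pc
  | .rsp _ => position pc

theorem rank_le (v : AnnVal 𝒪) (x : Bool) (pc : PC 𝒪 n) : rank v x pc ≤ 16 := by
  unfold rank
  split
  · omega
  · unfold openPosition; split <;> first | omega | (split_ifs <;> omega)
  · unfold position; split <;> omega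

theorem position_le (pc : PC 𝒪 n) : position pc ≤ 16 := by
  unfold position; split <;> omega

theorem position_skel (pc : PC 𝒪 n) : position (skel pc) = position pc := by
  cases pc with
  | llAnnounce op q rsp j c right => cases right <;> rfl
  | _ => rfl

theorem position_congr {pc pc' : PC 𝒪 n} (h : skel pc' = skel pc) : position pc' = position pc := by
  rw [← position_skel, h, position_skel]

theorem rank_congr (v : AnnVal 𝒪) (x : Bool) {pc pc' : PC 𝒪 n} (h : skel pc' = skel pc) :
    rank v x pc' = rank v x pc := by
  have hskel : ∀ pc : PC 𝒪 n, openPosition x (skel pc) = openPosition x pc := by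
    intro pc; cases pc <;> rfl
  cases v with
  | bot => rfl
  | op => exact (hskel pc').symm.trans (h ▸ hskel pc)
  | rsp => exact position_congr h

open Classical in
/-- The progress of a retry loop on the cell `X`. -/
noncomputable def retryProgress {W : Type u} (X : Cell W n) : Retry W n → ℕ
  | .read => 1
  | .cas cur => if cur = X then 2 else 0

/-- The progress of the retry loop that has to be served. -/
noncomputable def loopProgress (H : HeadCell 𝒪 n) (A : Fin n → AnnCell 𝒪 n) : PC 𝒪 n → ℕ
  | .llHead _ c => retryProgress H c
  | .scApply _ _ _ _ c => retryProgress H c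
  | .llAnnounce _ _ _ j c none => retryProgress (A j) c
  | .llAnnounce _ _ _ j _ (some d) => retryProgress (A j) d
  | .scAnnounce _ _ _ j _ c => retryProgress (A j) c
  | .scHeadBot _ _ _ _ c => retryProgress H c
  | .rlAnnounce _ j c => retryProgress (A j) c
  | .llHeadEnd _ c => retryProgress H c
  | .scHeadEnd _ _ c => retryProgress H c
  | .rlHead _ c => retryProgress H c
  | _ => 0

theorem retryProgress_le {W : Type u} (X : Cell W n) (c : Retry W n) : retryProgress X c ≤ 2 := by
  unfold retryProgress; split <;> first | omega | (split_ifs <;> omega)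

theorem loopProgress_le (H : HeadCell 𝒪 n) (A : Fin n → AnnCell 𝒪 n) (pc : PC 𝒪 n) :
    loopProgress H A pc ≤ 2 := by
  unfold loopProgress; split <;> first | exact retryProgress_le _ _ | omega

/-- The side of an interleaved block whose steps make progress when the memory is constant. -/
def needed : PC 𝒪 n → Option Side
  | .llHead _ _ => some .left
  | .llAnnounce _ _ _ _ _ none => some .left
  | .llAnnounce _ _ _ _ _ (some _) => some .right
  | .llHeadEnd _ _ => some .left
  | _ => none

theorem needed_skel (pc : PC 𝒪 n) : needed (skel pc) = needed pc := by
  cases pc with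
  | llAnnounce op q rsp j c right => cases right <;> rfl
  | _ => rfl

theorem mustServe_of_needed {l : LocalState 𝒪 n} {s : Side} (h : needed l.pc = some s) :
    mustServe s l := by
  rcases l with ⟨pr, pc⟩
  cases pc with
  | llAnnounce op q rsp j c right => cases right <;> simp_all [needed, mustServe]
  | _ => simp_all [needed, mustServe]

/-- Once the response is announced, the loop test can only exit; this is why `position` puts
`loopTest` above the whole loop body. A step that does not advance leaves the memory alone. -/
theorem Trans.skel_or_position_lt {p : Fin n} {s : Side} {H H' : HeadCell 𝒪 n}
    {A A' : Fin n → AnnCell 𝒪 n} {l l' : LocalState 𝒪 n} {pend : Option 𝒪.Op}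
    (h : Trans p s H A l H' A' l' none) (hp : ProcInv H A p pend l.pc) (hA : (A p).val.IsRsp) :
    (skel l'.pc = skel l.pc ∧ H' = H ∧ A' = A) ∨ position l.pc < position l'.pc := by
  obtain ⟨r, hr⟩ := hA
  cases h with
  | announce => simp [ProcInv, hr] at hp
  | loadResponseStay h => exact absurd hr (h r)
  | llAnnRead => rename_i rt; cases rt <;> exact Or.inl ⟨rfl, rfl, rfl⟩
  | llAnnFail => rename_i rt _ _; cases rt <;> exact Or.inl ⟨rfl, rfl, rfl⟩
  | llAnnSucc => rename_i rt _ _; right; cases rt <;> simp [position]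
  | vlFalse | scBotFalse => right; rename_i a _; cases a <;> simp [afterHelp, position]
  | scBotSucc => right; rename_i a _ _; cases a <;> simp [afterHelp, position]
  | loopEnter h => exact absurd hr (h r)
  | _ => first | exact Or.inl ⟨rfl, rfl, rfl⟩ | exact Or.inr (by simp [position])

/-- A pass with a stale link (values up to 7) runs back to the loop test and on to a fresh LL, which
lifts the measure to 12 or more. From there the bit stays set while `head` keeps its value, and the
loop test can be reached again only through an SC that changes `head`, contrary to `hH'`. -/
theorem Trans.skel_or_openPosition_lt {p : Fin n} {s : Side} {H H' : HeadCell 𝒪 n}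
    {A A' : Fin n → AnnCell 𝒪 n} {l l' : LocalState 𝒪 n} {pend : Option 𝒪.Op}
    {r : Option 𝒪.Resp} {o : 𝒪.Op}
    (h : Trans p s H A l H' A' l' r) (hp : ProcInv H A p pend l.pc) (hA : (A p).val = .op o)
    (hH' : H'.val = H.val) (hA' : ∀ j, (A' j).val = (A j).val) :
    (skel l'.pc = skel l.pc ∧ H' = H ∧ A' = A) ∨
      openPosition (H.context p) l.pc < openPosition (H'.context p) l'.pc := by
  cases h with
  | vlFalse h =>
    right; rename_i a; cases a <;> simp [afterHelp, openPosition, h]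
  | scBotFalse h =>
    right; rename_i a; cases a <;> simp [afterHelp, openPosition, h]
  | scApplySucc h =>
    subst h
    obtain ⟨q, o, h1, -⟩ := hp.2.2 (hp.2.1 _ rfl)
    rw [h1] at hH'; cases hH'
  | scBotSucc h =>
    subst h
    obtain ⟨⟨r, h1⟩, -⟩ := hp.2.2 (hp.2.1 _ rfl)
    rw [h1] at hH'; cases hH'
  | scAnnSucc h =>
    subst h
    rename_i j _
    obtain ⟨⟨o, h1⟩, -⟩ := hp.2.2.2.2 (hp.2.1 _ rfl)
    have := hA' j
    rw [h1] at this
    simp [Cell.fresh] at this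
  | llHeadNone => right; simp [openPosition, setBit_context_self]
  | llHeadSome => right; simp [openPosition, setBit_context_self]
  | scApplyFalse h => right; simp [openPosition, h]
  | llAnnRead => rename_i rt; cases rt <;> exact Or.inl ⟨rfl, rfl, rfl⟩
  | llAnnFail => rename_i rt _ _; cases rt <;> exact Or.inl ⟨rfl, rfl, rfl⟩
  | llAnnRlRead | llAnnRlDone | llAnnRlSucc | llAnnRlFail =>
    obtain ⟨⟨r, hr⟩, -⟩ := hp.2.2 _ rfl
    rw [hA] at hr; cases hr
  | _ =>
    first
    | exact Or.inl ⟨rfl, rfl, rfl⟩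
    | (exfalso; simp_all [ProcInv, Finishing]; done)
    | (right; simp only [openPosition]; cases H.context p <;> simp)

/-- Its purpose: while all values are constant, every change of a context bit strictly raises the
rank of its author. With an empty announcement, the only step that writes would change a value. -/
theorem Trans.rank_lt {p : Fin n} {s : Side} {H H' : HeadCell 𝒪 n}
    {A A' : Fin n → AnnCell 𝒪 n} {l l' : LocalState 𝒪 n} {pend : Option 𝒪.Op}
    {r : Option 𝒪.Resp} (h : Trans p s H A l H' A' l' r) (hp : ProcInv H A p pend l.pc)
    (hH' : H'.val = H.val) (hA' : ∀ j, (A' j).val = (A j).val) :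
    (H' = H ∧ A' = A ∧ ((A p).val ≠ .bot → skel l'.pc = skel l.pc)) ∨
      rank (A p).val (H.context p) l.pc < rank (A' p).val (H'.context p) l'.pc := by
  rw [hA' p]
  rcases hv : (A p).val with _ | o | r'
  · left
    have hv' := hA' p
    cases h <;> simp_all [ProcInv, Looping, Finishing, AnnVal.IsRsp, Cell.fresh]
  · rcases h.skel_or_openPosition_lt hp hv hH' hA' with ⟨h1, h2, h3⟩ | h
    · exact Or.inl ⟨h2, h3, fun _ => h1⟩
    · exact Or.inr h
  · have hr : r = none := by
      have hv' := hA' p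
      cases h <;> simp_all [ProcInv, Cell.fresh]
    subst hr
    rcases h.skel_or_position_lt hp ⟨_, hv⟩ with ⟨h1, h2, h3⟩ | h
    · exact Or.inl ⟨h2, h3, fun _ => h1⟩
    · exact Or.inr h

/-- A step inside a retry loop. -/
theorem Trans.loopProgress_of_skel {p : Fin n} {s : Side} {H H' : HeadCell 𝒪 n}
    {A A' : Fin n → AnnCell 𝒪 n} {l l' : LocalState 𝒪 n} {pend : Option 𝒪.Op}
    {r : Option 𝒪.Resp} (h : Trans p s H A l H' A' l' r) (hp : ProcInv H A p pend l.pc)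
    (hs : skel l'.pc = skel l.pc) :
    loopProgress H A l.pc ≤ loopProgress H A l'.pc ∧
      ((∀ s', needed l.pc = some s' → s' = s) →
        loopProgress H A l.pc < loopProgress H A l'.pc) := by
  cases h with
  | vlFalse | scBotFalse => rename_i a _; cases a <;> simp [afterHelp, skel] at hs
  | scBotSucc => rename_i a _ _; cases a <;> simp [afterHelp, skel] at hs
  -- The invariant guarantees an announced response here, so this self-loop never occurs.
  | loadResponseStay h =>
    obtain ⟨r, hr⟩ := hp
    exact absurd hr.2 (h r)
  | llAnnRead => rename_i rt; cases rt <;> simp [loopProgress, retryProgress, needed]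
  | llAnnFail h =>
    rename_i rt _; cases rt <;> simp [loopProgress, retryProgress, needed, h.symm]
  | llHeadRead | endRead | scApplyRead | scAnnRead | scBotRead | rlAnnRead | scEndRead
  | rlHeadRead | llAnnRlRead => simp [loopProgress, retryProgress, needed]
  | llHeadFail h | endFail h | scApplyFail h | scAnnFail h | scBotFail h | rlAnnFail h
  | scEndFail h | rlHeadFail h | llAnnRlFail h =>
    simp [loopProgress, retryProgress, needed, h.symm]
  -- Waiting happens on the right, whereas the needed side is the left.
  | llHeadWait | llAnnWait | endWait => simp [needed]
  | _ => simp [skel] at hs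

end Universal

namespace Universal

variable {𝒪 : AbstractObject.{u}} {n : ℕ}

/-! ### Changes of the memory -/

theorem MemStep.not_heldFor {p j : Fin n} {H H' : HeadCell 𝒪 n} {A A' : Fin n → AnnCell 𝒪 n}
    (h : MemStep p H A H' A') (hj : ∀ o, (A j).val ≠ .op o) (hH : ¬ HeldFor H j) :
    ¬ HeldFor H' j := by
  cases h with
  | apply h1 h2 h3 =>
    rintro ⟨q, r, h⟩
    simp only [Cell.fresh, Prod.mk.injEq, Option.some.injEq] at h
    exact hj _ (h.2.2 ▸ h2)
  | headBot => rintro ⟨q, r, h⟩; simp [Cell.fresh] at h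
  | _ => exact hH

/-- The only value change of an occupied `head` is `headBot`, which requires the announced response.
-/
theorem MemStep.of_heldFor {p j : Fin n} {H H' : HeadCell 𝒪 n} {A A' : Fin n → AnnCell 𝒪 n}
    (h : MemStep p H A H' A') (hj : HeldFor H j) (hv : H'.val ≠ H.val) :
    (A j).val.IsRsp ∧ ¬ HeldFor H' j := by
  obtain ⟨q, r, hj⟩ := hj
  cases h with
  | apply h1 => rw [hj] at h1; cases h1
  | headBot h1 h2 =>
    rw [hj] at h1
    cases h1
    exact ⟨h2, by rintro ⟨q, r, h⟩; simp [Cell.fresh] at h⟩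
  | _ => exact absurd rfl hv

theorem MemStep.of_none {p : Fin n} {H H' : HeadCell 𝒪 n} {A A' : Fin n → AnnCell 𝒪 n}
    (h : MemStep p H A H' A') (hj : H.val.2 = none) (hv : H'.val ≠ H.val) :
    H'.val.2 ≠ none := by
  cases h with
  | apply => simp [Cell.fresh]
  | headBot h1 => rw [h1] at hj; cases hj
  | _ => exact absurd rfl hv

theorem MemStep.head_context {p : Fin n} {H H' : HeadCell 𝒪 n} {A A' : Fin n → AnnCell 𝒪 n}
    (h : MemStep p H A H' A') (hv : H'.val ≠ H.val) (i : Fin n) : H'.context i = false := by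
  cases h <;> first | rfl | exact absurd rfl hv

theorem MemStep.ann_context {p j : Fin n} {H H' : HeadCell 𝒪 n} {A A' : Fin n → AnnCell 𝒪 n}
    (h : MemStep p H A H' A') (hv : (A' j).val ≠ (A j).val) (i : Fin n) :
    (A' j).context i = false := by
  cases h <;> grind [Function.update_apply, setBit_val, fresh_context]

theorem MemStep.head_context_of_ne {p i : Fin n} {H H' : HeadCell 𝒪 n} {A A' : Fin n → AnnCell 𝒪 n}
    (h : MemStep p H A H' A') (hi : i ≠ p) (hv : H'.val = H.val) : H'.context i = H.context i := by
  cases h with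
  | headBit x => exact setBit_context_of_ne _ hi _
  | apply h1 => rw [h1] at hv; cases hv
  | headBot h1 => rw [h1] at hv; cases hv
  | _ => rfl

theorem MemStep.head_context_false {p i : Fin n} {H H' : HeadCell 𝒪 n} {A A' : Fin n → AnnCell 𝒪 n}
    (h : MemStep p H A H' A') (hi : i ≠ p) (hc : H.context i = false) : H'.context i = false := by
  by_cases hv : H'.val = H.val
  · rw [h.head_context_of_ne hi hv, hc]
  · exact h.head_context hv i

theorem MemStep.ann_context_false {p i j : Fin n} {H H' : HeadCell 𝒪 n}
    {A A' : Fin n → AnnCell 𝒪 n} (h : MemStep p H A H' A') (hi : i ≠ p)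
    (hc : (A j).context i = false) : (A' j).context i = false := by
  cases h <;> grind [Function.update_apply, setBit_context_of_ne, fresh_context]

theorem MemStep.ann_val {p j : Fin n} {H H' : HeadCell 𝒪 n} {A A' : Fin n → AnnCell 𝒪 n}
    (h : MemStep p H A H' A') (hv : (A' j).val ≠ (A j).val) :
    (∃ o, (A j).val = .op o ∧ (A' j).val.IsRsp ∧ HeldFor H j) ∨
    ((A j).val = .bot ∧ ∃ o, (A' j).val = .op o) ∨
    ((A j).val.IsRsp ∧ (A' j).val = .bot ∧ ¬ HeldFor H j ∧ j = p) := by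
  cases h <;> grind [Function.update_apply, setBit_val, fresh_val, AnnVal.IsRsp, HeldFor]

open Classical in
/-- A potential of the value announced by `j`, for constant `head`. -/
noncomputable def valuePotential (H : HeadCell 𝒪 n) (j : Fin n) : AnnVal 𝒪 → ℕ
  | .bot => if HeldFor H j then 0 else 1
  | .op _ => if HeldFor H j then 0 else 2
  | .rsp _ => if HeldFor H j then 1 else 0

theorem valuePotential_le (H : HeadCell 𝒪 n) (j : Fin n) (a : AnnVal 𝒪) :
    valuePotential H j a ≤ 2 := by
  unfold valuePotential; split <;> split_ifs <;> omega

/-- An entry cycles through ⊥, operation and response, but a constant `head` cuts the cycle: if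
`head` is held for `j` the response cannot be cleared, otherwise the operation cannot be answered.
-/
theorem MemStep.valuePotential {p : Fin n} (j : Fin n) {H H' : HeadCell 𝒪 n}
    {A A' : Fin n → AnnCell 𝒪 n} (h : MemStep p H A H' A') (hg : HeadInv H A)
    (hv : H'.val = H.val) :
    (A' j).val = (A j).val ∨
      Universal.valuePotential H j (A j).val < Universal.valuePotential H' j (A' j).val := by
  have hh : HeldFor H' j = HeldFor H j := by unfold HeldFor; rw [hv]
  by_cases hne : (A' j).val = (A j).val
  · exact Or.inl hne
  right
  rcases h.ann_val hne with ⟨o, h1, ⟨r, h2⟩, h3⟩ | ⟨h1, o, h2⟩ | ⟨⟨r, h1⟩, h2, h3, -⟩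
  · simp [Universal.valuePotential, h1, h2, hh, h3]
  · have : ¬ HeldFor H j := fun ⟨q, r, h⟩ => (hg q r j h).1 h1
    simp [Universal.valuePotential, h1, h2, hh, this]
  · simp [Universal.valuePotential, h1, h2, hh, h3]

/-- How far a process is from leaving the block in which it accesses `announce[j]`. -/
def visit (j : Fin n) : PC 𝒪 n → ℕ
  | .llAnnounce _ _ _ j' _ _ => if j' = j then 0 else 3
  | .vlHead _ _ _ j' _ => if j' = j then 1 else 3
  | .scAnnounce _ _ _ j' _ _ => if j' = j then 1 else 3
  | .scHeadBot _ _ j' _ _ => if j' = j then 1 else 3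
  | .rlAnnounce _ j' _ => if j' = j then 2 else 3
  | _ => 3

theorem visit_le (j : Fin n) (pc : PC 𝒪 n) : visit j pc ≤ 3 := by
  unfold visit; split <;> first | omega | (split_ifs <;> omega)

theorem visit_afterHelp (op : 𝒪.Op) (j j' : Fin n) (a : AnnVal 𝒪) :
    (if j' = j then 1 else 3) ≤ visit j (afterHelp op j' a) := by
  cases a <;> simp only [afterHelp, visit] <;> split_ifs <;> omega

/-- A visit to `announce[j]` starts only when LL of `head` returns a response for `j`, which `hj`
forbids. Visits under way can only advance, and each successful LL or RL on the entry advances one.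
-/
theorem Trans.visit {p : Fin n} {s : Side} {H H' : HeadCell 𝒪 n}
    {A A' : Fin n → AnnCell 𝒪 n} {l l' : LocalState 𝒪 n} {pend : Option 𝒪.Op}
    {r : Option 𝒪.Resp} (h : Trans p s H A l H' A' l' r) (hp : ProcInv H A p pend l.pc)
    {j : Fin n} (hj : ¬ HeldFor H j) (hv : (A' j).val = (A j).val) :
    (A' j = A j ∧ Universal.visit j l.pc ≤ Universal.visit j l'.pc) ∨
      Universal.visit j l.pc < Universal.visit j l'.pc := by
  cases h with
  | vlFalse | scBotFalse | scBotSucc => exact Or.inl ⟨rfl, visit_afterHelp ..⟩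
  | announce =>
    by_cases h : j = p
    · subst h
      have := hp.2.2.1
      rw [this] at hv
      simp [Cell.fresh] at hv
    · exact Or.inl ⟨by simp [h], le_rfl⟩
  | clear =>
    by_cases h : j = p
    · subst h
      have := hp.1.2
      rw [this] at hv
      simp [Cell.fresh] at hv
    · exact Or.inl ⟨by simp [h], le_rfl⟩
  | llHeadSome h hq =>
    rename_i j'
    have : j' ≠ j := by rintro rfl; exact hj ⟨_, _, hq⟩
    exact Or.inl ⟨rfl, by simp [Universal.visit, this]⟩
  | scAnnSucc h =>
    subst h
    rename_i j' _
    obtain ⟨⟨o, h1⟩, -⟩ := hp.2.2.2.2 (hp.2.1 _ rfl)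
    by_cases h : j = j'
    · subst h
      rw [h1] at hv
      simp [Cell.fresh] at hv
    · exact Or.inl ⟨by simp [h], by simp [Universal.visit]⟩
  | llAnnSucc | llAnnRlSucc | rlAnnSucc =>
    simp only [Universal.visit, Function.update_apply]
    grind
  | _ =>
    refine Or.inl ⟨rfl, ?_⟩
    simp only [Universal.visit]
    first | exact le_rfl | (split_ifs <;> omega)

/-! ### Priorities -/

/-- The SC of `scApply` is both the only step that moves the priority and the only one that occupies
`head`, so either event identifies the other. -/
theorem Trans.priority {p : Fin n} {s : Side} {H H' : HeadCell 𝒪 n}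
    {A A' : Fin n → AnnCell 𝒪 n} {l l' : LocalState 𝒪 n} {pend : Option 𝒪.Op}
    {r : Option 𝒪.Resp} (h : Trans p s H A l H' A' l' r) (hp : ProcInv H A p pend l.pc) :
    (l'.priority = l.priority ∧ (H.val.2 = none → H'.val.2 = none)) ∨
    (l'.priority = succMod l.priority ∧ H.val.2 = none ∧ H'.val.2 ≠ none ∧
      (∃ op, l'.pc = .loopTest op) ∧
      ∃ op st rsp j c, l.pc = .scApply op st rsp j c ∧ HeldFor H' j) := by
  cases h with
  | scApplySucc h =>
    subst h
    obtain ⟨q, o, h1, -⟩ := hp.2.2 (hp.2.1 _ rfl)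
    exact Or.inr ⟨rfl, by rw [h1], by simp [Cell.fresh], ⟨_, rfl⟩, _, _, _, _, _, rfl, _, _, rfl⟩
  | scBotSucc | scEndSucc => exact Or.inl ⟨rfl, fun _ => rfl⟩
  | _ => exact Or.inl ⟨rfl, id⟩

/-- If the priority is `j`, then the process is not about to help anybody else but `j`. -/
def HelpsPriority (j : Fin n) (l : LocalState 𝒪 n) : Prop :=
  l.priority = j →
    match l.pc with
    | .loadOwn _ _ => False
    | .scApply _ _ _ j' _ => j' = j
    | _ => True

/-- With priority `j`, `loadHelp` finds the operation of `j` and must select it; the priority then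
stays fixed until the SC succeeds. -/
theorem Trans.helpsPriority {p j : Fin n} {s : Side} {H H' : HeadCell 𝒪 n}
    {A A' : Fin n → AnnCell 𝒪 n} {l l' : LocalState 𝒪 n} {o : 𝒪.Op}
    {r : Option 𝒪.Resp} (h : Trans p s H A l H' A' l' r) (hj : (A j).val = .op o)
    (hl : HelpsPriority j l) : HelpsPriority j l' := by
  cases h with
  | loadHelpOp => exact fun h => h
  | loadHelpNot h =>
    rintro rfl
    exact h _ hj
  | loadOwnOp => exact fun h => (hl h).elim
  | scApplyRead | scApplyFail => exact hl
  | vlFalse | scBotFalse => rename_i a _; cases a <;> exact fun _ => trivial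
  | scBotSucc => rename_i a _ _; cases a <;> exact fun _ => trivial
  | _ => exact fun _ => trivial

/-! ### The final kinds of retry loops -/

/-- The process waits for a condition on the right side of an interleaved block. -/
def Waiting : PC 𝒪 n → Prop
  | .llHead _ _ => True
  | .llAnnounce _ _ _ _ _ none => True
  | .llHeadEnd _ _ => True
  | _ => False

/-- The process executes SC or RL on `head`. -/
def OnHead : PC 𝒪 n → Prop
  | .scApply _ _ _ _ _ => True
  | .scHeadBot _ _ _ _ _ => True
  | .scHeadEnd _ _ _ => True
  | .rlHead _ _ => True
  | _ => False

/-- The process executes SC or RL on `announce[j]`. -/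
def OnAnn (j : Fin n) : PC 𝒪 n → Prop
  | .llAnnounce _ _ _ j' _ (some _) => j' = j
  | .scAnnounce _ _ _ j' _ _ => j' = j
  | .rlAnnounce _ j' _ => j' = j
  | _ => False

theorem waiting_skel (pc : PC 𝒪 n) : Waiting (skel pc) = Waiting pc := by
  cases pc with
  | llAnnounce op q rsp j c right => cases right <;> rfl
  | _ => rfl

theorem onHead_skel (pc : PC 𝒪 n) : OnHead (skel pc) = OnHead pc := by
  cases pc with
  | llAnnounce op q rsp j c right => cases right <;> rfl
  | _ => rfl

theorem onAnn_skel (j : Fin n) (pc : PC 𝒪 n) : OnAnn j (skel pc) = OnAnn j pc := by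
  cases pc with
  | llAnnounce op q rsp j c right => cases right <;> rfl
  | _ => rfl

theorem mustServe_of_waiting {l : LocalState 𝒪 n} (h : Waiting l.pc) (s : Side) :
    mustServe s l := by
  rcases l with ⟨pr, pc⟩
  cases pc with
  | llAnnounce op q rsp j c right => cases right <;> simp_all [Waiting, mustServe]
  | _ => simp_all [Waiting, mustServe]

/-- Under the hypotheses every wait condition is fulfilled, so a right step of a waiting process
changes its `skel`. -/
theorem Trans.not_waiting {p : Fin n} {H H' : HeadCell 𝒪 n}
    {A A' : Fin n → AnnCell 𝒪 n} {l l' : LocalState 𝒪 n} {r : Option 𝒪.Resp}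
    (h : Trans p .right H A l H' A' l' r) (hA : (A p).val.IsRsp) (hH : ¬ HeldFor H p)
    (hs : skel l'.pc = skel l.pc) : ¬ Waiting l.pc := by
  obtain ⟨r, hr⟩ := hA
  cases h with
  | llHeadExit => simp [skel] at hs
  | llHeadWait h => exact absurd hr (h r)
  | llAnnRsp => simp [skel] at hs
  | llAnnWait h => exact absurd hr (h r)
  | endWait h => exact absurd ⟨_, _, h⟩ hH
  | endExit => simp [skel] at hs
  | _ => exact id

/-- The expected cell has the bit of `i` set, so it differs from every cell where this bit is clear:
the CAS is bound to fail, and foreign changes of the cell are irrelevant to the loop. -/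
theorem retryProgress_unlinked {W : Type u} {i : Fin n} {c : Retry W n} (hc : Linked i c)
    {X Y : Cell W n} (hX : X.context i = false) (hY : Y.context i = false) :
    retryProgress X c = retryProgress Y c := by
  cases c with
  | read => rfl
  | cas cur =>
    have := hc cur rfl
    have h1 : cur ≠ X := by rintro rfl; simp_all
    have h2 : cur ≠ Y := by rintro rfl; simp_all
    simp [retryProgress, h1, h2]

theorem ProcInv.loopProgress_onHead {i : Fin n} {H H' : HeadCell 𝒪 n} {A A' : Fin n → AnnCell 𝒪 n}
    {pend : Option 𝒪.Op} {pc : PC 𝒪 n} (hp : ProcInv H A i pend pc) (hpc : OnHead pc)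
    (hH : H.context i = false) (hH' : H'.context i = false) :
    loopProgress H A pc = loopProgress H' A' pc := by
  cases pc with
  | scApply | scHeadBot | scHeadEnd | rlHead => exact retryProgress_unlinked hp.2.1 hH hH'
  | _ => exact hpc.elim

theorem ProcInv.loopProgress_onAnn {i j : Fin n} {H H' : HeadCell 𝒪 n}
    {A A' : Fin n → AnnCell 𝒪 n} {pend : Option 𝒪.Op} {pc : PC 𝒪 n}
    (hp : ProcInv H A i pend pc) (hpc : OnAnn j pc) (hA : (A j).context i = false)
    (hA' : (A' j).context i = false) :
    loopProgress H A pc = loopProgress H' A' pc := by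
  cases pc with
  | llAnnounce op q rsp j' c right =>
    cases right with
    | none => exact hpc.elim
    | some d =>
      obtain rfl : j' = j := hpc
      exact retryProgress_unlinked (hp.2.2 d rfl).2 hA hA'
  | scAnnounce op q rsp j' =>
    obtain rfl : j' = j := hpc
    exact retryProgress_unlinked hp.2.1 hA hA'
  | rlAnnounce op j' =>
    obtain rfl : j' = j := hpc
    exact retryProgress_unlinked hp.2 hA hA'
  | _ => exact hpc.elim

theorem loopProgress_congr_onAnn {j : Fin n} {H H' : HeadCell 𝒪 n} {A A' : Fin n → AnnCell 𝒪 n}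
    {pc : PC 𝒪 n} (hpc : OnAnn j pc) (hA : A' j = A j) :
    loopProgress H A pc = loopProgress H' A' pc := by
  cases pc with
  | llAnnounce op q rsp j' c right =>
    cases right with
    | none => exact hpc.elim
    | some d =>
      obtain rfl : j' = j := hpc
      simp [loopProgress, hA]
  | scAnnounce op q rsp j' =>
    obtain rfl : j' = j := hpc
    simp [loopProgress, hA]
  | rlAnnounce op j' =>
    obtain rfl : j' = j := hpc
    simp [loopProgress, hA]
  | _ => exact hpc.elim

theorem loopProgress_eq_zero {H : HeadCell 𝒪 n} {A : Fin n → AnnCell 𝒪 n} {pc : PC 𝒪 n}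
    (h1 : ¬ Waiting pc) (h2 : ¬ OnHead pc) (h3 : ∀ j, ¬ OnAnn j pc) : loopProgress H A pc = 0 := by
  cases pc with
  | llAnnounce op q rsp j c right =>
    cases right with
    | none => exact absurd trivial h1
    | some d => exact absurd rfl (h3 j)
  | scAnnounce op q rsp j => exact absurd rfl (h3 j)
  | rlAnnounce op j => exact absurd rfl (h3 j)
  | scApply | scHeadBot | scHeadEnd | rlHead => exact absurd trivial h2
  | llHead | llHeadEnd => exact absurd trivial h1
  | _ => rfl

end Universal

namespace Universal

open Filter

/-! ### Infinite executions -/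

/-- Infinitely many strict increases would exceed `B`. The bounded measures enter the wait-freedom
proof through this lemma. -/
theorem eventually_const_of_le {f : ℕ → ℕ} {B : ℕ} (h : ∀ᶠ t in atTop, f t ≤ f (t + 1))
    (hB : ∀ t, f t ≤ B) : ∀ᶠ t in atTop, f (t + 1) = f t := by
  obtain ⟨T, hT⟩ := eventually_atTop.1 h
  by_contra hne
  have hne' := frequently_atTop.1 (not_eventually.1 hne)
  have mono : ∀ t t', T ≤ t → t ≤ t' → f t ≤ f t' := fun t t' ht htt' => by
    induction t', htt' using Nat.le_induction with
    | base => exact le_rfl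
    | succ m hm ih => exact ih.trans (hT m (ht.trans hm))
  have grow : ∀ k, ∃ t, T ≤ t ∧ k ≤ f t := by
    intro k
    induction k with
    | zero => exact ⟨T, le_rfl, Nat.zero_le _⟩
    | succ k ih =>
      obtain ⟨t, ht, hk⟩ := ih
      obtain ⟨t', ht', hlt⟩ := hne' t
      have h1 := mono t t' ht ht'
      have h2 := hT t' (ht.trans ht')
      exact ⟨t' + 1, by omega, by omega⟩
  obtain ⟨t, -, ht⟩ := grow (B + 1)
  have := hB t
  omega

variable {𝒪 : AbstractObject.{u}} {n : ℕ} {ρ : (universalImplementation 𝒪 n).InfExec}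

theorem exists_memStep (ρ : (universalImplementation 𝒪 n).InfExec) (t : ℕ) :
    ∃ p, MemStep p (hd (ρ.cfg t)) (an (ρ.cfg t)) (hd (ρ.cfg (t + 1))) (an (ρ.cfg (t + 1))) := by
  have h := InfExec.confStep ρ t
  have hi := InfExec.inv ρ t
  generalize ρ.act t = a at h
  cases h with
  | invoke p o hpend hd_eq an_eq => rw [hd_eq, an_eq]; exact ⟨p, .silent⟩
  | step p s r hpend trans => exact ⟨p, trans.memStep (hi.proc p)⟩

/-- The state of `head` is changed infinitely often. -/
def HeadActive (ρ : (universalImplementation 𝒪 n).InfExec) : Prop :=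
  ∃ᶠ t in atTop, (hd (ρ.cfg (t + 1))).val ≠ (hd (ρ.cfg t)).val

/-- At time `t`, process `p` applies an operation. -/
def Applies (ρ : (universalImplementation 𝒪 n).InfExec) (p : Fin n) (t : ℕ) : Prop :=
  (∃ s r, ρ.act t = .step p s r) ∧ (hd (ρ.cfg t)).val.2 = none ∧ (hd (ρ.cfg (t + 1))).val.2 ≠ none

/-- An occupied `head` changes only by being released; without a release it would be frozen. -/
theorem HeadActive.exists_release (h : HeadActive ρ) {j : Fin n} {T : ℕ}
    (hT : HeldFor (hd (ρ.cfg T)) j) :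
    ∃ t, T ≤ t ∧ (an (ρ.cfg t) j).val.IsRsp ∧ ¬ HeldFor (hd (ρ.cfg (t + 1))) j := by
  by_contra hne
  push Not at hne
  have hall : ∀ t, T ≤ t → HeldFor (hd (ρ.cfg t)) j := fun t ht => by
    induction t, ht using Nat.le_induction with
    | base => exact hT
    | succ m hm ih =>
      obtain ⟨p, hp⟩ := exists_memStep ρ m
      by_cases hv : (hd (ρ.cfg (m + 1))).val = (hd (ρ.cfg m)).val
      · unfold HeldFor; rw [hv]; exact ih
      · exact hne m hm (hp.of_heldFor ih hv).1
  obtain ⟨t, ht, hv⟩ := frequently_atTop.1 h T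
  obtain ⟨p, hp⟩ := exists_memStep ρ t
  obtain ⟨h1, h2⟩ := hp.of_heldFor (hall t ht) hv
  exact h2 (hne t ht h1)

/-- Value changes of `head` alternate between applications and releases. -/
theorem HeadActive.frequently_applies (h : HeadActive ρ) : ∃ᶠ t in atTop, ∃ p, Applies ρ p t := by
  rw [frequently_atTop]
  intro T
  have hstep : ∀ t, (hd (ρ.cfg t)).val.2 = none → (hd (ρ.cfg (t + 1))).val.2 ≠ none →
      ∃ p, Applies ρ p t := by
    intro t h1 h2
    have hs := InfExec.confStep ρ t
    generalize ha : ρ.act t = a at hs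
    cases hs with
    | invoke p o hpend hd_eq => rw [hd_eq] at h2; exact absurd h1 h2
    | step p s r => exact ⟨p, ⟨s, r, ha⟩, h1, h2⟩
  have hnone : ∃ t, T ≤ t ∧ (hd (ρ.cfg t)).val.2 = none := by
    rcases hv : (hd (ρ.cfg T)).val with ⟨q, _ | ⟨r, j⟩⟩
    · exact ⟨T, le_rfl, by rw [hv]⟩
    · by_contra hne
      push Not at hne
      obtain ⟨t, ht, hv⟩ := frequently_atTop.1 h T
      obtain ⟨p, hp⟩ := exists_memStep ρ t
      rcases hv' : (hd (ρ.cfg t)).val with ⟨q', _ | ⟨r', j'⟩⟩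
      · exact hne t ht (by rw [hv'])
      · have h1 := hne (t + 1) (by omega)
        generalize hd (ρ.cfg (t + 1)) = H' at *
        generalize an (ρ.cfg (t + 1)) = A' at *
        cases hp with
        | apply hH => rw [hH] at hv'; cases hv'
        | headBot => exact h1 rfl
        | _ => exact hv rfl
  obtain ⟨t₀, ht₀, h₀⟩ := hnone
  by_contra hne
  push Not at hne
  have hall : ∀ t, t₀ ≤ t → (hd (ρ.cfg t)).val.2 = none := fun t ht => by
    induction t, ht using Nat.le_induction with
    | base => exact h₀
    | succ m hm ih =>
      by_contra h2
      obtain ⟨p, hp⟩ := hstep m ih h2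
      exact hne m (by omega) p hp
  obtain ⟨t, ht, hv⟩ := frequently_atTop.1 h t₀
  obtain ⟨p, hp⟩ := exists_memStep ρ t
  exact hp.of_none (hall t ht) hv (hall (t + 1) (by omega))

theorem applies_or_priority (ρ : (universalImplementation 𝒪 n).InfExec) (p : Fin n) (t : ℕ) :
    Applies ρ p t ∨ (lo (ρ.cfg (t + 1)) p).priority = (lo (ρ.cfg t) p).priority := by
  have hs := InfExec.confStep ρ t
  have hi := InfExec.inv ρ t
  generalize ha : ρ.act t = a at hs
  cases hs with
  | invoke p' o hpend hd_eq an_eq lo_eq lo_other =>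
    right
    by_cases hp : p = p'
    · subst hp; rw [lo_eq]; rfl
    · rw [lo_other p hp]
  | step p' s r hpend trans lo_other =>
    by_cases hp : p = p'
    · subst hp
      rcases trans.priority (hi.proc p) with ⟨h1, -⟩ | ⟨-, h2, h3, -⟩
      · exact Or.inr h1
      · exact Or.inl ⟨⟨s, r, ha⟩, h2, h3⟩
    · right; rw [lo_other p hp]

theorem Applies.spec {p : Fin n} {t : ℕ} (h : Applies ρ p t) :
    (lo (ρ.cfg (t + 1)) p).priority = succMod (lo (ρ.cfg t) p).priority ∧
    (∃ op, (lo (ρ.cfg (t + 1)) p).pc = .loopTest op) ∧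
    ∃ op st rsp j c, (lo (ρ.cfg t) p).pc = .scApply op st rsp j c ∧
      HeldFor (hd (ρ.cfg (t + 1))) j := by
  obtain ⟨⟨s, r, ha⟩, h1, h2⟩ := h
  have hs := InfExec.confStep ρ t
  have hi := InfExec.inv ρ t
  rw [ha] at hs
  cases hs with
  | step _ _ _ hpend trans lo_other =>
    rcases trans.priority (hi.proc p) with ⟨-, h3⟩ | ⟨h3, -, -, h4, h5⟩
    · exact absurd (h3 h1) h2
    · exact ⟨h3, h4, h5⟩

/-- A process that applies infinitely many operations does so with every priority. -/
theorem exists_applies_with_priority {p : Fin n} (hp : ∃ᶠ t in atTop, Applies ρ p t) (j : Fin n)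
    (T : ℕ) : ∃ t, T ≤ t ∧ Applies ρ p t ∧ (lo (ρ.cfg t) p).priority = j := by
  classical
  have first : ∀ T, ∃ t, T ≤ t ∧ Applies ρ p t ∧
      (lo (ρ.cfg t) p).priority = (lo (ρ.cfg T) p).priority := by
    intro T
    have hex := frequently_atTop.1 hp T
    obtain ⟨h1, h2⟩ := Nat.find_spec hex
    refine ⟨Nat.find hex, h1, h2, ?_⟩
    have : ∀ t, T ≤ t → t ≤ Nat.find hex →
        (lo (ρ.cfg t) p).priority = (lo (ρ.cfg T) p).priority := fun t ht => by
      induction t, ht using Nat.le_induction with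
      | base => exact fun _ => rfl
      | succ m hm ih =>
        intro hle
        rcases applies_or_priority ρ p m with h | h
        · exact absurd ⟨hm, h⟩ (Nat.find_min hex (by omega))
        · rw [h, ih (by omega)]
    exact this _ h1 le_rfl
  -- `k` is the number of applications that bring the priority to `j`; the next application is the
  -- one sought.
  have main : ∀ k T, ((lo (ρ.cfg T) p).priority.1 + k) % n = j.1 →
      ∃ t, T ≤ t ∧ Applies ρ p t ∧ (lo (ρ.cfg t) p).priority = j := by
    intro k
    induction k with
    | zero =>
      intro T h
      obtain ⟨t, h1, h2, h3⟩ := first T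
      refine ⟨t, h1, h2, Fin.ext ?_⟩
      rw [h3, ← h, Nat.add_zero, Nat.mod_eq_of_lt (Fin.is_lt _)]
    | succ k ih =>
      intro T h
      obtain ⟨t, h1, h2, h3⟩ := first T
      obtain ⟨t', h4, h5⟩ := ih (t + 1) (by
        rw [h2.spec.1, h3, ← h]
        simp only [succMod]
        rw [Nat.mod_add_mod]
        congr 1
        omega)
      exact ⟨t', by omega, h5⟩
  -- Adding `n` keeps the subtraction from truncating and disappears modulo `n`.
  refine main (j.1 + n - (lo (ρ.cfg T) p).priority.1) T ?_
  have h1 := (lo (ρ.cfg T) p).priority.2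
  have h2 := j.2
  rw [show (lo (ρ.cfg T) p).priority.1 + (j.1 + n - (lo (ρ.cfg T) p).priority.1) = j.1 + n by omega,
    Nat.add_mod_right, Nat.mod_eq_of_lt h2]

/-- While `head` is active, no announced operation is ignored forever. -/
theorem HeadActive.not_forever_op (h : HeadActive ρ) (j : Fin n) (T : ℕ) :
    ∃ t, T ≤ t ∧ ∀ o, (an (ρ.cfg t) j).val ≠ .op o := by
  by_contra hne
  push Not at hne
  -- Pigeonhole over finitely many processes.
  obtain ⟨p, hp⟩ : ∃ p, ∃ᶠ t in atTop, Applies ρ p t := by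
    by_contra hno
    push Not at hno
    refine h.frequently_applies ?_
    filter_upwards [eventually_all.2 fun p => hno p] with t ht
    rintro ⟨p, hp⟩
    exact ht p hp
  obtain ⟨t₁, ht₁, ha₁⟩ := frequently_atTop.1 hp T
  -- Right after an application `p` is at the loop test, so no target selected earlier survives.
  have hhelps : ∀ t, t₁ + 1 ≤ t → HelpsPriority j (lo (ρ.cfg t) p) := fun t ht => by
    induction t, ht using Nat.le_induction with
    | base =>
      obtain ⟨op, hop⟩ := ha₁.spec.2.1
      intro _
      rw [hop]
      trivial
    | succ m hm ih =>
      obtain ⟨o, ho⟩ := hne m (by omega)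
      have hs := InfExec.confStep ρ m
      generalize ρ.act m = a at hs
      cases hs with
      | invoke p' o' hpend hd_eq an_eq lo_eq lo_other =>
        by_cases hp' : p = p'
        · subst hp'
          intro _
          rw [lo_eq]
          unfold start
          by_cases hro : 𝒪.ReadOnly o'
          · simp [hro]
          · simp [hro]
        · rw [lo_other p hp']; exact ih
      | step p' s r hpend trans lo_other =>
        by_cases hp' : p = p'
        · subst hp'
          exact trans.helpsPriority ho ih
        · rw [lo_other p hp']; exact ih
  obtain ⟨t₂, ht₂, ha₂, hpr⟩ := exists_applies_with_priority hp j (t₁ + 1)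
  obtain ⟨-, -, op, st, rsp, j', c, hpc, hheld⟩ := ha₂.spec
  have hj : j' = j := by
    have := hhelps t₂ ht₂ hpr
    rw [hpc] at this
    exact this
  subst hj
  -- The operation of `j` has been applied, and its release from `head` requires an announced
  -- response.
  obtain ⟨t₃, ht₃, ⟨r, hr⟩, -⟩ := h.exists_release hheld
  obtain ⟨o, ho⟩ := hne t₃ (by omega)
  rw [ho] at hr
  cases hr

/-- While `head` is active and `j` announces no operation, `head` is not occupied by `j`. -/
theorem HeadActive.eventually_not_heldFor (h : HeadActive ρ) {j : Fin n}
    (hj : ∀ᶠ t in atTop, ∀ o, (an (ρ.cfg t) j).val ≠ .op o) :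
    ∀ᶠ t in atTop, ¬ HeldFor (hd (ρ.cfg t)) j := by
  obtain ⟨T, hT⟩ := eventually_atTop.1 hj
  obtain ⟨T', hT', hno⟩ : ∃ T', T ≤ T' ∧ ¬ HeldFor (hd (ρ.cfg T')) j := by
    by_cases hheld : HeldFor (hd (ρ.cfg T)) j
    · obtain ⟨t, ht, -, h'⟩ := h.exists_release hheld
      exact ⟨t + 1, by omega, h'⟩
    · exact ⟨T, le_rfl, hheld⟩
  refine eventually_atTop.2 ⟨T', fun t ht => ?_⟩
  induction t, ht using Nat.le_induction with
  | base => exact hno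
  | succ m hm ih =>
    obtain ⟨p, hp⟩ := exists_memStep ρ m
    exact hp.not_heldFor (hT m (by omega)) ih

/-- While `head` is active, an entry of `announce` in which a context bit stays set becomes
constant. -/
theorem HeadActive.eventually_ann_const (h : HeadActive ρ) {i j : Fin n} {T : ℕ}
    (hT : ∀ t, T ≤ t → (an (ρ.cfg t) j).context i = true) :
    ∀ᶠ t in atTop, an (ρ.cfg (t + 1)) j = an (ρ.cfg t) j := by
  -- A change of the value would erase the bit of `i`.
  have hval : ∀ t, T ≤ t → (an (ρ.cfg (t + 1)) j).val = (an (ρ.cfg t) j).val := by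
    intro t ht
    by_contra hne
    obtain ⟨p, hp⟩ := exists_memStep ρ t
    have := hp.ann_context hne i
    rw [hT (t + 1) (by omega)] at this
    cases this
  have hop : ∀ t, T ≤ t → ∀ o, (an (ρ.cfg t) j).val ≠ .op o := by
    intro t ht o ho
    have hall : ∀ t', t ≤ t' → (an (ρ.cfg t') j).val = .op o := fun t' ht' => by
      induction t', ht' using Nat.le_induction with
      | base => exact ho
      | succ m hm ih => rw [hval m (by omega), ih]
    obtain ⟨t', ht', hne⟩ := h.not_forever_op j t
    exact hne o (hall t' ht')
  have hheld := h.eventually_not_heldFor (j := j) (eventually_atTop.2 ⟨T, hop⟩)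
  -- Only context bits can still change, no new visit to `announce[j]` begins, and each change
  -- advances some bounded `visit`.
  have key : ∀ᶠ t in atTop, ∀ p,
      (an (ρ.cfg (t + 1)) j = an (ρ.cfg t) j ∨
        ∃ p, visit j (lo (ρ.cfg t) p).pc < visit j (lo (ρ.cfg (t + 1)) p).pc) ∧
      visit j (lo (ρ.cfg t) p).pc ≤ visit j (lo (ρ.cfg (t + 1)) p).pc := by
    filter_upwards [hheld, eventually_ge_atTop T] with t hh ht p
    have hs := InfExec.confStep ρ t
    have hi := InfExec.inv ρ t
    generalize ρ.act t = a at hs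
    cases hs with
    | invoke p' o' hpend hd_eq an_eq lo_eq lo_other =>
      rw [an_eq]
      refine ⟨Or.inl rfl, ?_⟩
      by_cases hp' : p = p'
      · subst hp'
        rw [lo_eq]
        have : visit j (start o' (lo (ρ.cfg t) p)).pc = 3 := by
          unfold start
          by_cases hro : 𝒪.ReadOnly o'
          · simp [hro, visit]
          · simp [hro, visit]
        rw [this]
        exact visit_le _ _
      · rw [lo_other p hp']
    | step p' s r hpend trans lo_other =>
      have := trans.visit (hi.proc p') hh (hval t ht)
      refine ⟨?_, ?_⟩
      · rcases this with h | h
        · exact Or.inl h.1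
        · exact Or.inr ⟨p', h⟩
      · by_cases hp' : p = p'
        · subst hp'
          rcases this with h | h
          · exact h.2
          · exact h.le
        · rw [lo_other p hp']
  have hconst : ∀ᶠ t in atTop, ∀ p, visit j (lo (ρ.cfg (t + 1)) p).pc =
      visit j (lo (ρ.cfg t) p).pc :=
    eventually_all.2 fun p => eventually_const_of_le (f := fun t => visit j (lo (ρ.cfg t) p).pc)
      (key.mono fun t ht => (ht p).2) fun t => visit_le _ _
  filter_upwards [key, hconst] with t h1 h2
  rcases (h1 i).1 with h | ⟨p, hp⟩
  · exact h
  · have := h2 p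
    omega

end Universal

/-! ### Wait-freedom: no process is stuck -/

namespace Universal

open Filter

variable {𝒪 : AbstractObject.{u}} {n : ℕ} {ρ : (universalImplementation 𝒪 n).InfExec} {i : Fin n}

/-- From time `T` on, process `i` has a pending operation that never returns, although `i` takes
infinitely many steps. -/
structure Stuck (ρ : (universalImplementation 𝒪 n).InfExec) (i : Fin n) (T : ℕ) : Prop where
  fair : ρ.FairInterleaving
  steps : ρ.StepsInfinitely i
  pending : ∀ t, T ≤ t → (ρ.cfg t).pending i ≠ none
  no_return : ∀ t, T ≤ t → ∀ s r, ρ.act t = .step i s r → r = none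

theorem Stuck.exists_step {T : ℕ} (h : Stuck ρ i T) (T' : ℕ) :
    ∃ t, T' ≤ t ∧ ∃ s r, ρ.act t = .step i s r := by
  obtain ⟨t, ht, hlt⟩ := h.steps.exists_gt T'
  exact ⟨t, hlt.le, ht⟩

/-- A step of the stuck process, or of another one. -/
theorem Stuck.step_cases {T : ℕ} (h : Stuck ρ i T) {t : ℕ} (ht : T ≤ t) :
    (∃ s, ρ.act t = .step i s none ∧
      Trans i s (hd (ρ.cfg t)) (an (ρ.cfg t)) (lo (ρ.cfg t) i) (hd (ρ.cfg (t + 1)))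
        (an (ρ.cfg (t + 1))) (lo (ρ.cfg (t + 1)) i) none) ∨
    ((∀ s r, ρ.act t ≠ .step i s r) ∧ lo (ρ.cfg (t + 1)) i = lo (ρ.cfg t) i ∧
      ∃ p, i ≠ p ∧
        MemStep p (hd (ρ.cfg t)) (an (ρ.cfg t)) (hd (ρ.cfg (t + 1))) (an (ρ.cfg (t + 1)))) := by
  have hs := InfExec.confStep ρ t
  have hi := InfExec.inv ρ t
  have hret := h.no_return t ht
  generalize ρ.act t = a at hs hret
  cases hs with
  | invoke p o hpend hd_eq an_eq lo_eq lo_other =>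
    have hp : i ≠ p := by rintro rfl; exact h.pending t ht hpend
    rw [hd_eq, an_eq]
    exact Or.inr ⟨fun s r hsr => (nomatch hsr), lo_other i hp, p, hp, .silent⟩
  | step p s r hpend trans lo_other =>
    by_cases hp : i = p
    · subst hp
      obtain rfl := hret s r rfl
      exact Or.inl ⟨s, rfl, trans⟩
    · refine Or.inr ⟨fun s' r' hsr => ?_, lo_other i hp, p, hp, trans.memStep (hi.proc p)⟩
      cases hsr
      exact hp rfl

/-- A pending process with an empty announcement either returns in its next step or announces its
operation, and the entry is emptied only in a step that returns. -/
theorem Stuck.eventually_ne_bot {T : ℕ} (h : Stuck ρ i T) :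
    ∀ᶠ t in atTop, (an (ρ.cfg t) i).val ≠ .bot := by
  have hstep : ∀ t, T ≤ t → (∃ s r, ρ.act t = .step i s r) ∨ (an (ρ.cfg t) i).val ≠ .bot →
      (an (ρ.cfg (t + 1)) i).val ≠ .bot := by
    intro t ht hor
    have hi := (InfExec.inv ρ t).proc i
    rcases h.step_cases ht with ⟨s, ha, trans⟩ | ⟨hno, -, p, hp, hm⟩
    · by_cases hb : (an (ρ.cfg t) i).val = .bot
      · generalize hd (ρ.cfg (t + 1)) = H', an (ρ.cfg (t + 1)) = A', lo (ρ.cfg (t + 1)) i = l',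
          an (ρ.cfg t) = A, hd (ρ.cfg t) = H, lo (ρ.cfg t) i = l at *
        cases trans <;> simp_all [ProcInv, Looping, Finishing, AnnVal.IsRsp, Cell.fresh]
      · intro hb'
        rcases (trans.memStep hi).ann_val (fun e => hb (e.symm.trans hb')) with
          ⟨o, -, ⟨r, h2⟩, -⟩ | ⟨h1, -⟩ | ⟨⟨r', h1⟩, -⟩
        · rw [hb'] at h2; cases h2
        · exact hb h1
        · generalize hd (ρ.cfg (t + 1)) = H', an (ρ.cfg (t + 1)) = A', lo (ρ.cfg (t + 1)) i = l',
            an (ρ.cfg t) = A, hd (ρ.cfg t) = H, lo (ρ.cfg t) i = l at *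
          cases trans <;>
            simp_all [ProcInv, Looping, AnnVal.IsRsp, Cell.fresh, Function.update_apply,
              Cell.setBit] <;> grind
    · have hb : (an (ρ.cfg t) i).val ≠ .bot := by
        rcases hor with ⟨s, r, hsr⟩ | hb
        · exact absurd hsr (hno s r)
        · exact hb
      intro hb'
      rcases hm.ann_val (fun e => hb (e.symm.trans hb')) with
        ⟨o, -, ⟨r, h2⟩, -⟩ | ⟨h1, -⟩ | ⟨-, -, -, h4⟩
      · rw [hb'] at h2; cases h2
      · exact hb h1
      · exact hp h4
  obtain ⟨t₀, ht₀, ha⟩ := h.exists_step T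
  refine eventually_atTop.2 ⟨t₀ + 1, fun t ht => ?_⟩
  induction t, ht using Nat.le_induction with
  | base => exact hstep t₀ ht₀ (Or.inl ha)
  | succ m hm ih => exact hstep m (by omega) (Or.inr ih)

theorem ann_isRsp_succ {T : ℕ} (hb : ∀ t, T ≤ t → (an (ρ.cfg t) i).val ≠ .bot)
    {t : ℕ} (ht : T ≤ t) (hr : (an (ρ.cfg t) i).val.IsRsp) :
    (an (ρ.cfg (t + 1)) i).val.IsRsp := by
  obtain ⟨p, hm⟩ := exists_memStep ρ t
  by_cases hv : (an (ρ.cfg (t + 1)) i).val = (an (ρ.cfg t) i).val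
  · rw [hv]; exact hr
  · rcases hm.ann_val hv with ⟨o, h1, -⟩ | ⟨h1, -⟩ | ⟨-, h2, -⟩
    · obtain ⟨r, hr⟩ := hr; rw [h1] at hr; cases hr
    · exact absurd h1 (hb t ht)
    · exact absurd h2 (hb (t + 1) (by omega))

theorem skel_eq_of_eventually {T : ℕ}
    (h : ∀ t, T ≤ t → skel (lo (ρ.cfg (t + 1)) i).pc = skel (lo (ρ.cfg t) i).pc) {t : ℕ}
    (ht : T ≤ t) : skel (lo (ρ.cfg t) i).pc = skel (lo (ρ.cfg T) i).pc := by
  induction t, ht using Nat.le_induction with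
  | base => rfl
  | succ m hm ih => rw [h m hm, ih]

/-- A stuck process does not stay forever in a retry loop that makes progress. -/
theorem Stuck.false_of_loopProgress {T : ℕ} (h : Stuck ρ i T)
    (hskel : ∀ᶠ t in atTop, skel (lo (ρ.cfg (t + 1)) i).pc = skel (lo (ρ.cfg t) i).pc)
    (hown : ∀ᶠ t in atTop, ∀ s r, ρ.act t = .step i s r →
      hd (ρ.cfg (t + 1)) = hd (ρ.cfg t) ∧ an (ρ.cfg (t + 1)) = an (ρ.cfg t))
    (hother : ∀ᶠ t in atTop, (∀ s r, ρ.act t ≠ .step i s r) →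
      loopProgress (hd (ρ.cfg t)) (an (ρ.cfg t)) (lo (ρ.cfg t) i).pc ≤
        loopProgress (hd (ρ.cfg (t + 1))) (an (ρ.cfg (t + 1))) (lo (ρ.cfg t) i).pc) : False := by
  have hmono : ∀ᶠ t in atTop,
      loopProgress (hd (ρ.cfg t)) (an (ρ.cfg t)) (lo (ρ.cfg t) i).pc ≤
        loopProgress (hd (ρ.cfg (t + 1))) (an (ρ.cfg (t + 1))) (lo (ρ.cfg (t + 1)) i).pc := by
    filter_upwards [hskel, hown, hother, eventually_ge_atTop T] with t h1 h2 h3 ht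
    rcases h.step_cases ht with ⟨s, ha, trans⟩ | ⟨hno, hlo, -⟩
    · obtain ⟨h4, h5⟩ := h2 s _ ha
      have := (trans.loopProgress_of_skel ((InfExec.inv ρ t).proc i) h1).1
      rw [h4, h5]
      exact this
    · rw [hlo]
      exact h3 hno
  have hconst := eventually_const_of_le
    (f := fun t => loopProgress (hd (ρ.cfg t)) (an (ρ.cfg t)) (lo (ρ.cfg t) i).pc) hmono
    fun t => loopProgress_le _ _ _
  obtain ⟨T', hT'⟩ := eventually_atTop.1
    (hskel.and (hown.and (hconst.and (eventually_ge_atTop T))))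
  have hsk : ∀ t, T' ≤ t → skel (lo (ρ.cfg t) i).pc = skel (lo (ρ.cfg T') i).pc :=
    fun t ht => skel_eq_of_eventually (fun t ht => (hT' t ht).1) ht
  have hneed : ∀ t, T' ≤ t → needed (lo (ρ.cfg t) i).pc = needed (lo (ρ.cfg T') i).pc := by
    intro t ht
    rw [← needed_skel, hsk t ht, needed_skel]
  -- Fairness yields a step on the side where the retry loop runs; outside interleaved blocks any
  -- step will do. Such a step raises the progress, which is already constant.
  obtain ⟨t, ht, s, r, ha, hs⟩ : ∃ t, T' ≤ t ∧ ∃ s r, ρ.act t = .step i s r ∧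
      ∀ s', needed (lo (ρ.cfg t) i).pc = some s' → s' = s := by
    rcases hn : needed (lo (ρ.cfg T') i).pc with _ | s
    · obtain ⟨t, ht, s, r, ha⟩ := h.exists_step T'
      refine ⟨t, ht, s, r, ha, fun s' hs' => ?_⟩
      rw [hneed t ht, hn] at hs'
      cases hs'
    · obtain ⟨t, r, ht, ha⟩ := h.fair i s T' h.steps fun t ht =>
        mustServe_of_needed (by rw [← hn]; exact hneed t ht)
      refine ⟨t, ht, s, r, ha, fun s' hs' => ?_⟩
      rw [hneed t ht, hn] at hs'
      cases hs'
      rfl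
  obtain ⟨h1, h2, h3, h4⟩ := hT' t ht
  rcases h.step_cases h4 with ⟨s', ha', trans⟩ | ⟨hno, -⟩
  · rw [ha] at ha'
    cases ha'
    have := (trans.loopProgress_of_skel ((InfExec.inv ρ t).proc i) h1).2 hs
    obtain ⟨h5, h6⟩ := h2 s _ ha
    rw [h5, h6] at h3
    omega
  · exact hno s r ha

/-- Freezing in stages: if the value of `head` is constant, `valuePotential` makes the announced
values constant, and then `rank` does the same for the context bits. In constant memory a retry loop
reads the current cell and its CAS succeeds. -/
theorem Stuck.headActive {T : ℕ} (h : Stuck ρ i T) : HeadActive ρ := by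
  by_contra hna
  have hhead : ∀ᶠ t in atTop, (hd (ρ.cfg (t + 1))).val = (hd (ρ.cfg t)).val := by
    simpa [HeadActive] using hna
  have hann : ∀ᶠ t in atTop, ∀ j, (an (ρ.cfg (t + 1)) j).val = (an (ρ.cfg t) j).val := by
    refine eventually_all.2 fun j => ?_
    have hpot : ∀ᶠ t in atTop, (an (ρ.cfg (t + 1)) j).val = (an (ρ.cfg t) j).val ∧
        valuePotential (hd (ρ.cfg t)) j (an (ρ.cfg t) j).val =
          valuePotential (hd (ρ.cfg (t + 1))) j (an (ρ.cfg (t + 1)) j).val ∨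
        valuePotential (hd (ρ.cfg t)) j (an (ρ.cfg t) j).val <
          valuePotential (hd (ρ.cfg (t + 1))) j (an (ρ.cfg (t + 1)) j).val := by
      filter_upwards [hhead] with t ht
      obtain ⟨p, hm⟩ := exists_memStep ρ t
      rcases hm.valuePotential j (InfExec.inv ρ t).head ht with h | h
      · left
        refine ⟨h, ?_⟩
        rw [h]
        have hh : HeldFor (hd (ρ.cfg (t + 1))) j = HeldFor (hd (ρ.cfg t)) j := by
          unfold HeldFor; rw [ht]
        by_cases hb : HeldFor (hd (ρ.cfg t)) j <;>
          cases (an (ρ.cfg t) j).val <;> simp [valuePotential, hh, hb]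
      · exact Or.inr h
    have hconst := eventually_const_of_le
      (f := fun t => valuePotential (hd (ρ.cfg t)) j (an (ρ.cfg t) j).val) (B := 2)
      (hpot.mono fun t ht => by rcases ht with h | h <;> omega) fun t => valuePotential_le _ _ _
    filter_upwards [hpot, hconst] with t h1 h2
    rcases h1 with h1 | h1
    · exact h1.1
    · omega
  have hrank : ∀ᶠ t in atTop, ∀ p,
      rank (an (ρ.cfg t) p).val ((hd (ρ.cfg t)).context p) (lo (ρ.cfg t) p).pc ≤
        rank (an (ρ.cfg (t + 1)) p).val ((hd (ρ.cfg (t + 1))).context p)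
          (lo (ρ.cfg (t + 1)) p).pc := by
    filter_upwards [hhead, hann] with t h1 h2 p
    have hs := InfExec.confStep ρ t
    have hi := InfExec.inv ρ t
    generalize ρ.act t = a at hs
    cases hs with
    | invoke p' o' hpend hd_eq an_eq lo_eq lo_other =>
      rw [hd_eq, an_eq]
      by_cases hp : p = p'
      -- The invoked process has an empty announcement, and then the rank is 0 at every program
      -- counter.
      · subst hp
        have hb : (an (ρ.cfg t) p).val = .bot := by
          have := hi.proc p
          rw [hpend] at this
          cases h : (lo (ρ.cfg t) p).pc <;> simp_all [ProcInv, Looping, Finishing]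
        rw [hb]
        exact le_rfl
      · rw [lo_other p hp]
    | step p' s r hpend trans lo_other =>
      by_cases hp : p = p'
      · subst hp
        rcases trans.rank_lt (hi.proc p) h1 h2 with ⟨h3, h4, h5⟩ | h3
        · rw [h3, h4]
          by_cases hb : (an (ρ.cfg t) p).val = .bot
          · rw [hb]; exact le_rfl
          · exact (rank_congr _ _ (h5 hb)).ge
        · exact h3.le
      · rw [lo_other p hp, h2 p, (trans.memStep (hi.proc p')).head_context_of_ne hp h1]
  have hconst : ∀ᶠ t in atTop, ∀ p,
      rank (an (ρ.cfg (t + 1)) p).val ((hd (ρ.cfg (t + 1))).context p) (lo (ρ.cfg (t + 1)) p).pc =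
        rank (an (ρ.cfg t) p).val ((hd (ρ.cfg t)).context p) (lo (ρ.cfg t) p).pc :=
    eventually_all.2 fun p => eventually_const_of_le
      (f := fun t => rank (an (ρ.cfg t) p).val ((hd (ρ.cfg t)).context p) (lo (ρ.cfg t) p).pc)
      (hrank.mono fun t ht => ht p) fun t => rank_le _ _ _
  have hmem : ∀ᶠ t in atTop, hd (ρ.cfg (t + 1)) = hd (ρ.cfg t) ∧
      an (ρ.cfg (t + 1)) = an (ρ.cfg t) := by
    filter_upwards [hhead, hann, hconst] with t h1 h2 h3
    have hs := InfExec.confStep ρ t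
    have hi := InfExec.inv ρ t
    generalize ρ.act t = a at hs
    cases hs with
    | invoke p' o' hpend hd_eq an_eq => exact ⟨hd_eq, an_eq⟩
    | step p s r hpend trans =>
      rcases trans.rank_lt (hi.proc p) h1 h2 with ⟨h4, h5, -⟩ | h4
      · exact ⟨h4, h5⟩
      · have := h3 p
        omega
  refine h.false_of_loopProgress ?_ (hmem.mono fun t ht _ _ _ => ht) ?_
  · filter_upwards [hhead, hann, hconst, h.eventually_ne_bot, eventually_ge_atTop T]
      with t h1 h2 h3 h4 ht
    rcases h.step_cases ht with ⟨s, -, trans⟩ | ⟨-, hlo, -⟩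
    · rcases trans.rank_lt ((InfExec.inv ρ t).proc i) h1 h2 with ⟨-, -, h5⟩ | h5
      · exact h5 h4
      · have := h3 i
        omega
    · rw [hlo]
  · filter_upwards [hmem] with t ht _
    rw [ht.1, ht.2]

/-- An active `head` ensures that the operation of `i` is answered and that `head` is eventually
never held for `i`. Then `position` becomes constant, so `i` remains at one place and its own steps
no longer alter the memory. It remains to see that foreign steps do not reduce `loopProgress` there.
-/
theorem Stuck.elim {T : ℕ} (h : Stuck ρ i T) : False := by
  have hact := h.headActive
  obtain ⟨T₁, hT₁⟩ := eventually_atTop.1 (h.eventually_ne_bot.and (eventually_ge_atTop T))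
  have hrsp : ∀ᶠ t in atTop, (an (ρ.cfg t) i).val.IsRsp := by
    obtain ⟨t₀, ht₀, hop⟩ := hact.not_forever_op i T₁
    refine eventually_atTop.2 ⟨t₀, fun t ht => ?_⟩
    induction t, ht using Nat.le_induction with
    | base =>
      rcases hv : (an (ρ.cfg t₀) i).val with _ | o | r
      · exact absurd hv (hT₁ t₀ ht₀).1
      · exact absurd hv (hop o)
      · exact ⟨r, rfl⟩
    | succ m hm ih => exact ann_isRsp_succ (fun t ht => (hT₁ t ht).1) (by omega) ih
  have hheld : ∀ᶠ t in atTop, ¬ HeldFor (hd (ρ.cfg t)) i :=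
    hact.eventually_not_heldFor (hrsp.mono fun t ⟨r, hr⟩ o ho => by rw [hr] at ho; cases ho)
  have hpos : ∀ᶠ t in atTop, position (lo (ρ.cfg (t + 1)) i).pc = position (lo (ρ.cfg t) i).pc := by
    refine eventually_const_of_le (f := fun t => position (lo (ρ.cfg t) i).pc) ?_
      fun t => position_le _
    filter_upwards [hrsp, eventually_ge_atTop T] with t h1 ht
    rcases h.step_cases ht with ⟨s, -, trans⟩ | ⟨-, hlo, -⟩
    · rcases trans.skel_or_position_lt ((InfExec.inv ρ t).proc i) h1 with ⟨h2, -⟩ | h2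
      · exact (position_congr h2).ge
      · exact h2.le
    · rw [hlo]
  have hskel : ∀ᶠ t in atTop, skel (lo (ρ.cfg (t + 1)) i).pc = skel (lo (ρ.cfg t) i).pc ∧
      ∀ s r, ρ.act t = .step i s r →
        hd (ρ.cfg (t + 1)) = hd (ρ.cfg t) ∧ an (ρ.cfg (t + 1)) = an (ρ.cfg t) := by
    filter_upwards [hrsp, hpos, eventually_ge_atTop T] with t h1 h2 ht
    rcases h.step_cases ht with ⟨s, -, trans⟩ | ⟨hno, hlo, -⟩
    · rcases trans.skel_or_position_lt ((InfExec.inv ρ t).proc i) h1 with ⟨h3, h4, h5⟩ | h3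
      · exact ⟨h3, fun _ _ _ => ⟨h4, h5⟩⟩
      · omega
    · exact ⟨by rw [hlo], fun s r hsr => absurd hsr (hno s r)⟩
  obtain ⟨T₂, hT₂⟩ := eventually_atTop.1
    (hskel.and (hrsp.and (hheld.and (eventually_ge_atTop T))))
  have hsk : ∀ t, T₂ ≤ t → skel (lo (ρ.cfg t) i).pc = skel (lo (ρ.cfg T₂) i).pc :=
    fun t ht => skel_eq_of_eventually (fun t ht => (hT₂ t ht).1.1) ht
  have hwait : ¬ Waiting (lo (ρ.cfg T₂) i).pc := by
    intro hw
    have hw' : ∀ t, T₂ ≤ t → Waiting (lo (ρ.cfg t) i).pc := fun t ht => by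
      rw [← waiting_skel, hsk t ht, waiting_skel]; exact hw
    obtain ⟨t, r, ht, ha⟩ := h.fair i .right T₂ h.steps fun t ht =>
      mustServe_of_waiting (hw' t ht) _
    obtain ⟨⟨h1, -⟩, h2, h3, h4⟩ := hT₂ t ht
    rcases h.step_cases h4 with ⟨s', ha', trans⟩ | ⟨hno, -⟩
    · rw [ha] at ha'
      cases ha'
      exact trans.not_waiting h2 h3 h1 (hw' t ht)
    · exact hno _ _ ha
  have hwait' : ∀ t, T₂ ≤ t → ¬ Waiting (lo (ρ.cfg t) i).pc := fun t ht => by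
    rw [← waiting_skel, hsk t ht, waiting_skel]; exact hwait
  refine h.false_of_loopProgress (hskel.mono fun t ht => ht.1) (hskel.mono fun t ht => ht.2) ?_
  by_cases hon : OnHead (lo (ρ.cfg T₂) i).pc
  · have hon' : ∀ t, T₂ ≤ t → OnHead (lo (ρ.cfg t) i).pc := fun t ht => by
      rw [← onHead_skel, hsk t ht, onHead_skel]; exact hon
    -- The next value change of `head` clears the bit of `i`, which only `i` could set again.
    obtain ⟨t₀, ht₀, hne⟩ := frequently_atTop.1 hact T₂
    have hctx : ∀ t, t₀ + 1 ≤ t → (hd (ρ.cfg t)).context i = false := fun t ht => by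
      induction t, ht using Nat.le_induction with
      | base =>
        obtain ⟨p, hm⟩ := exists_memStep ρ t₀
        exact hm.head_context hne i
      | succ m hm ih =>
        obtain ⟨⟨-, h2⟩, -, -, h4⟩ := hT₂ m (by omega)
        rcases h.step_cases h4 with ⟨s', ha', -⟩ | ⟨-, -, p, hp, hm⟩
        · rw [(h2 _ _ ha').1]; exact ih
        · exact hm.head_context_false hp ih
    filter_upwards [eventually_ge_atTop (t₀ + 1)] with t ht _
    exact (((InfExec.inv ρ t).proc i).loopProgress_onHead (hon' t (by omega)) (hctx t ht)
      (hctx (t + 1) (by omega))).le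
  · by_cases hann : ∃ j, OnAnn j (lo (ρ.cfg T₂) i).pc
    · obtain ⟨j, hj⟩ := hann
      have hj' : ∀ t, T₂ ≤ t → OnAnn j (lo (ρ.cfg t) i).pc := fun t ht => by
        rw [← onAnn_skel, hsk t ht, onAnn_skel]; exact hj
      -- Entries of `announce` need not change infinitely often, so the bit may survive; then the
      -- entry becomes constant. If the bit is ever lost, it stays lost.
      by_cases hset : ∀ t, T₂ ≤ t → (an (ρ.cfg t) j).context i = true
      · filter_upwards [hact.eventually_ann_const hset, eventually_ge_atTop T₂] with t h1 ht _
        exact (loopProgress_congr_onAnn (hj' t ht) h1).le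
      · push Not at hset
        obtain ⟨t₀, ht₀, hne⟩ := hset
        have hctx : ∀ t, t₀ ≤ t → (an (ρ.cfg t) j).context i = false := fun t ht => by
          induction t, ht using Nat.le_induction with
          | base => simpa using hne
          | succ m hm ih =>
            obtain ⟨⟨-, h2⟩, -, -, h4⟩ := hT₂ m (by omega)
            rcases h.step_cases h4 with ⟨s', ha', -⟩ | ⟨-, -, p, hp, hm⟩
            · rw [(h2 _ _ ha').2]; exact ih
            · exact hm.ann_context_false hp ih
        filter_upwards [eventually_ge_atTop t₀] with t ht _
        exact (((InfExec.inv ρ t).proc i).loopProgress_onAnn (hj' t (by omega)) (hctx t ht)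
          (hctx (t + 1) (by omega))).le
    · filter_upwards [eventually_ge_atTop T₂] with t ht _
      refine (loopProgress_eq_zero (hwait' t ht) ?_ ?_).le.trans (Nat.zero_le _)
      · rw [← onHead_skel, hsk t ht, onHead_skel]; exact hon
      · intro j hj
        rw [← onAnn_skel, hsk t ht, onAnn_skel] at hj
        exact hann ⟨j, hj⟩

/-- If no response follows the invocation, the operation stays pending, since a pending process
accepts no invocation; thus its process is `Stuck`. -/
theorem waitFree : (universalImplementation 𝒪 n).WaitFree := by
  intro ρ hfair t₀ i o hinv hsteps
  by_contra hno
  push Not at hno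
  have hact₀ : ρ.act t₀ = .invoke i o := by
    simp only [Implementation.InfExec.history] at hinv
    generalize ρ.act t₀ = a at hinv
    cases a with
    | invoke p o' => cases hinv; rfl
    | step p s r => cases r <;> cases hinv
  have key : ∀ t, t₀ + 1 ≤ t → (ρ.cfg t).pending i ≠ none ∧
      ∀ x, t₀ < x → x < t → ∀ e, ρ.history x = some e → e.proc ≠ i := fun t ht => by
    induction t, ht using Nat.le_induction with
    | base =>
      refine ⟨?_, fun x h1 h2 => by omega⟩
      have hs := InfExec.confStep ρ t₀
      rw [hact₀] at hs
      cases hs with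
      | invoke _ _ hpend hd_eq an_eq lo_eq lo_other pending_eq =>
        rw [pending_eq, Function.update_self]; simp
    | succ m hm ih =>
      obtain ⟨h1, h2⟩ := ih
      have hs := InfExec.confStep ρ m
      have hm' : (ρ.cfg (m + 1)).pending i ≠ none ∧
          ∀ e, ρ.history m = some e → e.proc ≠ i := by
        simp only [Implementation.InfExec.history]
        generalize ha : ρ.act m = a at hs
        cases hs with
        | invoke p o' hpend hd_eq an_eq lo_eq lo_other pending_eq =>
          have hp : i ≠ p := by rintro rfl; exact h1 hpend
          rw [pending_eq, Function.update_of_ne hp]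
          refine ⟨h1, fun e he => ?_⟩
          cases he
          exact hp.symm
        | step p s r hpend trans lo_other pending_eq pending_other =>
          by_cases hp : i = p
          · subst hp
            cases r with
            | none => exact ⟨by rw [pending_eq]; exact h1, fun e he => by cases he⟩
            | some r =>
              refine absurd ⟨i, o, hinv, by omega, ?_, h2⟩ (hno m r)
              simp only [Implementation.InfExec.history]
              rw [ha]
              rfl
          · rw [pending_other i hp]
            refine ⟨h1, fun e he => ?_⟩
            cases r with
            | none => cases he
            | some r => cases he; exact Ne.symm hp
      refine ⟨hm'.1, fun x hx hx' e he => ?_⟩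
      by_cases hxm : x = m
      · subst hxm; exact hm'.2 e he
      · exact h2 x hx (by omega) e he
  refine Stuck.elim (ρ := ρ) (i := i) (T := t₀ + 1)
    ⟨hfair, hsteps, fun t ht => (key t ht).1, fun t ht s r ha => ?_⟩
  cases r with
  | none => rfl
  | some r =>
    refine absurd rfl ((key (t + 1) (by omega)).2 t (by omega) (by omega) (.res i r) ?_)
    simp only [Implementation.InfExec.history]
    rw [ha]
    rfl

end Universal

/-! ### Sizes of the CAS objects -/

namespace Universal

/-- A cell is a value with one bit per process. -/
def cellEquiv (W : Type u) (n : ℕ) : Cell W n ≃ W × (Fin n → Bool) where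
  toFun c := (c.val, c.context)
  invFun x := ⟨x.1, x.2⟩
  left_inv _ := rfl
  right_inv _ := rfl

theorem card_cell (W : Type u) (n : ℕ) : Nat.card (Cell W n) = Nat.card W * 2 ^ n := by
  rw [Nat.card_congr (cellEquiv W n), Nat.card_prod, Nat.card_fun]
  simp

/-- Announced values as a sum type. -/
def annValEquiv (𝒪 : AbstractObject.{u}) : AnnVal 𝒪 ≃ Option (𝒪.Op ⊕ 𝒪.Resp) where
  toFun
    | .bot => none
    | .op o => some (.inl o)
    | .rsp r => some (.inr r)
  invFun
    | none => .bot
    | some (.inl o) => .op o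
    | some (.inr r) => .rsp r
  left_inv a := by cases a <;> rfl
  right_inv a := by rcases a with _ | _ | _ <;> rfl

theorem card_headVal (𝒪 : AbstractObject.{u}) (n : ℕ) [Finite 𝒪.Resp] :
    Nat.card (HeadVal 𝒪 n) = Nat.card 𝒪.State * (n * Nat.card 𝒪.Resp + 1) := by
  rw [Nat.card_prod, Finite.card_option, Nat.card_prod, Nat.card_fin, mul_comm n]

theorem card_annVal (𝒪 : AbstractObject.{u}) [Finite 𝒪.Op] [Finite 𝒪.Resp] :
    Nat.card (AnnVal 𝒪) = Nat.card 𝒪.Op + Nat.card 𝒪.Resp + 1 := by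
  rw [Nat.card_congr (annValEquiv 𝒪), Finite.card_option, Nat.card_sum]

end Universal

theorem mainTheorem4 (𝒪 : AbstractObject.{u}) (n : ℕ) :
    (universalImplementation 𝒪 n).Linearizable ∧
    (universalImplementation 𝒪 n).WaitFree ∧
    (universalImplementation 𝒪 n).StateQuiescentHI ∧
    (Finite 𝒪.State → Finite 𝒪.Op → Finite 𝒪.Resp →
      Nat.card ((universalImplementation 𝒪 n).Val Universal.Var.head) =
        Nat.card 𝒪.State * (n * Nat.card 𝒪.Resp + 1) * 2 ^ n ∧
      ∀ j : Fin n, Nat.card ((universalImplementation 𝒪 n).Val (Universal.Var.announce j)) =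
        (Nat.card 𝒪.Op + Nat.card 𝒪.Resp + 1) * 2 ^ n) := by
  refine ⟨Universal.linearizable, Universal.waitFree, Universal.stateQuiescentHI, ?_⟩
  intro _ _ _
  refine ⟨?_, fun j => ?_⟩
  · exact (Universal.card_cell (Universal.HeadVal 𝒪 n) n).trans
      (congrArg (· * 2 ^ n) (Universal.card_headVal 𝒪 n))
  · exact (Universal.card_cell (Universal.AnnVal 𝒪) n).trans
      (congrArg (· * 2 ^ n) (Universal.card_annVal 𝒪))
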